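/- Let $c>0$ be a real number and, for $N\ge 1$, let $n=n(N)=\lfloor cN^2\rfloor$. Let $T_N$ be the representation of the unitary group $U(N)$ in $(\mathbb C^N)^{\otimes n}$ given by $g(v_1\otimes\cdots\otimes v_n)=gv_1\otimes\cdots\otimes gv_n$. Write $T_N=\bigoplus_{\lambda}c_\lambda\pi^\lambda$, where $\lambda$ runs over the signatures $\lambda_1\ge\dots\ge\lambda_N$ ($\lambda_i\in\mathbb Z$) and $\pi^\lambda$ is the irreducible representation of $U(N)$ with highest weight $\lambda$, and let $\rho_N$ be the Schur–Weyl measure, i.e. the probability measure $\rho_N(\lambda)=c_\lambda\dim(\pi^\lambda)/\dim(T_N)$ on signatures. Set $$p_k^{T_N}=\sum_{i=1}^N(\lambda_i+N-i)^k,\qquad k=1,2,\dots,\qquad \lambda\ \text{being}\ \rho_N\text{-distributed}.$$ Then, as $N\to\infty$, the random vector $\{N^{-k}(p_k^{T_N}-\mathbf E\,p_k^{T_N})\}_{k\ge1}$ converges in the sense of moments (that is, all joint moments converge) to a Gaussian vector $\{\xi_k\}_{k\ge1}$ with zero mean and covariance given, for all $k_1,k_2\ge1$ and every $\epsilon>0$,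 by $$\mathrm{cov}(\xi_{k_1},\xi_{k_2})=\lim_{N\to\infty}\frac{\mathrm{cov}\left(p_{k_1}^{T_N},p_{k_2}^{T_N}\right)}{N^{k_1+k_2}}=\frac1{(2\pi\mathbf i)^2}\oint_{|z|=\epsilon}\oint_{|w|=2\epsilon}\left(\frac1z+1+c+cz\right)^{k_1}\left(\frac1w+1+c+cw\right)^{k_2}\left(-c+\frac1{(z-w)^2}\right)dw\,dz,$$ where both contours are counter-clockwise. -/

import Mathlib

open MeasureTheory ProbabilityTheory Filter Topology
open scoped TensorProduct

noncomputable section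

/-- Signatures of length `N`: weakly decreasing `N`-tuples of integers. -/
abbrev Signature (N : ℕ) : Type := {lam : Fin N → ℤ // Antitone lam}

/-- The unitary group `U(N)`. -/
abbrev UnitaryGp (N : ℕ) : Type := ↥(Matrix.unitaryGroup (Fin N) ℂ)

/-- The element `diag(t_1, …, t_N)` of the maximal torus of `U(N)`, for `t_i` on the unit circle. -/
def torusElt {N : ℕ} (t : Fin N → Circle) : UnitaryGp N :=
  ⟨Matrix.diagonal fun i => (t i : ℂ), by
    rw [Matrix.mem_unitaryGroup_iff, Matrix.star_eq_conjTranspose, Matrix.diagonal_conjTranspose,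
      Matrix.diagonal_mul_diagonal, ← Matrix.diagonal_one]
    congr 1
    funext i
    simp [Complex.mul_conj, Complex.normSq_eq_norm_sq, Circle.norm_coe]⟩

section Decomposition

variable {N : ℕ} {V : Type*} [AddCommGroup V] [Module ℂ V]

/-- `mu` is a weight of the representation `T` of `U(N)`: some nonzero vector `v` satisfies
`T(diag t) v = t_1 ^ mu_1 ⋯ t_N ^ mu_N v` for all `t` in the torus. -/
def IsTorusWeight (T : Representation ℂ (UnitaryGp N) V) (mu : Fin N → ℤ) : Prop :=
  ∃ v : V, v ≠ 0 ∧ ∀ t : Fin N → Circle,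
    T (torusElt t) v = (∏ i, (t i : ℂ) ^ mu i) • v

/-- `lam` is the highest weight of `T`, i.e. the greatest weight in the lexicographic order. (On
irreducible representations this is the same as the greatest weight in the dominance order.) -/
def HasHighestWeight (T : Representation ℂ (UnitaryGp N) V) (lam : Fin N → ℤ) : Prop :=
  IsTorusWeight T lam ∧ ∀ mu : Fin N → ℤ, IsTorusWeight T mu → toLex mu ≤ toLex lam

/-- The part `c_lam π^lam` of the decomposition of `T` into irreducibles: the sum of all irreducible
subrepresentations of `T` whose highest weight is `lam`. -/
def isotypicPart (T : Representation ℂ (UnitaryGp N) V) (lam : Signature N) : Submodule ℂ V :=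
  ⨆ (W : Subrepresentation T) (_ : W.toRepresentation.IsIrreducible)
    (_ : HasHighestWeight W.toRepresentation lam.1), W.toSubmodule

/-- The measure `ρ_T` on signatures of length `N` attached to a finite-dimensional representation
`T = ⨁ c_lam π^lam` of `U(N)`: it gives `lam` the mass `c_lam dim(π^lam) / dim T`. -/
def decompositionMeasure (T : Representation ℂ (UnitaryGp N) V) : Measure (Signature N) :=
  Measure.sum fun lam : Signature N =>
    ((Module.finrank ℂ (isotypicPart T lam) : ENNReal) / (Module.finrank ℂ V : ENNReal)) •
      Measure.dirac lam

end Decomposition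

/-- The representation of `U(N)` in `(ℂ^N)^{⊗ n}` given by
`g (v_1 ⊗ ⋯ ⊗ v_n) = g v_1 ⊗ ⋯ ⊗ g v_n`. -/
def tensorPowerRep (N n : ℕ) :
    Representation ℂ (UnitaryGp N) (⨂[ℂ] _ : Fin n, (Fin N → ℂ)) where
  toFun g := PiTensorProduct.map fun _ => Matrix.toLin' (g : Matrix (Fin N) (Fin N) ℂ)
  map_one' := by
    simp only [OneMemClass.coe_one, Matrix.toLin'_one]
    exact PiTensorProduct.map_id
  map_mul' g h := by
    simp only [Submonoid.coe_mul, Matrix.toLin'_mul]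
    exact PiTensorProduct.map_comp _ _

/-- The Schur–Weyl measure, governing the decomposition of `(ℂ^N)^{⊗ n}` into irreducible
representations of `U(N)`. -/
def schurWeylMeasure (N n : ℕ) : Measure (Signature N) :=
  decompositionMeasure (tensorPowerRep N n)

/-- `p_k = ∑_{i=1}^N (lam_i + N - i)^k`; the index `i : Fin N` starts from `0`, whence `i + 1`. -/
def powerSum {N : ℕ} (k : ℕ) (lam : Signature N) : ℝ :=
  ∑ i : Fin N, ((lam.1 i : ℝ) + (N : ℝ) - ((i : ℕ) + 1 : ℝ)) ^ k

/-- The normalized moment `N^{-k} (p_k - E p_k)` under a measure on signatures of length `N`. -/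
def normalizedMoment {N : ℕ} (μ : Measure (Signature N)) (k : ℕ) (lam : Signature N) : ℝ :=
  (powerSum k lam - ∫ nu, powerSum k nu ∂μ) / (N : ℝ) ^ k

/-- The double contour integral for the limiting covariance, over `|z| = ε` and `|w| = 2 ε`. -/
def schurWeylCovariance (c ε : ℝ) (k₁ k₂ : ℕ) : ℂ :=
  1 / (2 * Real.pi * Complex.I) ^ 2 *
    ∮ z in C(0, ε), ∮ w in C(0, 2 * ε),
      (1 / z + 1 + c + c * z) ^ k₁ * (1 / w + 1 + c + c * w) ^ k₂ *
        (-c + 1 / (z - w) ^ 2)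

end

/-! Adding tensor factors one at a time makes the Schur–Weyl measures the marginals of a growth
process: with `l_i = λ_i + N - i`, a box is added to row `i` with probability `N⁻¹ ∏_{j ≠ i} (1 + 1
/ (l_i - l_j))`. All that is needed of this is `integral_linStat_succ`: the moments of a linear
statistic `∑ φ(l_i)` at time `n + 1` are averages over one jump from time `n`. It is proved without
dimension or character formulas. On `V ⊗ ℂ^N` the split Casimir `∑ E_{ab} ⊗ e_{ba}`, shifted by `N -
1`, has eigenvalue `l_i(λ)` where the box went to row `i` of `λ`, and the partial traces of its
powers produce the jump weights. Summing `φ(X + 1) - φ(X)` over the factors gives an operator,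
`statOp`, acting by `∑ φ(l_i)` on isotypic parts; its normalized traces of powers are the moments.

The limit theorem is then a moment computation in the time `t = n / N² ≤ c`, with rescaled
coordinate `x = l / N - 1 - t`. Jump averages are determined by row averages through the Newton
recursion `newtonP_rec`, whose natural functions are the Dickson polynomials `D_m`, `U_m` of
parameter `t`. To leading order, jump averages are integrals against the semicircle law of variance
`t`, for which the `U_a` are orthogonal with squared norm `t ^ a` (`jump_pU_mul_pU`). As `∂D_m/∂x =
m U_{m-1}`, a new box changes the centred statistic `H_m = ∑ D_m(x_i, t) - ⋯`, for `m ≥ 2`, by `N⁻¹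
m U_{m-1}(x_i)` up to order `N⁻²`. The conditional mean of this change is of order `N⁻²`, and its
random part is smaller still, of order `N⁻³` (`swTheta_sub_mem`). So the recentred `H_m` are nearly
martingales with orthogonal increments of variance `m² t ^ (m-1) dt`; in the limit they are
independent Gaussians of variance `m c ^ m`. For `m = 1` there is no variance, the number of boxes
being fixed.

The rigorous form is `exists_gaussMom_bound`: the moments of a centred combination and those of a
Gaussian obey the same recursion in `n`, with errors of order `N⁻³` over at most `c N²` steps. This
requires moment bounds uniform in `N` and `n`, obtained from a discrete Gronwall inequality and a
bootstrap on the degree (`swStat_mem_bddS`, `swEta_mem_bddS`).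

Finally `N^{-k} p_k = ∑ (x_i + 1 + t) ^ k` is expanded in the `D_m`. Since `D_m(1/z + t z, t) =
z^{-m} + t^m z^m`, the coefficients are Laurent coefficients of `(1/z + 1 + t + t z) ^ k`, and the
limiting covariance is `∑_{m ≥ 2} m c^m a_m b_m`. In the contour integral the kernel `1 / (z - w)²`
gives this sum from `m = 1` on, and `-c` removes the term `m = 1`. Joint moments follow from powers
of sums by polarization. -/

/-! ### Dickson polynomials and Newton-type identities -/

section Dickson

variable {R : Type*} [CommRing R]

/-- Dickson polynomials of the first kind, as functions: `α ^ n + β ^ n` in terms of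
`x = α + β` and `t = α β`. -/
def dicksonD (x t : R) : ℕ → R
  | 0 => 2
  | 1 => x
  | n + 2 => x * dicksonD x t (n + 1) - t * dicksonD x t n

/-- Dickson polynomials of the second kind, as functions. -/
def dicksonU (x t : R) : ℕ → R
  | 0 => 1
  | 1 => x
  | n + 2 => x * dicksonU x t (n + 1) - t * dicksonU x t n

theorem map_dicksonD {S : Type*} [CommRing S] (f : R →+* S) (x t : R) (n : ℕ) :
    f (dicksonD x t n) = dicksonD (f x) (f t) n := by
  induction n using Nat.twoStepInduction with
  | zero => exact map_ofNat f 2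
  | one => simp [dicksonD]
  | more n h1 h2 => simp [dicksonD, h1, h2]

theorem map_dicksonU {S : Type*} [CommRing S] (f : R →+* S) (x t : R) (n : ℕ) :
    f (dicksonU x t n) = dicksonU (f x) (f t) n := by
  induction n using Nat.twoStepInduction with
  | zero => simp [dicksonU]
  | one => simp [dicksonU]
  | more n h1 h2 => simp [dicksonU, h1, h2]

/-- With `a = z⁻¹` and `b = c z`, Dickson polynomials become sums of two Laurent monomials; this is
what links them to the contour integral. -/
theorem dicksonD_add_mul (a b : R) (n : ℕ) : dicksonD (a + b) (a * b) n = a ^ n + b ^ n := by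
  induction n using Nat.twoStepInduction with
  | zero => simp [dicksonD]; norm_num
  | one => simp [dicksonD]
  | more n h1 h2 => simp only [dicksonD, h1, h2]; ring

theorem dicksonD_eq_dicksonU (x t : R) (n : ℕ) :
    dicksonD x t (n + 2) = dicksonU x t (n + 2) - t * dicksonU x t n := by
  induction n using Nat.twoStepInduction with
  | zero => simp only [dicksonD, dicksonU]; ring
  | one => simp only [dicksonD, dicksonU]; ring
  | more n h1 h2 =>
    rw [dicksonD, h1, h2, dicksonU, dicksonU, dicksonU]
    simp only [dicksonU]
    ring

theorem dicksonD_zero_right (x : R) (n : ℕ) : dicksonD x 0 (n + 1) = x ^ (n + 1) := by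
  induction n with
  | zero => simp [dicksonD]
  | succ n ih => rw [dicksonD, ih]; ring

theorem dicksonU_zero_right (x : R) (n : ℕ) : dicksonU x 0 n = x ^ n := by
  induction n with
  | zero => simp [dicksonU]
  | succ n ih =>
    cases n with
    | zero => simp [dicksonU]
    | succ n => rw [dicksonU, ih]; ring

open PowerSeries in
/-- The quadratic power series `1 - x w + t w ^ 2`. -/
noncomputable def quadSeries (x t : R) : R⟦X⟧ := 1 - C x * X + C t * X ^ 2

open PowerSeries in
theorem quadSeries_mul_mk_dicksonU (x t : R) : quadSeries x t * mk (dicksonU x t) = 1 := by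
  ext n
  have e : quadSeries x t * mk (dicksonU x t) = mk (dicksonU x t)
      - C x * (mk (dicksonU x t) * X) + C t * (mk (dicksonU x t) * X ^ 2) := by
    rw [quadSeries]; ring
  rw [e]
  match n with
  | 0 => simp [coeff_X_pow_mul', dicksonU, coeff_zero_mul_X, coeff_mul_X_pow']
  | 1 => simp [dicksonU, coeff_succ_mul_X, coeff_mul_X_pow', coeff_one]
  | n + 2 =>
    simp only [map_add, map_sub, coeff_C_mul, coeff_succ_mul_X, coeff_mul_X_pow, coeff_mk,
      dicksonU, coeff_one]
    simp

open PowerSeries in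
/-- The generating series of the Dickson polynomials of the first kind, without constant term. -/
noncomputable def dicksonSeries (x t : R) : R⟦X⟧ :=
  mk fun n => if n = 0 then 0 else dicksonD x t n

open PowerSeries in
-- Logarithmic derivative of `(1 - α w)(1 - β w)` with `x = α + β`, `t = α β`: the factors
-- contribute `-∑ α ^ n w ^ n` and `-∑ β ^ n w ^ n`.
theorem X_mul_deriv_quadSeries (x t : R) :
    X * derivative R (quadSeries x t) = -(quadSeries x t * dicksonSeries x t) := by
  have e1 : X * derivative R (quadSeries x t) = -(C x * X) + C (2 * t) * X ^ 2 := by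
    have h1 : derivative R (C x * X : R⟦X⟧) = C x := by
      rw [Derivation.leibniz]; simp
    have h2 : derivative R (C t * X ^ 2 : R⟦X⟧) = C t * (2 * X) := by
      rw [Derivation.leibniz, Derivation.leibniz_pow]; simp
    rw [quadSeries, map_add, map_sub, h1, h2, map_mul]
    have : (C (2 : R) : R⟦X⟧) = 2 := map_ofNat _ 2
    simp [this]
    ring
  have e2 : quadSeries x t * dicksonSeries x t = dicksonSeries x t
      - C x * (dicksonSeries x t * X) + C t * (dicksonSeries x t * X ^ 2) := by
    rw [quadSeries]; ring
  rw [e1, e2]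
  ext n
  match n with
  | 0 => simp [dicksonSeries, coeff_zero_mul_X, coeff_mul_X_pow']
  | 1 => simp [dicksonSeries, dicksonD, coeff_succ_mul_X, coeff_mul_X_pow', coeff_X_pow]
  | 2 =>
    simp [dicksonSeries, dicksonD, coeff_succ_mul_X, coeff_mul_X_pow', coeff_X_pow, coeff_X]
    ring
  | n + 3 =>
    simp only [map_add, map_sub, map_neg, coeff_C_mul, coeff_succ_mul_X, dicksonSeries, coeff_mk,
      coeff_X_pow, coeff_X]
    rw [show n + 3 = n + 1 + 2 from rfl, coeff_mul_X_pow, coeff_mk]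
    simp [dicksonD]

end Dickson

/-! ### Partial fractions and the Newton recursion for jump averages. -/

section PartialFractions

variable {ι : Type*} [Fintype ι] [DecidableEq ι]

/-- The numbers `∏_{j ≠ i} (1 + e / (x_i - x_j))`. -/
noncomputable def jumpCoeff (x : ι → ℝ) (e : ℝ) (i : ι) : ℝ :=
  ∏ j ∈ Finset.univ.erase i, (1 + e / (x i - x j))

open Polynomial in
-- Lagrange interpolation: the two products are monic of equal degree, so their difference is
-- determined by its values at the nodes, which are `e ∏_{j ≠ k} (x k - x j + e)`. After division by
-- `∏ (X - x j)` this is a partial fraction expansion with residues `e * jumpCoeff x e i`.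
theorem prod_shift_eq (x : ι → ℝ) (hx : Function.Injective x) (e : ℝ) :
    ∏ j, (X - C (x j) + C e) = ∏ j, (X - C (x j)) +
      ∑ i, C (e * jumpCoeff x e i) * ∏ j ∈ Finset.univ.erase i, (X - C (x j)) := by
  have hd1 : ∏ j, (X - C (x j) + C e) = ∏ j, (X - C (x j - e)) := by
    refine Finset.prod_congr rfl fun j _ => ?_
    rw [C_sub]; ring
  have hm1 : (∏ j, (X - C (x j - e))).Monic := monic_prod_of_monic _ _ fun j _ => monic_X_sub_C _
  have hm2 : (∏ j, (X - C (x j))).Monic := monic_prod_of_monic _ _ fun j _ => monic_X_sub_C _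
  have hdeg1 : (∏ j, (X - C (x j - e))).degree = (Fintype.card ι : WithBot ℕ) := by
    rw [degree_prod]; simp [-map_sub, degree_X_sub_C]
  have hdeg2 : (∏ j, (X - C (x j))).degree = (Fintype.card ι : WithBot ℕ) := by
    rw [degree_prod]; simp [-map_sub, degree_X_sub_C]
  rw [← sub_eq_iff_eq_add', hd1]
  refine eq_of_degrees_lt_of_eval_index_eq (s := Finset.univ) (v := x) hx.injOn ?_ ?_ ?_
  · rw [Finset.card_univ, ← hdeg1]
    exact degree_sub_lt_left (by rw [hdeg1, hdeg2]) hm1.ne_zero (by rw [hm1, hm2])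
  · refine (degree_sum_le _ _).trans_lt ?_
    rw [Finset.sup_lt_iff (by exact_mod_cast WithBot.bot_lt_coe _)]
    intro i _
    rw [← smul_eq_C_mul]
    refine (degree_smul_le _ _).trans_lt ?_
    rw [degree_prod]
    simp only [degree_X_sub_C, Finset.sum_const, nsmul_eq_mul, mul_one, Finset.card_erase_of_mem
      (Finset.mem_univ i), Finset.card_univ]
    have : 0 < Fintype.card ι := Fintype.card_pos_iff.2 ⟨i⟩
    exact_mod_cast Nat.sub_lt this one_pos
  · intro k _
    rw [eval_sub, eval_prod, eval_prod, eval_finsetSum]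
    rw [Finset.prod_eq_zero (Finset.mem_univ k) (f := fun j => eval (x k) (X - C (x j))) (by simp),
      Finset.sum_eq_single k]
    · rw [eval_mul, eval_C, eval_prod, jumpCoeff, ← Finset.mul_prod_erase _ _ (Finset.mem_univ k),
        mul_assoc, ← Finset.prod_mul_distrib, sub_zero]
      congr 1
      · simp
      · refine Finset.prod_congr rfl fun j hj => ?_
        have : x k - x j ≠ 0 := sub_ne_zero.2 fun h => (Finset.ne_of_mem_erase hj) (hx h).symm
        simp
        field_simp
        ring
    · intro b _ hb
      rw [eval_mul, eval_prod, Finset.prod_eq_zero (Finset.mem_erase.2 ⟨hb.symm, Finset.mem_univ k⟩),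
        mul_zero]
      simp
    · simp

/-- The previous identity at `X = A / B` with denominators cleared. The substitution used next, `(1
+ t w ^ 2) / w`, is not a power series. -/
theorem prod_shift_homogeneous {K : Type*} [Field K] [Algebra ℝ K] (x : ι → ℝ)
    (hx : Function.Injective x) (e : ℝ) (A B : K) (hB : B ≠ 0) :
    ∏ j, (A - algebraMap ℝ K (x j) * B + algebraMap ℝ K e * B) =
      ∏ j, (A - algebraMap ℝ K (x j) * B) + B * ∑ i, algebraMap ℝ K (e * jumpCoeff x e i) *
        ∏ j ∈ Finset.univ.erase i, (A - algebraMap ℝ K (x j) * B) := by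
  have h := congrArg (fun p => B ^ Fintype.card ι * Polynomial.aeval (A / B) p)
    (prod_shift_eq x hx e)
  simp only [map_add, map_prod, map_sum, map_mul, map_sub, Polynomial.aeval_X,
    Polynomial.aeval_C, mul_add] at h
  have e1 : ∀ f : ι → K, B ^ Fintype.card ι * ∏ j, f j = ∏ j, (B * f j) := fun f => by
    rw [Finset.prod_mul_distrib, Finset.prod_const, Finset.card_univ]
  have e2 : ∀ (i : ι) (f : ι → K), B ^ Fintype.card ι * ∏ j ∈ Finset.univ.erase i, f j
      = B * ∏ j ∈ Finset.univ.erase i, (B * f j) := fun i f => by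
    have : 0 < Fintype.card ι := Fintype.card_pos_iff.2 ⟨i⟩
    rw [Finset.prod_mul_distrib, Finset.prod_const, Finset.card_erase_of_mem (Finset.mem_univ i),
      Finset.card_univ, ← mul_assoc, ← pow_succ', Nat.sub_add_cancel this]
  rw [e1, e1, Finset.mul_sum] at h
  have e3 : ∀ a : K, B * (A / B - a) = A - a * B := fun a => by field_simp
  have e4 : ∀ a b : K, B * (A / B - a + b) = A - a * B + b * B := fun a b => by field_simp
  simp only [e3, e4] at h
  rw [h, Finset.mul_sum]
  congr 1
  refine Finset.sum_congr rfl fun i _ => ?_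
  rw [mul_left_comm, e2, map_mul]
  simp only [e3]
  ring

open PowerSeries in
-- At `X = (1 + t w ^ 2) / w` one has `w (X - x) = 1 - x w + t w ^ 2`, so the residues get paired
-- with the generating series of `dicksonU`. The parameter `t` is free here; taking it to be the
-- rescaled time will make the leading terms trivial.
theorem prod_quadSeries_shift (x : ι → ℝ) (hx : Function.Injective x) (e t : ℝ) :
    ∏ j, quadSeries (x j - e) t = (∏ j, quadSeries (x j) t) *
      (1 + ∑ i, C (e * jumpCoeff x e i) * (X * mk (dicksonU (x i) t))) := by
  have hinj : Function.Injective (algebraMap ℝ⟦X⟧ (FractionRing ℝ⟦X⟧)) :=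
    IsFractionRing.injective _ _
  have hC : ∀ a : ℝ, algebraMap ℝ (FractionRing ℝ⟦X⟧) a = algebraMap ℝ⟦X⟧ _ (C a) := fun a => by
    rw [IsScalarTower.algebraMap_apply ℝ ℝ⟦X⟧ (FractionRing ℝ⟦X⟧)]; rfl
  have h := prod_shift_homogeneous x hx e
    (algebraMap ℝ⟦X⟧ (FractionRing ℝ⟦X⟧) (1 + C t * X ^ 2)) (algebraMap _ _ X)
    (by rw [Ne, map_eq_zero_iff _ hinj]; exact X_ne_zero)
  simp only [hC, ← map_mul, ← map_sub, ← map_add, ← map_prod, ← map_sum] at h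
  have h := hinj h
  have q1 : ∀ j, quadSeries (x j) t = 1 + C t * X ^ 2 - C (x j) * X := fun j => by
    rw [quadSeries]; ring
  have q2 : ∀ j, quadSeries (x j - e) t = 1 + C t * X ^ 2 - C (x j) * X + C e * X := fun j => by
    rw [quadSeries, map_sub]; ring
  simp only [← q2] at h
  simp only [← q1] at h
  rw [h, mul_add, mul_one, Finset.mul_sum, Finset.mul_sum]
  congr 1
  refine Finset.sum_congr rfl fun i _ => ?_
  rw [← Finset.mul_prod_erase _ _ (Finset.mem_univ i)]
  linear_combination (-X * C (e * jumpCoeff x e i) *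
    ∏ j ∈ Finset.univ.erase i, quadSeries (x j) t) * quadSeries_mul_mk_dicksonU (x i) t

open PowerSeries in
theorem X_mul_deriv_prod_quadSeries (s : Finset ι) (x : ι → ℝ) (t : ℝ) :
    X * derivative ℝ (∏ j ∈ s, quadSeries (x j) t) =
      -((∏ j ∈ s, quadSeries (x j) t) * ∑ j ∈ s, dicksonSeries (x j) t) := by
  induction s using Finset.induction_on with
  | empty => simp
  | insert a s ha ih =>
    rw [Finset.prod_insert ha, Finset.sum_insert ha, Derivation.leibniz, smul_eq_mul, smul_eq_mul]
    linear_combination quadSeries (x a) t * ih +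
      (∏ j ∈ s, quadSeries (x j) t) * X_mul_deriv_quadSeries (x a) t

/-- The coefficients of `1 + ∑ e c_i w / (1 - x_i w + t w²)`. -/
noncomputable def newtonP (x : ι → ℝ) (e t : ℝ) : ℕ → ℝ
  | 0 => 1
  | m + 1 => ∑ i, e * jumpCoeff x e i * dicksonU (x i) t m

open PowerSeries in
-- Logarithmic derivative of `prod_quadSeries_shift`: the series of `newtonP` is a quotient of two
-- products of quadratics, so its logarithmic derivative is a difference of Dickson power sums.
-- Averages against the jump weights are thereby computed from plain sums over rows.
theorem newtonP_rec (x : ι → ℝ) (hx : Function.Injective x) (e t : ℝ) (m : ℕ) :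
    (m + 1 : ℝ) * newtonP x e t (m + 1) = ∑ p ∈ Finset.HasAntidiagonal.antidiagonal m,
      (∑ j, (dicksonD (x j) t (p.1 + 1) - dicksonD (x j - e) t (p.1 + 1))) * newtonP x e t p.2 := by
  set P : ℝ⟦X⟧ := 1 + ∑ i, C (e * jumpCoeff x e i) * (X * mk (dicksonU (x i) t)) with hP
  have hPc : ∀ k, coeff k P = newtonP x e t k := by
    intro k
    cases k with
    | zero => simp [hP, newtonP]
    | succ k =>
      simp only [hP, newtonP, map_add, map_sum, coeff_one, coeff_C_mul, coeff_succ_X_mul, coeff_mk]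
      simp
  have h := prod_quadSeries_shift x hx e t
  rw [← hP] at h
  have hd : X * derivative ℝ _ = X * derivative ℝ _ := congrArg (fun z => X * derivative ℝ z) h
  rw [X_mul_deriv_prod_quadSeries Finset.univ (fun j => x j - e), h, Derivation.leibniz,
    smul_eq_mul, smul_eq_mul, mul_add] at hd
  have h1 := X_mul_deriv_prod_quadSeries Finset.univ x t
  have hne : ∏ j, quadSeries (x j) t ≠ 0 := by
    refine Finset.prod_ne_zero_iff.2 fun j _ h0 => ?_
    have := quadSeries_mul_mk_dicksonU (x j) t
    rw [h0, zero_mul] at this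
    exact zero_ne_one this
  have key : X * derivative ℝ P =
      (∑ j, (dicksonSeries (x j) t - dicksonSeries (x j - e) t)) * P := by
    apply mul_left_cancel₀ hne
    rw [Finset.sum_sub_distrib]
    linear_combination -hd - P * h1
  have hc := congrArg (coeff (m + 1)) key
  rw [coeff_succ_X_mul, coeff_mul, Finset.Nat.antidiagonal_succ, Finset.sum_cons] at hc
  have h0 : coeff 0 (∑ j, (dicksonSeries (x j) t - dicksonSeries (x j - e) t)) = 0 := by
    simp [dicksonSeries]
  rw [h0, zero_mul, zero_add, Finset.sum_map, coeff_derivative, hPc] at hc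
  rw [mul_comm, hc]
  refine Finset.sum_congr rfl fun p _ => ?_
  simp [hPc, dicksonSeries]

end PartialFractions

/-! ### Tensoring a `gl_N`-module with the vector representation -/

section TensorStep

variable {N : ℕ} {V : Type*} [AddCommGroup V] [Module ℂ V]

/-- The commutation relations of the matrix units of `gl_N`. -/
def GLRelations (E : Fin N → Fin N → Module.End ℂ V) : Prop :=
  ∀ a b c d, E a b * E c d - E c d * E a b =
    (if b = c then E a d else 0) - (if d = a then E c b else 0)

/-- Compatibility of a group element `g`, acting by `T`, with the action of the matrix units. -/
def GLEquivariant (E : Fin N → Fin N → Module.End ℂ V) (g : Matrix (Fin N) (Fin N) ℂ)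
    (T : Module.End ℂ V) : Prop :=
  ∀ a b, ∑ c, g c a • (E c b * T) = ∑ d, g b d • (T * E a d)

/-- `v` is annihilated by the raising operators and has weight `lam`. -/
def IsHighestVector (E : Fin N → Fin N → Module.End ℂ V) (lam : Fin N → ℤ) (v : V) : Prop :=
  (∀ a b, a < b → E a b v = 0) ∧ ∀ a, E a a v = (lam a : ℂ) • v

/-- The matrix units acting on `V ⊗ ℂ^N`, viewed as `Fin N → V`. -/
def tensE (E : Fin N → Fin N → Module.End ℂ V) (a b : Fin N) : Module.End ℂ (Fin N → V) where
  toFun u c := E a b (u c) + if c = a then u b else 0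
  map_add' u v := by ext c; simp only [Pi.add_apply, map_add]; split_ifs <;> module
  map_smul' r u := by ext c; simp only [Pi.smul_apply, map_smul, RingHom.id_apply]; split_ifs <;> module

/-- The operator `∑ E_{ab} ⊗ e_{ba}`, shifted by `N - 1`. -/
def tensX (E : Fin N → Fin N → Module.End ℂ V) : Module.End ℂ (Fin N → V) where
  toFun u b := ∑ a, E a b (u a) + ((N : ℂ) - 1) • u b
  map_add' u v := by ext b; simp only [Pi.add_apply, map_add, Finset.sum_add_distrib]; module
  map_smul' r u := by
    ext b; simp only [Pi.smul_apply, map_smul, RingHom.id_apply, ← Finset.smul_sum]; module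

/-- The operator `A ⊗ 1`. -/
def tensLift (A : Module.End ℂ V) : Module.End ℂ (Fin N → V) where
  toFun u c := A (u c)
  map_add' u v := by ext c; simp
  map_smul' r u := by ext c; simp

/-- The operator `T ⊗ g`. -/
def tensT (g : Matrix (Fin N) (Fin N) ℂ) (T : Module.End ℂ V) : Module.End ℂ (Fin N → V) where
  toFun u c := ∑ d, g c d • T (u d)
  map_add' u v := by ext c; simp [Finset.sum_add_distrib]
  map_smul' r u := by
    ext c; simp only [Pi.smul_apply, map_smul, RingHom.id_apply, Finset.smul_sum, smul_comm r]

theorem tensE_apply (E : Fin N → Fin N → Module.End ℂ V) (a b : Fin N) (u : Fin N → V) (c : Fin N) :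
    tensE E a b u c = E a b (u c) + if c = a then u b else 0 := rfl

theorem tensX_apply (E : Fin N → Fin N → Module.End ℂ V) (u : Fin N → V) (b : Fin N) :
    tensX E u b = ∑ a, E a b (u a) + ((N : ℂ) - 1) • u b := rfl

theorem tensLift_apply (A : Module.End ℂ V) (u : Fin N → V) (c : Fin N) :
    tensLift A u c = A (u c) := rfl

theorem tensT_apply (g : Matrix (Fin N) (Fin N) ℂ) (T : Module.End ℂ V) (u : Fin N → V)
    (c : Fin N) : tensT g T u c = ∑ d, g c d • T (u d) := rfl

variable {E : Fin N → Fin N → Module.End ℂ V}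

theorem GLRelations.apply (hE : GLRelations E) (a b c d : Fin N) (v : V) :
    E a b (E c d v) = E c d (E a b v) + (if b = c then E a d v else 0)
      - (if d = a then E c b v else 0) := by
  have h := LinearMap.congr_fun (hE a b c d) v
  simp only [LinearMap.sub_apply, Module.End.mul_apply] at h
  rw [sub_eq_iff_eq_add] at h
  rw [h]
  split_ifs <;> (try simp only [LinearMap.zero_apply]) <;> abel

/-- The split Casimir is invariant under the diagonal action; in coordinates both sides leave the
same extra term `E c b (u d)`. -/
theorem commute_tensX_tensE (hE : GLRelations E) (c d : Fin N) :
    Commute (tensX E) (tensE E c d) := by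
  refine LinearMap.ext fun u => funext fun b => ?_
  simp only [Module.End.mul_apply, tensX_apply, tensE_apply, map_add, map_sum, map_smul]
  simp only [hE.apply c d, Finset.sum_add_distrib, Finset.sum_sub_distrib, smul_add]
  have h1 : ∑ x, (E x b) (if x = c then u d else 0) = E c b (u d) := by
    rw [Finset.sum_eq_single c] <;> simp +contextual
  have h2 : ∑ x, (if d = x then E c b (u x) else 0) = E c b (u d) := by simp
  rw [h1, h2]
  by_cases hb : b = c
  · simp [hb]; abel
  · simp [hb]

theorem commute_tensLift_tensE {A : Module.End ℂ V} {a b : Fin N} (h : Commute A (E a b)) :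
    Commute (tensLift A) (tensE E a b) := by
  refine LinearMap.ext fun u => funext fun c => ?_
  have h' : ∀ v, A (E a b v) = E a b (A v) := fun v => LinearMap.congr_fun h.eq v
  simp only [Module.End.mul_apply, tensLift_apply, tensE_apply, map_add, h']
  split_ifs <;> simp

theorem commute_tensLift_tensX {A : Module.End ℂ V} (h : ∀ a b, Commute A (E a b)) :
    Commute (tensLift A) (tensX E) := by
  refine LinearMap.ext fun u => funext fun c => ?_
  have h' : ∀ a b v, A (E a b v) = E a b (A v) := fun a b v => LinearMap.congr_fun (h a b).eq v
  simp only [Module.End.mul_apply, tensLift_apply, tensX_apply, map_add, map_sum, map_smul, h']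

theorem commute_tensLift_tensT {A T : Module.End ℂ V} (g : Matrix (Fin N) (Fin N) ℂ)
    (h : Commute A T) : Commute (tensLift A) (tensT g T) := by
  refine LinearMap.ext fun u => funext fun c => ?_
  have h' : ∀ v, A (T v) = T (A v) := fun v => LinearMap.congr_fun h.eq v
  simp only [Module.End.mul_apply, tensLift_apply, tensT_apply, map_sum, map_smul, h']

theorem GLEquivariant.apply {g : Matrix (Fin N) (Fin N) ℂ} {T : Module.End ℂ V}
    (h : GLEquivariant E g T) (a b : Fin N) (v : V) :
    ∑ c, g c a • E c b (T v) = ∑ d, g b d • T (E a d v) := by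
  simpa using LinearMap.congr_fun (h a b) v

theorem commute_tensX_tensT {g : Matrix (Fin N) (Fin N) ℂ} {T : Module.End ℂ V}
    (h : GLEquivariant E g T) : Commute (tensX E) (tensT g T) := by
  refine LinearMap.ext fun u => funext fun b => ?_
  simp only [Module.End.mul_apply, tensX_apply, tensT_apply, map_add, map_sum, map_smul, smul_add,
    Finset.sum_add_distrib, Finset.smul_sum]
  congr 1
  · rw [Finset.sum_comm]
    rw [Finset.sum_comm (f := fun x y => g b x • T (E y x (u y)))]
    exact Finset.sum_congr rfl fun a _ => h.apply a b (u a)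
  · exact Finset.sum_congr rfl fun a _ => smul_comm _ _ _

theorem glRelations_tensE (hE : GLRelations E) : GLRelations (tensE E) := by
  intro a b c d
  refine LinearMap.ext fun u => funext fun e => ?_
  simp only [LinearMap.sub_apply, Module.End.mul_apply, Pi.sub_apply, tensE_apply, map_add,
    hE.apply a b c d]
  rw [show (if b = c then tensE E a d else 0) u e
      = if b = c then E a d (u e) + (if e = a then u d else 0) else 0 by split_ifs <;> simp [*, tensE_apply],
    show (if d = a then tensE E c b else 0) u e
      = if d = a then E c b (u e) + (if e = c then u b else 0) else 0 by split_ifs <;> simp [*, tensE_apply]]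
  have h1 : ∀ (p : Prop) [Decidable p] (x : V), E a b (if p then x else 0) = if p then E a b x else 0 :=
    fun p _ x => by split_ifs <;> simp
  have h2 : ∀ (p : Prop) [Decidable p] (x : V), E c d (if p then x else 0) = if p then E c d x else 0 :=
    fun p _ x => by split_ifs <;> simp
  rw [h1, h2]
  split_ifs <;> (try subst_vars) <;> abel

theorem glEquivariant_tensE {g : Matrix (Fin N) (Fin N) ℂ} {T : Module.End ℂ V}
    (h : GLEquivariant E g T) : GLEquivariant (tensE E) g (tensT g T) := by
  intro a b
  refine LinearMap.ext fun u => funext fun e => ?_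
  simp only [LinearMap.sum_apply, LinearMap.smul_apply, Finset.sum_apply, Pi.smul_apply,
    Module.End.mul_apply, tensE_apply, tensT_apply, map_add, map_sum, map_smul, smul_add,
    Finset.sum_add_distrib, Finset.smul_sum]
  congr 1
  · rw [Finset.sum_comm]
    rw [Finset.sum_comm (f := fun x y => g b x • g e y • T (E a x (u y)))]
    refine Finset.sum_congr rfl fun d _ => ?_
    simp only [smul_comm _ (g e d), ← Finset.smul_sum]
    rw [h.apply]
  · have h1 : ∀ x, (if e = x then ∑ d, g b d • T (u d) else 0) = if e = x then ∑ d, g b d • T (u d) else 0 :=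
      fun _ => rfl
    simp only [smul_ite, smul_zero, Finset.sum_ite_eq, Finset.mem_univ, if_true, Finset.smul_sum]
    refine Finset.sum_congr rfl fun d _ => ?_
    rw [Finset.sum_eq_single a]
    · rw [if_pos rfl, smul_comm]
    · intro x _ hx; simp [hx]
    · simp

end TensorStep

/-! ### Highest vectors of `V ⊗ ℂ^N` and the spectrum of the split Casimir. -/

section HighestVectors

variable {N : ℕ} {V : Type*} [AddCommGroup V] [Module ℂ V]
  {E : Fin N → Fin N → Module.End ℂ V}

/-- The shifted coordinate `lam_i + N - i`. -/
noncomputable def shiftedCoord (lam : Fin N → ℤ) (i : Fin N) : ℝ :=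
  (lam i : ℝ) + (N : ℝ) - ((i : ℕ) + 1 : ℝ)

theorem shiftedCoord_sub_single (lam : Fin N → ℤ) (i j : Fin N) :
    shiftedCoord (lam - Pi.single i 1) j = shiftedCoord lam j - if j = i then 1 else 0 := by
  simp only [shiftedCoord, Pi.sub_apply, Pi.single_apply]
  split_ifs <;> push_cast <;> ring

theorem shiftedCoord_add_single (lam : Fin N → ℤ) (i j : Fin N) :
    shiftedCoord (lam + Pi.single i 1) j = shiftedCoord lam j + if j = i then 1 else 0 := by
  simp only [shiftedCoord, Pi.add_apply, Pi.single_apply]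
  split_ifs <;> push_cast <;> ring

theorem shiftedCoord_strictAnti {lam : Fin N → ℤ} (h : Antitone lam) :
    StrictAnti (shiftedCoord lam) := by
  intro i j hij
  have h1 : (lam j : ℝ) ≤ lam i := by exact_mod_cast h hij.le
  have h2 : ((i : ℕ) : ℝ) < (j : ℕ) := by exact_mod_cast hij
  simp only [shiftedCoord]
  linarith

theorem IsHighestVector.sub {lam : Fin N → ℤ} {v w : V} (hv : IsHighestVector E lam v)
    (hw : IsHighestVector E lam w) : IsHighestVector E lam (v - w) :=
  ⟨fun a b h => by rw [map_sub, hv.1 a b h, hw.1 a b h, sub_zero],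
    fun a => by rw [map_sub, hv.2, hw.2, smul_sub]⟩

theorem IsHighestVector.smul {lam : Fin N → ℤ} {v : V} (hv : IsHighestVector E lam v) (r : ℂ) :
    IsHighestVector E lam (r • v) :=
  ⟨fun a b h => by rw [map_smul, hv.1 a b h, smul_zero],
    fun a => by rw [map_smul, hv.2, smul_comm]⟩

theorem IsHighestVector.zero {lam : Fin N → ℤ} : IsHighestVector E lam 0 :=
  ⟨fun a b _ => map_zero _, fun a => by rw [map_zero, smul_zero]⟩

theorem IsHighestVector.map {lam : Fin N → ℤ} {v : V} (hv : IsHighestVector E lam v)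
    {A : Module.End ℂ V} (hA : ∀ a b, Commute A (E a b)) : IsHighestVector E lam (A v) := by
  have h' : ∀ a b v, A (E a b v) = E a b (A v) := fun a b v => LinearMap.congr_fun (hA a b).eq v
  exact ⟨fun a b h => by rw [← h', hv.1 a b h, map_zero], fun a => by rw [← h', hv.2, map_smul]⟩

/-- The action of `E_{ab}` on `V ⊗ ℂ^N` feeds component `b` into component `a`; for `a < b` the last
nonzero component receives nothing. -/
theorem IsHighestVector.top_component {mu : Fin N → ℤ} {u : Fin N → V}
    (hu : IsHighestVector (tensE E) mu u) {i : Fin N} (hi : ∀ j, i < j → u j = 0) :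
    IsHighestVector E (mu - Pi.single i 1) (u i) := by
  constructor
  · intro a b hab
    have h := congrFun (hu.1 a b hab) i
    rw [tensE_apply] at h
    by_cases hia : i = a
    · rwa [if_pos hia, hi b (hia ▸ hab), add_zero] at h
    · rwa [if_neg hia, add_zero] at h
  · intro a
    have h := congrFun (hu.2 a) i
    rw [tensE_apply, Pi.smul_apply] at h
    rw [eq_sub_of_add_eq h]
    by_cases hia : i = a
    · subst hia; simp [sub_smul]
    · simp [hia, Pi.single_apply, Ne.symm hia]

theorem IsHighestVector.tensX_apply_of_lt {mu : Fin N → ℤ} {u : Fin N → V}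
    (hu : IsHighestVector (tensE E) mu u) {i : Fin N} (hi : ∀ j, i < j → u j = 0) {b : Fin N}
    (hb : i < b) : tensX E u b = 0 := by
  rw [tensX_apply, hi b hb, smul_zero, add_zero]
  refine Finset.sum_eq_zero fun a _ => ?_
  rcases le_or_gt a i with ha | ha
  · have h := congrFun (hu.1 a b (ha.trans_lt hb)) a
    rw [tensE_apply, if_pos rfl, hi b hb, add_zero] at h
    exact h
  · rw [hi a ha, map_zero]

/-- For `a < i`, the equation of a highest vector for `E_{ai}`, read in component `a`, gives `E_{ai}
u_a = -u_i`, so the sum collapses to the scalar `mu_i - (i + 1) + N - 1`. On highest vectors `tensX`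
is therefore triangular with distinct diagonal entries. -/
theorem IsHighestVector.tensX_apply_top {mu : Fin N → ℤ} {u : Fin N → V}
    (hu : IsHighestVector (tensE E) mu u) {i : Fin N} (hi : ∀ j, i < j → u j = 0) :
    tensX E u i = ((shiftedCoord mu i - 1 : ℝ) : ℂ) • u i := by
  have h1 : ∀ a, E a i (u a) = (if a = i then (mu i : ℂ) • u i else 0)
      - if a ≤ i then u i else 0 := by
    intro a
    rcases lt_trichotomy a i with ha | ha | ha
    · have h := congrFun (hu.1 a i ha) a
      rw [tensE_apply, if_pos rfl] at h
      rw [if_neg ha.ne, if_pos ha.le, zero_sub]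
      exact eq_neg_of_add_eq_zero_left h
    · subst ha
      have h := congrFun (hu.2 a) a
      rw [tensE_apply, if_pos rfl, Pi.smul_apply] at h
      rw [if_pos rfl, if_pos le_rfl]
      exact eq_sub_of_add_eq h
    · rw [hi a ha, map_zero, if_neg ha.ne', if_neg (not_le.2 ha), sub_zero]
  rw [tensX_apply, Finset.sum_congr rfl fun a _ => h1 a, Finset.sum_sub_distrib,
    Finset.sum_ite_eq', if_pos (Finset.mem_univ i), ← Finset.sum_filter, Finset.sum_const]
  have h2 : (Finset.univ.filter (fun a => a ≤ i)).card = (i : ℕ) + 1 := by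
    rw [show Finset.univ.filter (fun a => a ≤ i) = Finset.Iic i by ext; simp, Fin.card_Iic]
  rw [h2, ← Nat.cast_smul_eq_nsmul ℂ, ← sub_smul, ← add_smul]
  congr 1
  simp only [shiftedCoord]
  push_cast
  ring

/-- A nonzero `tensE`-highest vector which is an eigenvector of `tensX` has its top component in the
position determined by the eigenvalue. -/
theorem IsHighestVector.eq_top_of_eigen {mu : Fin N → ℤ} (hmu : Antitone mu) {u : Fin N → V}
    (hu : IsHighestVector (tensE E) mu u) {i : Fin N}
    (hX : tensX E u = ((shiftedCoord mu i - 1 : ℝ) : ℂ) • u) (hne : u ≠ 0) :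
    u i ≠ 0 ∧ ∀ j, i < j → u j = 0 := by
  classical
  obtain ⟨k, hk⟩ : ∃ k, u k ≠ 0 := by
    by_contra! h
    exact hne (funext h)
  have hs : (Finset.univ.filter fun k => u k ≠ 0).Nonempty := ⟨k, by simp [hk]⟩
  set j := (Finset.univ.filter fun k => u k ≠ 0).max' hs with hj
  have hj1 : u j ≠ 0 := (Finset.mem_filter.1 (Finset.max'_mem _ hs)).2
  have hj2 : ∀ l, j < l → u l = 0 := by
    intro l hl
    by_contra h
    exact absurd (Finset.le_max' _ l (by simp [h])) (not_le.2 hl)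
  have h1 := hu.tensX_apply_top hj2
  rw [hX, Pi.smul_apply] at h1
  have h2 := smul_left_injective ℂ hj1 h1
  have h3 : shiftedCoord mu i = shiftedCoord mu j := by
    have : shiftedCoord mu i - 1 = shiftedCoord mu j - 1 := by exact_mod_cast h2
    linarith
  have h4 : i = j := (shiftedCoord_strictAnti hmu).injective h3
  rw [h4]
  exact ⟨hj1, hj2⟩

/-- A triangular operator with distinct diagonal entries is diagonalizable. With `i` the last
position allowed to be nonzero, `tensX - x i` removes component `i`; dividing the eigenvectors found
for the result by `x j - x i` recovers `u` up to an eigenvector for `x i`. -/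
theorem IsHighestVector.exists_eigen_decomposition (hE : GLRelations E) {mu : Fin N → ℤ}
    (hmu : Antitone mu) (k : ℕ) : ∀ {u : Fin N → V}, IsHighestVector (tensE E) mu u →
    (∀ j : Fin N, k ≤ (j : ℕ) → u j = 0) → ∃ w : Fin N → Fin N → V, u = ∑ i, w i ∧
      (∀ i : Fin N, k ≤ (i : ℕ) → w i = 0) ∧ ∀ i, IsHighestVector (tensE E) mu (w i) ∧
        tensX E (w i) = ((shiftedCoord mu i - 1 : ℝ) : ℂ) • w i := by
  have hcomm : ∀ a b, Commute (tensX E) (tensE E a b) := commute_tensX_tensE hE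
  induction k with
  | zero =>
    intro u hu h0
    refine ⟨fun _ => 0, ?_, fun _ _ => rfl, fun i => ⟨.zero, by simp⟩⟩
    rw [Finset.sum_const_zero]
    exact funext fun j => h0 j (Nat.zero_le _)
  | succ k ih =>
    intro u hu h0
    by_cases hk : k < N
    · set i : Fin N := ⟨k, hk⟩ with hi
      have hi' : ∀ j, i < j → u j = 0 := fun j hj => h0 j hj
      set x : Fin N → ℂ := fun i => ((shiftedCoord mu i - 1 : ℝ) : ℂ) with hx
      have hu' : IsHighestVector (tensE E) mu (tensX E u - x i • u) := (hu.map hcomm).sub (hu.smul _)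
      obtain ⟨w, hw1, hw2, hw3⟩ := ih hu' fun j hj => by
        rw [Pi.sub_apply, Pi.smul_apply]
        rcases eq_or_lt_of_le (show i ≤ j from hj) with h | h
        · rw [← h, hu.tensX_apply_top hi', sub_self]
        · rw [hu.tensX_apply_of_lt hi' h, hi' j h, smul_zero, sub_zero]
      have hxne : ∀ j, w j ≠ 0 → x j - x i ≠ 0 := by
        intro j hj h
        have h' : shiftedCoord mu j - 1 = shiftedCoord mu i - 1 := by
          exact Complex.ofReal_injective (sub_eq_zero.1 h)
        have : j = i := (shiftedCoord_strictAnti hmu).injective (by linarith)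
        exact hj (hw2 j (by rw [this]))
      have hwi : w i = 0 := hw2 i le_rfl
      have hterm : ∀ j, (x j - x i) • ((x j - x i)⁻¹ • w j) = w j := by
        intro j
        by_cases hj : w j = 0
        · rw [hj, smul_zero, smul_zero]
        · rw [smul_smul, mul_inv_cancel₀ (hxne j hj), one_smul]
      set v : Fin N → V := u - ∑ j, (x j - x i)⁻¹ • w j with hv
      have hsumhw : ∀ s : Finset (Fin N),
          IsHighestVector (tensE E) mu (∑ j ∈ s, (x j - x i)⁻¹ • w j) := by
        intro s
        induction s using Finset.induction_on with
        | empty => exact .zero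
        | insert a s ha ihs =>
          rw [Finset.sum_insert ha, ← sub_neg_eq_add, ← neg_one_smul ℂ (Finset.sum _ _)]
          exact ((hw3 a).1.smul _).sub (ihs.smul _)
      have hvX : tensX E v = x i • v := by
        rw [hv, map_sub, map_sum, smul_sub, sub_eq_sub_iff_sub_eq_sub, hw1, Finset.smul_sum,
          ← Finset.sum_sub_distrib]
        refine Finset.sum_congr rfl fun j _ => ?_
        rw [map_smul, (hw3 j).2]
        conv_lhs => rw [← hterm j]
        rw [smul_smul, smul_smul, smul_smul, ← sub_smul]
        congr 1
        simp only [hx]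
        ring
      refine ⟨fun j => if j = i then v else (x j - x i)⁻¹ • w j, ?_, ?_, ?_⟩
      · rw [Finset.sum_ite, Finset.filter_eq' Finset.univ i, if_pos (Finset.mem_univ i),
          Finset.sum_singleton, hv]
        have : ∑ j ∈ Finset.univ.filter (fun j => ¬ j = i), (x j - x i)⁻¹ • w j
            = ∑ j, (x j - x i)⁻¹ • w j := by
          refine Finset.sum_subset (Finset.filter_subset _ _) fun j _ hj => ?_
          have : j = i := by simpa using hj
          rw [this, hwi, smul_zero]
        rw [this, sub_add_cancel]
      · intro j hj
        have hji : j ≠ i := by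
          rintro rfl
          simp [hi] at hj
        simp only [if_neg hji]
        rw [hw2 j (by omega), smul_zero]
      · intro j
        by_cases hji : j = i
        · simp only [if_pos hji]
          rw [hji]
          exact ⟨hu.sub (hsumhw _), hvX⟩
        · simp only [if_neg hji]
          exact ⟨(hw3 j).1.smul _, by rw [map_smul, (hw3 j).2, smul_comm]⟩
    · obtain ⟨w, h1, h2, h3⟩ := ih hu fun j hj => absurd j.2 (by omega)
      exact ⟨w, h1, fun i hi => h2 i (by omega), h3⟩

open Polynomial in
theorem aeval_apply_of_eigen {W : Type*} [AddCommGroup W] [Module ℂ W] {A : Module.End ℂ W} {r : ℂ}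
    {w : W} (h : A w = r • w) (p : ℂ[X]) : aeval A p w = p.eval r • w := by
  by_cases hw : w = 0
  · simp [hw]
  · exact Module.End.aeval_apply_of_hasEigenvector ⟨Module.End.mem_eigenspace_iff.2 h, hw⟩

/-- The linear statistic `∑ φ(lam_j + N - j)`. -/
noncomputable def linStat {S : Type*} [CommRing S] [Algebra ℝ S] (φ : Polynomial S)
    (lam : Fin N → ℤ) : S :=
  ∑ j, φ.eval (algebraMap ℝ S (shiftedCoord lam j))

theorem linStat_add_single {S : Type*} [CommRing S] [Algebra ℝ S] (φ : Polynomial S)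
    (lam : Fin N → ℤ) (i : Fin N) : linStat φ (lam + Pi.single i 1) = linStat φ lam +
      (φ.eval (algebraMap ℝ S (shiftedCoord lam i) + 1)
        - φ.eval (algebraMap ℝ S (shiftedCoord lam i))) := by
  rw [← sub_eq_iff_eq_add', linStat, linStat, ← Finset.sum_sub_distrib, Finset.sum_eq_single i]
  · simp [shiftedCoord_add_single]
  · intro j _ hj
    simp [shiftedCoord_add_single, hj]
  · simp

open Polynomial in
/-- If `A` acts on highest vectors through the linear statistic of `φ`, then so does
`A ⊗ 1 + (φ(· + 1) - φ)(X)`. -/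
theorem tens_acts_linStat (hE : GLRelations E) {A : Module.End ℂ V}
    (hA : ∀ a b, Commute A (E a b)) (φ : ℂ[X])
    (h : ∀ lam v, IsHighestVector E lam v → A v = linStat φ lam • v)
    {mu : Fin N → ℤ} (hmu : Antitone mu) {u : Fin N → V} (hu : IsHighestVector (tensE E) mu u) :
    (tensLift A + aeval (tensX E) (φ.comp (X + 1) - φ) : Module.End ℂ (Fin N → V)) u = linStat φ mu • u := by
  obtain ⟨w, hw1, -, hw3⟩ := hu.exists_eigen_decomposition hE hmu N fun j hj =>
    absurd j.2 (by omega)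
  rw [hw1, map_sum, Finset.smul_sum]
  refine Finset.sum_congr rfl fun i _ => ?_
  obtain ⟨hwi, hXi⟩ := hw3 i
  set s := linStat φ (mu - Pi.single i 1) with hs
  -- `A ⊗ 1` commutes with the action and with `tensX`, so the difference of the two sides is again
  -- a highest eigenvector for the same eigenvalue. Its component `i` vanishes, because `A` is the
  -- scalar `s` on the highest vector `w i i` of `V`; but a nonzero such vector has nonzero
  -- component `i`.
  have hlift : tensLift A (w i) = s • w i := by
    by_contra hne
    have hne' : tensLift A (w i) - s • w i ≠ 0 := sub_ne_zero.2 hne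
    have h0 : w i ≠ 0 := by
      rintro h0
      rw [h0, map_zero, smul_zero] at hne
      exact hne rfl
    have htop := hwi.eq_top_of_eigen hmu hXi h0
    have hd : IsHighestVector (tensE E) mu (tensLift A (w i) - s • w i) :=
      (hwi.map fun a b => commute_tensLift_tensE (hA a b)).sub (hwi.smul _)
    have hc : ∀ v, tensX E (tensLift A v) = tensLift A (tensX E v) := fun v =>
      (LinearMap.congr_fun (commute_tensLift_tensX hA).eq v).symm
    have htop' := hd.eq_top_of_eigen hmu (i := i)
      (by rw [map_sub, hc, hXi, map_smul, map_smul, hXi]; module) hne'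
    refine htop'.1 ?_
    rw [Pi.sub_apply, Pi.smul_apply, tensLift_apply, h _ _ (hwi.top_component htop.2), sub_self]
  rw [LinearMap.add_apply, hlift, aeval_apply_of_eigen hXi, ← add_smul]
  congr 1
  have e : linStat φ mu = s + (φ.eval (((shiftedCoord mu i - 1 : ℝ) : ℂ) + 1)
      - φ.eval ((shiftedCoord mu i - 1 : ℝ) : ℂ)) := by
    have := linStat_add_single φ (mu - Pi.single i 1) i
    rw [sub_add_cancel, shiftedCoord_sub_single, if_pos rfl] at this
    exact this
  rw [e]
  simp

end HighestVectors

/-! ### Partial traces over the vector representation. -/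

section PartialTrace

variable {N : ℕ} {V : Type*} [AddCommGroup V] [Module ℂ V]
  {E : Fin N → Fin N → Module.End ℂ V}

/-- The diagonal matrix elements of powers of `tensX` on a highest vector. -/
noncomputable def diagCoeff (l : Fin N → ℝ) : ℕ → Fin N → ℝ
  | 0, _ => 1
  | m + 1, i => l i * diagCoeff l m i + ∑ c ∈ Finset.Iio i, diagCoeff l m c

theorem tensE_single (a b i : Fin N) (v : V) :
    tensE E a b (Pi.single i v) = Pi.single i (E a b v) + if b = i then Pi.single a v else 0 := by
  funext e
  rw [tensE_apply, Pi.add_apply]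
  by_cases h1 : e = i <;> by_cases h2 : e = a <;> by_cases h3 : b = i <;>
    simp [Pi.single_apply, h1, h2, h3] <;> subst_vars <;> simp_all

/-- Commuting `tensX ^ m` with `E_{cb}` expresses `E_{cb}` of a component of `tensX ^ m (v ⊗ e_i)`
through diagonal components alone, since `v` is annihilated by raising operators. This makes the
array triangular and yields the recursion of `diagCoeff`. -/
theorem tensX_pow_single (hE : GLRelations E) {lam : Fin N → ℤ} {v : V}
    (hv : IsHighestVector E lam v) (m : ℕ) :
    (∀ i b : Fin N, i < b → (tensX E ^ m) (Pi.single i v) b = 0) ∧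
      ∀ i, (tensX E ^ m) (Pi.single i v) i = ((diagCoeff (shiftedCoord lam) m i : ℝ) : ℂ) • v := by
  induction m with
  | zero =>
    refine ⟨fun i b hib => ?_, fun i => ?_⟩
    · simp [Pi.single_apply, hib.ne']
    · simp [diagCoeff]
  | succ m ih =>
    have hcomm : ∀ c d e i : Fin N, E c d ((tensX E ^ m) (Pi.single i v) e)
        + (if e = c then (tensX E ^ m) (Pi.single i v) d else 0) =
        (tensX E ^ m) (Pi.single i (E c d v)) e
          + if d = i then (tensX E ^ m) (Pi.single c v) e else 0 := by
      intro c d e i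
      have h := LinearMap.congr_fun ((commute_tensX_tensE hE c d).pow_left m).eq (Pi.single i v)
      have h := congrFun h e
      rw [Module.End.mul_apply, Module.End.mul_apply, tensE_single, tensE_apply, map_add,
        Pi.add_apply] at h
      rw [← h]
      split_ifs <;> simp
    have hterm : ∀ i b : Fin N, i ≤ b → ∀ c, E c b ((tensX E ^ m) (Pi.single i v) c) =
        (if b = i then (if c = i then ((lam i : ℂ) * (diagCoeff (shiftedCoord lam) m i : ℝ)) • v
          else 0) + (if c < i then ((diagCoeff (shiftedCoord lam) m c : ℝ) : ℂ) • v
            - ((diagCoeff (shiftedCoord lam) m i : ℝ) : ℂ) • v else 0) else 0) := by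
      intro i b hib c
      rcases lt_trichotomy c i with hc | hc | hc
      · have h := hcomm c b c i
        rw [if_pos rfl, hv.1 c b (hc.trans_le hib), Pi.single_zero, map_zero, Pi.zero_apply,
          zero_add, ih.2 c] at h
        rw [eq_sub_of_add_eq h, if_neg hc.ne, if_pos hc, zero_add]
        by_cases hb : b = i
        · rw [if_pos hb, if_pos hb, hb, ih.2 i]
        · rw [if_neg hb, if_neg hb, ih.1 i b (lt_of_le_of_ne hib (Ne.symm hb)), sub_zero]
      · subst hc
        rw [ih.2 c, map_smul, if_pos rfl, if_neg (lt_irrefl _), add_zero]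
        by_cases hb : b = c
        · rw [if_pos hb, hb, hv.2, smul_smul, mul_comm]
        · rw [if_neg hb, hv.1 c b (lt_of_le_of_ne hib (Ne.symm hb)), smul_zero]
      · rw [ih.1 i c hc, map_zero, if_neg hc.ne', if_neg (not_lt.2 hc.le), add_zero, ite_self]
    refine ⟨fun i b hib => ?_, fun i => ?_⟩
    · rw [pow_succ', Module.End.mul_apply, tensX_apply, ih.1 i b hib, smul_zero, add_zero]
      refine Finset.sum_eq_zero fun c _ => ?_
      rw [hterm i b hib.le c, if_neg hib.ne']
    · rw [pow_succ', Module.End.mul_apply, tensX_apply, ih.2 i,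
        Finset.sum_congr rfl fun c _ => hterm i i le_rfl c]
      simp only [if_true]
      rw [Finset.sum_add_distrib, Finset.sum_ite_eq', if_pos (Finset.mem_univ i),
        ← Finset.sum_filter, show Finset.univ.filter (fun c => c < i) = Finset.Iio i by ext; simp,
        Finset.sum_sub_distrib, Finset.sum_const, Fin.card_Iio, ← Finset.sum_smul,
        ← Nat.cast_smul_eq_nsmul ℂ, smul_smul, smul_smul, ← sub_smul, ← add_smul, ← add_smul]
      congr 1
      simp only [diagCoeff, shiftedCoord]
      push_cast
      ring

open PowerSeries in
-- The generating series satisfy `α_i (1 - l_i w) = 1 + w ∑_{c < i} α_c`, so `1 + w ∑_{c < k} α_c`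
-- telescopes to `∏_{c < k} (1 - (l_c - 1) w) / (1 - l_c w)`. At `k = N` the partial fractions of
-- this product, case `e = 1`, `t = 0` of `prod_quadSeries_shift`, have the jump weights as
-- residues.
theorem sum_diagCoeff_eq (l : Fin N → ℝ) (hl : Function.Injective l) (m : ℕ) :
    ∑ i, diagCoeff l m i = ∑ i, jumpCoeff l 1 i * l i ^ m := by
  set α : Fin N → ℝ⟦X⟧ := fun i => mk fun m => diagCoeff l m i with hα
  have h1 : ∀ i, α i * quadSeries (l i) 0 = 1 + X * ∑ c ∈ Finset.Iio i, α c := by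
    intro i
    have e : α i * quadSeries (l i) 0 = α i - C (l i) * (X * α i) := by
      rw [quadSeries, map_zero]; ring
    rw [e]
    ext k
    cases k with
    | zero => simp [hα, diagCoeff]
    | succ k =>
      simp only [map_sub, map_add, coeff_C_mul, coeff_succ_X_mul, map_sum, hα, coeff_mk, diagCoeff,
        coeff_one]
      simp
  have h2 : ∀ k, k ≤ N → (1 + X * ∑ c ∈ Finset.univ.filter (fun c : Fin N => (c : ℕ) < k), α c) *
      ∏ c ∈ Finset.univ.filter (fun c : Fin N => (c : ℕ) < k), quadSeries (l c) 0 =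
      ∏ c ∈ Finset.univ.filter (fun c : Fin N => (c : ℕ) < k), quadSeries (l c - 1) 0 := by
    intro k
    induction k with
    | zero => simp
    | succ k ih =>
      intro hk
      set i : Fin N := ⟨k, hk⟩ with hi
      have hf : Finset.univ.filter (fun c : Fin N => (c : ℕ) < k + 1)
          = insert i (Finset.univ.filter (fun c : Fin N => (c : ℕ) < k)) := by
        ext c
        simp only [Finset.mem_filter, Finset.mem_univ, true_and, Finset.mem_insert, hi, Fin.ext_iff]
        omega
      have hni : i ∉ Finset.univ.filter (fun c : Fin N => (c : ℕ) < k) := by simp [hi]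
      have hio : Finset.Iio i = Finset.univ.filter (fun c : Fin N => (c : ℕ) < k) := by
        ext c; simp [hi, Fin.lt_def]
      have h1i := h1 i
      rw [hio] at h1i
      rw [hf, Finset.sum_insert hni, Finset.prod_insert hni, Finset.prod_insert hni, ← ih (by omega)]
      have e : quadSeries (l i - 1) 0 = quadSeries (l i) 0 + X := by
        rw [quadSeries, quadSeries, map_sub, map_one]; ring
      rw [e]
      linear_combination (X * ∏ c ∈ Finset.univ.filter (fun c : Fin N => (c : ℕ) < k),
        quadSeries (l c) 0) * h1i
  have h3 := h2 N le_rfl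
  have hf : Finset.univ.filter (fun c : Fin N => (c : ℕ) < N) = Finset.univ := by ext c; simp
  rw [hf, prod_quadSeries_shift l hl 1 0, mul_comm] at h3
  have hne : ∏ j, quadSeries (l j) 0 ≠ 0 := by
    refine Finset.prod_ne_zero_iff.2 fun j _ h0 => ?_
    have := quadSeries_mul_mk_dicksonU (l j) (0 : ℝ)
    rw [h0, zero_mul] at this
    exact zero_ne_one this
  have h4 := congrArg (coeff (m + 1)) (mul_left_cancel₀ hne h3)
  simp only [map_add, coeff_one, coeff_succ_X_mul, map_sum, coeff_C_mul, hα, coeff_mk,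
    dicksonU_zero_right, one_mul] at h4
  simpa using h4

/-- The partial trace of an operator on `V ⊗ ℂ^N` over the second factor. -/
noncomputable def partialTrace (B : Module.End ℂ (Fin N → V)) : Module.End ℂ V :=
  ∑ i, LinearMap.proj i ∘ₗ B ∘ₗ LinearMap.single ℂ (fun _ => V) i

theorem partialTrace_apply (B : Module.End ℂ (Fin N → V)) (v : V) :
    partialTrace B v = ∑ i, B (Pi.single i v) i := by
  simp [partialTrace]

theorem partialTrace_tensLift_mul (A : Module.End ℂ V) (B : Module.End ℂ (Fin N → V)) :
    partialTrace (tensLift A * B) = A * partialTrace B := by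
  ext v
  simp [partialTrace_apply, tensLift_apply, Module.End.mul_apply]

open Polynomial in
/-- The partial trace of a polynomial in `tensX` acts on highest vectors as the (unnormalized)
average of this polynomial over the possible jumps. -/
theorem partialTrace_aeval_tensX (hE : GLRelations E) {lam : Fin N → ℤ} (hlam : Antitone lam) {v : V}
    (hv : IsHighestVector E lam v) (p : ℂ[X]) :
    partialTrace (aeval (tensX E) p) v =
      (∑ i, ((jumpCoeff (shiftedCoord lam) 1 i : ℝ) : ℂ) * p.eval ((shiftedCoord lam i : ℝ) : ℂ)) • v := by
  induction p using Polynomial.induction_on' with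
  | add p q hp hq =>
    simp only [partialTrace_apply] at hp hq ⊢
    simp only [map_add, LinearMap.add_apply, Pi.add_apply, Finset.sum_add_distrib, hp, hq, eval_add,
      mul_add, add_smul]
  | monomial m a =>
    have h1 : ∀ i, (aeval (tensX E) (monomial m a)) (Pi.single i v) i
        = (a * ((diagCoeff (shiftedCoord lam) m i : ℝ) : ℂ)) • v := by
      intro i
      rw [aeval_monomial, Module.algebraMap_end_eq_smul_id, smul_mul_assoc, LinearMap.smul_apply,
        Pi.smul_apply, mul_smul, ← (tensX_pow_single hE hv m).2 i]
      rfl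
    rw [partialTrace_apply, Finset.sum_congr rfl fun i _ => h1 i, ← Finset.sum_smul,
      ← Finset.mul_sum, ← Complex.ofReal_sum,
      sum_diagCoeff_eq _ (shiftedCoord_strictAnti hlam).injective]
    congr 1
    push_cast
    rw [Finset.mul_sum]
    exact Finset.sum_congr rfl fun i _ => by rw [eval_monomial]; ring

/-- Conjugation by `g` in the second factor does not change the trace over that factor. -/
theorem commute_partialTrace {g h : Matrix (Fin N) (Fin N) ℂ} (hgh : g * h = 1)
    {T : Module.End ℂ V} {B : Module.End ℂ (Fin N → V)} (hB : Commute B (tensT g T)) :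
    Commute (partialTrace B) T := by
  have hhg : h * g = 1 := mul_eq_one_comm.1 hgh
  refine LinearMap.ext fun v => ?_
  have hs : ∀ e, tensT g T (Pi.single e v) = ∑ d, g d e • Pi.single d (T v) := by
    intro e
    funext c
    rw [tensT_apply, Finset.sum_apply, Finset.sum_eq_single e, Finset.sum_eq_single c]
    · simp
    · intro b _ hb; simp [Pi.single_apply, hb.symm]
    · simp
    · intro b _ hb; simp [Pi.single_apply, hb]
    · simp
  have key : ∀ c e, ∑ d, g c d • T (B (Pi.single e v) d) = ∑ d, g d e • B (Pi.single d (T v)) c := by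
    intro c e
    have h1 := congrFun (LinearMap.congr_fun hB.eq (Pi.single e v)) c
    rw [Module.End.mul_apply, Module.End.mul_apply, tensT_apply, hs, map_sum, Finset.sum_apply] at h1
    rw [← h1]
    simp
  have h2 : ∑ e, ∑ c, h e c • ∑ d, g c d • T (B (Pi.single e v) d)
      = ∑ e, ∑ c, h e c • ∑ d, g d e • B (Pi.single d (T v)) c := by
    simp only [key]
  rw [Module.End.mul_apply, Module.End.mul_apply, partialTrace_apply, partialTrace_apply, map_sum]
  have h3 : ∀ e, ∑ c, h e c • ∑ d, g c d • T (B (Pi.single e v) d) = T (B (Pi.single e v) e) := by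
    intro e
    simp only [Finset.smul_sum, smul_smul]
    rw [Finset.sum_comm]
    simp only [← Finset.sum_smul, ← Matrix.mul_apply, hhg]
    simp [Matrix.one_apply]
  have h4 : ∀ c, ∑ e, h e c • ∑ d, g d e • B (Pi.single d (T v)) c = B (Pi.single c (T v)) c := by
    intro c
    simp only [Finset.smul_sum, smul_smul]
    rw [Finset.sum_comm]
    simp only [← Finset.sum_smul, mul_comm (h _ _), ← Matrix.mul_apply, hgh]
    simp [Matrix.one_apply]
  rw [← Finset.sum_congr rfl fun c _ => h4 c, Finset.sum_comm, ← h2]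
  exact Finset.sum_congr rfl fun e _ => h3 e

end PartialTrace

/-! ### The tensor power in coordinates and the operators acting by linear statistics. -/

section Coordinates

/-- The coordinate space of the `n`-th tensor power of `ℂ^N`. -/
abbrev TensorCoord (N n : ℕ) : Type := (Fin n → Fin N) → ℂ

variable {N : ℕ}

/-- The action of the matrix units of `gl_N` on the `n`-th tensor power of `ℂ^N`. -/
def coordE (n : ℕ) (a b : Fin N) : Module.End ℂ (TensorCoord N n) where
  toFun ψ f := ∑ j, if f j = a then ψ (Function.update f j b) else 0
  map_add' u v := by
    ext f
    rw [Pi.add_apply, ← Finset.sum_add_distrib]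
    exact Finset.sum_congr rfl fun j _ => by split_ifs <;> simp
  map_smul' r u := by
    ext f
    rw [RingHom.id_apply, Pi.smul_apply, smul_eq_mul, Finset.mul_sum]
    exact Finset.sum_congr rfl fun j _ => by split_ifs <;> simp

/-- The matrix of `g ⊗ ⋯ ⊗ g`. -/
def tensorMatrix (n : ℕ) (g : Matrix (Fin N) (Fin N) ℂ) :
    Matrix (Fin n → Fin N) (Fin n → Fin N) ℂ :=
  fun f h => ∏ j, g (f j) (h j)

/-- The action of `g` on the `n`-th tensor power of `ℂ^N`. -/
noncomputable def coordT (n : ℕ) (g : Matrix (Fin N) (Fin N) ℂ) : Module.End ℂ (TensorCoord N n) :=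
  Matrix.toLin' (tensorMatrix n g)

theorem coordE_apply (n : ℕ) (a b : Fin N) (ψ : TensorCoord N n) (f : Fin n → Fin N) :
    coordE n a b ψ f = ∑ j, if f j = a then ψ (Function.update f j b) else 0 := rfl

theorem coordT_apply (n : ℕ) (g : Matrix (Fin N) (Fin N) ℂ) (ψ : TensorCoord N n)
    (f : Fin n → Fin N) : coordT n g ψ f = ∑ h, (∏ j, g (f j) (h j)) * ψ h := rfl

theorem tensorMatrix_conjTranspose (n : ℕ) (g : Matrix (Fin N) (Fin N) ℂ) :
    (tensorMatrix n g).conjTranspose = tensorMatrix n g.conjTranspose := by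
  ext f k
  simp [tensorMatrix, Matrix.conjTranspose_apply]

/-- Splitting off the first tensor factor. -/
def splitEquiv (N n : ℕ) : TensorCoord N (n + 1) ≃ₗ[ℂ] (Fin N → TensorCoord N n) where
  toFun u a f := u (Fin.cons a f)
  invFun w f := w (f 0) (Fin.tail f)
  map_add' _ _ := rfl
  map_smul' _ _ := rfl
  left_inv u := by ext f; simp
  right_inv w := by ext a f; simp

theorem splitEquiv_apply (n : ℕ) (u : TensorCoord N (n + 1)) (a : Fin N) (f : Fin n → Fin N) :
    splitEquiv N n u a f = u (Fin.cons a f) := rfl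

theorem splitEquiv_coordE (n : ℕ) (a b : Fin N) (ψ : TensorCoord N (n + 1)) :
    splitEquiv N n (coordE (n + 1) a b ψ) = tensE (coordE n) a b (splitEquiv N n ψ) := by
  funext c
  ext f
  rw [splitEquiv_apply, coordE_apply, tensE_apply, Pi.add_apply, coordE_apply, Fin.sum_univ_succ,
    add_comm]
  simp only [Fin.cons_zero, Fin.cons_succ, Fin.update_cons_zero, ← Fin.cons_update,
    splitEquiv_apply]
  split_ifs <;> rfl

theorem splitEquiv_coordT (n : ℕ) (g : Matrix (Fin N) (Fin N) ℂ) (ψ : TensorCoord N (n + 1)) :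
    splitEquiv N n (coordT (n + 1) g ψ) = tensT g (coordT n g) (splitEquiv N n ψ) := by
  funext c
  ext f
  rw [splitEquiv_apply, coordT_apply, tensT_apply, Finset.sum_apply,
    ← (Fin.consEquiv fun _ => Fin N).sum_comp, Fintype.sum_prod_type]
  refine Finset.sum_congr rfl fun d _ => ?_
  rw [Pi.smul_apply, coordT_apply, smul_eq_mul, Finset.mul_sum]
  refine Finset.sum_congr rfl fun h _ => ?_
  simp [Fin.prod_univ_succ, Fin.consEquiv, splitEquiv_apply, mul_assoc]

theorem glRelations_coordE (n : ℕ) : GLRelations (coordE (N := N) n) := by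
  induction n with
  | zero =>
    intro a b c d
    have h0 : ∀ a b : Fin N, coordE 0 a b = 0 := fun a b => by
      ext ψ f; simp [coordE_apply]
    simp [h0]
  | succ n ih =>
    intro a b c d
    refine LinearMap.ext fun ψ => (splitEquiv N n).injective ?_
    have h := LinearMap.congr_fun (glRelations_tensE ih a b c d) (splitEquiv N n ψ)
    rw [LinearMap.sub_apply, LinearMap.sub_apply] at h ⊢
    simp only [Module.End.mul_apply, map_sub, splitEquiv_coordE] at h ⊢
    rw [h]
    congr 1 <;> split_ifs <;> simp [splitEquiv_coordE]

theorem glEquivariant_coordE (n : ℕ) (g : Matrix (Fin N) (Fin N) ℂ) :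
    GLEquivariant (coordE n) g (coordT n g) := by
  induction n with
  | zero =>
    intro a b
    have h0 : ∀ a b : Fin N, coordE 0 a b = 0 := fun a b => by
      ext ψ f; simp [coordE_apply]
    simp [h0]
  | succ n ih =>
    intro a b
    refine LinearMap.ext fun ψ => (splitEquiv N n).injective ?_
    have h := LinearMap.congr_fun (glEquivariant_tensE ih a b) (splitEquiv N n ψ)
    simpa only [LinearMap.sum_apply, LinearMap.smul_apply, Module.End.mul_apply, map_sum, map_smul,
      splitEquiv_coordE, splitEquiv_coordT] using h

/-- Infinitesimal unitarity: the adjoint of `E_{ab}` is `E_{ba}`. -/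
theorem dotProduct_coordE (n : ℕ) (a b : Fin N) (φ ψ : TensorCoord N n) :
    star (coordE n a b φ) ⬝ᵥ ψ = star φ ⬝ᵥ coordE n b a ψ := by
  simp only [dotProduct, Pi.star_apply, coordE_apply, star_sum, Finset.sum_mul, Finset.mul_sum]
  rw [Finset.sum_comm]
  rw [Finset.sum_comm (f := fun x i => star (φ x) * if x i = b then ψ (Function.update x i a) else 0)]
  refine Finset.sum_congr rfl fun j _ => ?_
  have e1 : ∀ x : Fin n → Fin N, star (if x j = a then φ (Function.update x j b) else 0) * ψ x
      = if x j = a then star (φ (Function.update x j b)) * ψ x else 0 := fun x => by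
    split_ifs <;> simp
  have e2 : ∀ x : Fin n → Fin N, star (φ x) * (if x j = b then ψ (Function.update x j a) else 0)
      = if x j = b then star (φ x) * ψ (Function.update x j a) else 0 := fun x => by
    split_ifs <;> simp
  simp only [e1, e2]
  rw [← Finset.sum_filter, ← Finset.sum_filter]
  refine Finset.sum_nbij' (fun f => Function.update f j b) (fun f => Function.update f j a)
    ?_ ?_ ?_ ?_ ?_
  · intro f hf; simp
  · intro f hf; simp
  · intro f hf
    have : f j = a := by simpa using hf
    simp [← this]
  · intro f hf
    have : f j = b := by simpa using hf
    simp [← this]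
  · intro f hf
    have : f j = a := by simpa using hf
    simp [← this]

open scoped ComplexOrder in
/-- Weights of highest vectors are dominant. -/
theorem IsHighestVector.antitone {n : ℕ} {lam : Fin N → ℤ} {v : TensorCoord N n}
    (hv : IsHighestVector (coordE n) lam v) (hne : v ≠ 0) : Antitone lam := by
  intro a b hab
  rcases hab.eq_or_lt with rfl | hab
  · exact le_rfl
  -- `‖E_{ba} v‖² = ⟨v, E_{ab} E_{ba} v⟩`, and `E_{ab} v = 0`, so only the commutator `E_{aa} -
  -- E_{bb}` contributes.
  have h1 : star (coordE n b a v) ⬝ᵥ coordE n b a v = ((lam a - lam b : ℤ) : ℂ) * (star v ⬝ᵥ v) := by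
    rw [dotProduct_coordE, (glRelations_coordE n).apply, hv.1 a b hab, map_zero, zero_add, if_pos rfl,
      if_pos rfl, hv.2, hv.2, ← sub_smul, dotProduct_smul, smul_eq_mul]
    push_cast
    rfl
  have h2 : (0 : ℂ) ≤ star (coordE n b a v) ⬝ᵥ coordE n b a v := dotProduct_star_self_nonneg _
  have h3 : (0 : ℂ) < star v ⬝ᵥ v := by
    refine lt_of_le_of_ne (dotProduct_star_self_nonneg _) fun h => hne ?_
    exact dotProduct_star_self_eq_zero.1 h.symm
  rw [h1] at h2
  have h4 : (0 : ℂ) ≤ ((lam a - lam b : ℤ) : ℂ) := by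
    by_contra hcon
    have hlt : ((lam a - lam b : ℤ) : ℂ) < 0 := by
      have : ¬ (0 : ℤ) ≤ lam a - lam b := fun h => hcon (by exact_mod_cast h)
      exact_mod_cast not_le.1 this
    exact absurd h2 (not_le_of_gt (mul_neg_of_neg_of_pos hlt h3))
  have h5 : 0 ≤ lam a - lam b := by exact_mod_cast h4
  linarith

open Polynomial in
theorem commute_aeval {A : Type*} [Ring A] [Algebra ℂ A] {x y : A} (h : Commute x y) (p : ℂ[X]) :
    Commute (aeval x p) y := by
  induction p using Polynomial.induction_on' with
  | add p q hp hq => rw [map_add]; exact hp.add_left hq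
  | monomial m a =>
    rw [aeval_monomial]
    exact (Algebra.commute_algebraMap_left a y).mul_left (h.pow_left m)

open Polynomial in
/-- The operator acting on the irreducible components of highest weight `lam` by
`∑ φ(lam_j + N - j)`; it is built from the Jucys–Murphy elements. -/
noncomputable def statOp (φ : ℂ[X]) : (n : ℕ) → Module.End ℂ (TensorCoord N n)
  | 0 => (linStat φ (0 : Fin N → ℤ)) • 1
  | n + 1 => (splitEquiv N n).symm.conj
      (tensLift (statOp φ n) + aeval (tensX (coordE n)) (φ.comp (X + 1) - φ))

open Polynomial in
theorem splitEquiv_statOp (φ : ℂ[X]) (n : ℕ) (ψ : TensorCoord N (n + 1)) :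
    splitEquiv N n (statOp φ (n + 1) ψ) = (tensLift (statOp φ n) +
      aeval (tensX (coordE n)) (φ.comp (X + 1) - φ) : Module.End ℂ (Fin N → TensorCoord N n))
        (splitEquiv N n ψ) := by
  simp [statOp, LinearEquiv.conj_apply]

open Polynomial in
theorem commute_statOp_coordE (φ : ℂ[X]) (n : ℕ) (a b : Fin N) :
    Commute (statOp φ n) (coordE n a b) := by
  induction n generalizing a b with
  | zero => exact (Commute.one_left _).smul_left _
  | succ n ih =>
    have h : Commute (tensLift (statOp φ n) + aeval (tensX (coordE n)) (φ.comp (X + 1) - φ))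
        (tensE (coordE n) a b) :=
      (commute_tensLift_tensE (ih a b)).add_left (commute_aeval (commute_tensX_tensE (glRelations_coordE n) a b) _)
    refine LinearMap.ext fun ψ => (splitEquiv N n).injective ?_
    have h := LinearMap.congr_fun h.eq (splitEquiv N n ψ)
    rw [Module.End.mul_apply, Module.End.mul_apply] at h ⊢
    rw [splitEquiv_statOp, splitEquiv_coordE, splitEquiv_coordE, splitEquiv_statOp, h]

open Polynomial in
theorem commute_statOp_coordT (φ : ℂ[X]) (n : ℕ) (g : Matrix (Fin N) (Fin N) ℂ) :
    Commute (statOp φ n) (coordT n g) := by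
  induction n with
  | zero => exact (Commute.one_left _).smul_left _
  | succ n ih =>
    have h : Commute (tensLift (statOp φ n) + aeval (tensX (coordE n)) (φ.comp (X + 1) - φ))
        (tensT g (coordT n g)) :=
      (commute_tensLift_tensT g ih).add_left
        (commute_aeval (commute_tensX_tensT (glEquivariant_coordE n g)) _)
    refine LinearMap.ext fun ψ => (splitEquiv N n).injective ?_
    have h := LinearMap.congr_fun h.eq (splitEquiv N n ψ)
    rw [Module.End.mul_apply, Module.End.mul_apply] at h ⊢
    rw [splitEquiv_statOp, splitEquiv_coordT, splitEquiv_coordT, splitEquiv_statOp, h]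

theorem IsHighestVector.splitEquiv {n : ℕ} {lam : Fin N → ℤ} {v : TensorCoord N (n + 1)}
    (hv : IsHighestVector (coordE (n + 1)) lam v) :
    IsHighestVector (tensE (coordE n)) lam (splitEquiv N n v) :=
  ⟨fun a b h => by rw [← splitEquiv_coordE, hv.1 a b h, map_zero],
    fun a => by rw [← splitEquiv_coordE, hv.2, map_smul]⟩

open Polynomial in
theorem statOp_apply_highest (φ : ℂ[X]) (n : ℕ) (lam : Fin N → ℤ) (v : TensorCoord N n)
    (hv : IsHighestVector (coordE n) lam v) : statOp φ n v = linStat φ lam • v := by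
  induction n generalizing lam with
  | zero =>
    by_cases hne : v = 0
    · simp [hne]
    have hlam : lam = 0 := by
      funext a
      have h := hv.2 a
      have h0 : coordE 0 a a v = 0 := by ext f; simp [coordE_apply]
      rw [h0, eq_comm, smul_eq_zero] at h
      exact_mod_cast h.resolve_right hne
    rw [hlam]
    rfl
  | succ n ih =>
    by_cases hne : v = 0
    · simp [hne]
    refine (splitEquiv N n).injective ?_
    rw [splitEquiv_statOp, map_smul]
    exact tens_acts_linStat (glRelations_coordE n) (commute_statOp_coordE φ n) φ ih
      (hv.antitone hne) hv.splitEquiv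

theorem trace_coord_eq_sum {ι : Type*} [Fintype ι] [DecidableEq ι] (A : Module.End ℂ (ι → ℂ)) :
    LinearMap.trace ℂ (ι → ℂ) A = ∑ f, A (Pi.single f 1) f := by
  rw [LinearMap.trace_eq_matrix_trace ℂ (Pi.basisFun ℂ ι), Matrix.trace]
  refine Finset.sum_congr rfl fun f _ => ?_
  simp [LinearMap.toMatrix_apply, Matrix.diag]

theorem trace_split (n : ℕ) (B : Module.End ℂ (Fin N → TensorCoord N n)) :
    LinearMap.trace ℂ (TensorCoord N (n + 1)) ((splitEquiv N n).symm.conj B) =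
      LinearMap.trace ℂ (TensorCoord N n) (partialTrace B) := by
  rw [trace_coord_eq_sum, trace_coord_eq_sum, ← (Fin.consEquiv fun _ => Fin N).sum_comp,
    Fintype.sum_prod_type_right]
  refine Finset.sum_congr rfl fun f _ => ?_
  rw [partialTrace_apply, Finset.sum_apply]
  refine Finset.sum_congr rfl fun a _ => ?_
  have h : splitEquiv N n (Pi.single (Fin.cons a f) 1) = Pi.single a (Pi.single f 1) := by
    funext c
    ext k
    rw [splitEquiv_apply]
    by_cases hc : c = a
    · subst hc
      by_cases hk : k = f
      · subst hk; simp
      · rw [Pi.single_eq_same, Pi.single_eq_of_ne hk, Pi.single_eq_of_ne]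
        intro h; exact hk (Fin.cons_right_injective _ h)
    · rw [Pi.single_eq_of_ne hc, Pi.single_eq_of_ne, Pi.zero_apply]
      intro h; exact hc (congrFun h 0)
  rw [LinearEquiv.conj_apply, LinearEquiv.symm_symm]
  simp only [Fin.consEquiv, Equiv.coe_fn_mk, LinearMap.comp_apply, LinearEquiv.coe_coe]
  change ((splitEquiv N n).symm _) (Fin.cons a f) = _
  rw [h]
  rfl

open Polynomial in
theorem splitEquiv_conj_statOp (φ : ℂ[X]) (n : ℕ) :
    (statOp φ (n + 1) : Module.End ℂ (TensorCoord N (n + 1))) = (splitEquiv N n).symm.conj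
      (tensLift (statOp φ n) + aeval (tensX (coordE n)) (φ.comp (X + 1) - φ)) := rfl

open Polynomial in
-- A trace over `n + 1` factors is a trace over `n` factors of a partial trace. The two summands of
-- `statOp` commute, whence the binomial formula, and powers of `statOp φ n` come out of the partial
-- trace.
theorem trace_statOp_succ_pow (φ : ℂ[X]) (n r : ℕ) :
    LinearMap.trace ℂ (TensorCoord N (n + 1)) (statOp φ (n + 1) ^ r) =
      LinearMap.trace ℂ (TensorCoord N n) (∑ k ∈ Finset.range (r + 1),
        (r.choose k : ℂ) • (statOp φ n ^ k *
          partialTrace (aeval (tensX (coordE n)) ((φ.comp (X + 1) - φ) ^ (r - k))))) := by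
  have h1 : statOp φ (n + 1) ^ r = (splitEquiv N n).symm.conj
      ((tensLift (statOp φ n) + aeval (tensX (coordE n)) (φ.comp (X + 1) - φ)) ^ r) := by
    rw [splitEquiv_conj_statOp]
    exact (map_pow (splitEquiv N n).symm.conjRingEquiv _ r).symm
  have hc : Commute (tensLift (statOp (N := N) φ n))
      (aeval (tensX (coordE n)) (φ.comp (X + 1) - φ)) :=
    (commute_aeval (commute_tensLift_tensX (commute_statOp_coordE φ n)).symm _).symm
  rw [h1, trace_split, hc.add_pow]
  congr 1
  have hlin : ∀ (s : Finset ℕ) (f : ℕ → Module.End ℂ (Fin N → TensorCoord N n)),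
      partialTrace (∑ k ∈ s, f k) = ∑ k ∈ s, partialTrace (f k) := by
    intro s f
    refine LinearMap.ext fun v => ?_
    simp only [partialTrace_apply, LinearMap.sum_apply, Finset.sum_apply]
    exact Finset.sum_comm
  rw [hlin]
  refine Finset.sum_congr rfl fun k _ => ?_
  have h2 : ∀ k, (tensLift (statOp φ n) ^ k : Module.End ℂ (Fin N → TensorCoord N n)) =
      tensLift (statOp φ n ^ k) := by
    intro k
    induction k with
    | zero => rfl
    | succ k ih => rw [pow_succ, ih, pow_succ]; rfl
  rw [← partialTrace_tensLift_mul, h2, map_pow]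
  refine LinearMap.ext fun v => ?_
  rw [partialTrace_apply, LinearMap.smul_apply, partialTrace_apply, Finset.smul_sum]
  refine Finset.sum_congr rfl fun i _ => ?_
  rw [(Nat.cast_commute _ _).eq.symm, ← nsmul_eq_mul, LinearMap.smul_apply, Pi.smul_apply,
    Nat.cast_smul_eq_nsmul]

end Coordinates

/-! ### From invariance under the unitary group to invariance under the matrix units. -/

section InvariantSubspaces

variable {N n : ℕ}

/-- The infinitesimal action of a matrix on the `n`-th tensor power. -/
noncomputable def coordDeriv (n : ℕ) (M : Matrix (Fin N) (Fin N) ℂ) : Module.End ℂ (TensorCoord N n) :=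
  ∑ a, ∑ b, M a b • coordE n a b

theorem coordDeriv_apply (M : Matrix (Fin N) (Fin N) ℂ) (ψ : TensorCoord N n) (f : Fin n → Fin N) :
    coordDeriv n M ψ f = ∑ j, ∑ b, M (f j) b * ψ (Function.update f j b) := by
  simp only [coordDeriv, LinearMap.sum_apply, LinearMap.smul_apply, Finset.sum_apply, Pi.smul_apply,
    coordE_apply, smul_eq_mul, Finset.mul_sum]
  rw [Finset.sum_congr rfl fun a _ => Finset.sum_comm, Finset.sum_comm]
  refine Finset.sum_congr rfl fun j _ => ?_
  rw [Finset.sum_comm]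
  refine Finset.sum_congr rfl fun b _ => ?_
  simp

theorem hasDerivAt_coordT (M : Matrix (Fin N) (Fin N) ℂ) (ψ : TensorCoord N n) :
    HasDerivAt (fun s : ℂ => coordT n (1 + s • M) ψ) (coordDeriv n M ψ) 0 := by
  rw [hasDerivAt_pi]
  intro f
  have h1 : ∀ h : Fin n → Fin N, HasDerivAt (fun s : ℂ => (∏ j, (1 + s • M) (f j) (h j)) * ψ h)
      ((∑ j, (∏ k ∈ Finset.univ.erase j, (1 : Matrix (Fin N) (Fin N) ℂ) (f k) (h k)) *
        M (f j) (h j)) * ψ h) 0 := by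
    intro h
    have h2 : ∀ j ∈ Finset.univ, HasDerivAt (fun s : ℂ => (1 + s • M) (f j) (h j)) (M (f j) (h j)) 0 := by
      intro j _
      have : HasDerivAt (fun s : ℂ => (1 : Matrix (Fin N) (Fin N) ℂ) (f j) (h j) + s * M (f j) (h j))
          (1 * M (f j) (h j)) 0 := ((hasDerivAt_id (0 : ℂ)).mul_const _).const_add _
      rw [one_mul] at this
      exact this
    have h3 := (HasDerivAt.fun_finsetProd h2).mul_const (ψ h)
    refine h3.congr_deriv ?_
    simp
  have h4 := HasDerivAt.fun_sum (u := Finset.univ) fun h _ => h1 h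
  refine h4.congr_deriv ?_
  rw [coordDeriv_apply]
  simp only [Finset.sum_mul]
  rw [Finset.sum_comm]
  refine Finset.sum_congr rfl fun j _ => ?_
  have h5 : ∀ h : Fin n → Fin N,
      (∏ k ∈ Finset.univ.erase j, (1 : Matrix (Fin N) (Fin N) ℂ) (f k) (h k)) * M (f j) (h j) * ψ h
      = if h ∈ Finset.univ.image (fun b => Function.update f j b) then M (f j) (h j) * ψ h else 0 := by
    intro h
    by_cases hh : h ∈ Finset.univ.image (fun b => Function.update f j b)
    · rw [if_pos hh]
      obtain ⟨b, -, rfl⟩ := Finset.mem_image.1 hh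
      rw [Finset.prod_eq_one, one_mul]
      intro k hk
      rw [Function.update_of_ne (Finset.ne_of_mem_erase hk), Matrix.one_apply_eq]
    · rw [if_neg hh]
      have : ∃ k, k ≠ j ∧ f k ≠ h k := by
        by_contra! hcon
        refine hh (Finset.mem_image.2 ⟨h j, Finset.mem_univ _, ?_⟩)
        funext k
        by_cases hk : k = j
        · rw [hk, Function.update_self]
        · rw [Function.update_of_ne hk, hcon k hk]
      obtain ⟨k, hk1, hk2⟩ := this
      have h0 : ∏ k ∈ Finset.univ.erase j, (1 : Matrix (Fin N) (Fin N) ℂ) (f k) (h k) = 0 :=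
        Finset.prod_eq_zero (Finset.mem_erase.2 ⟨hk1, Finset.mem_univ k⟩) (Matrix.one_apply_ne hk2)
      rw [h0, zero_mul, zero_mul]
  rw [Finset.sum_congr rfl fun h _ => h5 h, ← Finset.sum_filter, Finset.filter_mem_eq_inter,
    Finset.univ_inter, Finset.sum_image fun b _ c _ hbc => Function.update_injective f j hbc]
  simp

/-- A subspace of the `n`-th tensor power stable under the unitary group. -/
def UnitaryStable (W : Submodule ℂ (TensorCoord N n)) : Prop :=
  ∀ g ∈ Matrix.unitaryGroup (Fin N) ℂ, ∀ w ∈ W, coordT n g w ∈ W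

/-- For an orthogonal projection `Q` the matrix `exp (iθQ) = 1 + (e^{iθ} - 1) Q` is unitary. Its
tensor power preserves `W`, which is closed, so the derivative at `θ = 0` does as well. -/
theorem UnitaryStable.coordDeriv_mem {W : Submodule ℂ (TensorCoord N n)} (hW : UnitaryStable W)
    {Q : Matrix (Fin N) (Fin N) ℂ} (hQ1 : Q * Q = Q) (hQ2 : Q.conjTranspose = Q)
    {w : TensorCoord N n} (hw : w ∈ W) : coordDeriv n Q w ∈ W := by
  have h1 : HasDerivAt (fun θ : ℝ => Complex.exp (θ * Complex.I) - 1) Complex.I 0 := by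
    have h : HasDerivAt (fun z : ℂ => Complex.exp (z * Complex.I) - 1)
        (Complex.exp (((0 : ℝ) : ℂ) * Complex.I) * (1 * Complex.I)) ((0 : ℝ) : ℂ) :=
      (((hasDerivAt_id _).mul_const _).cexp).sub_const _
    simpa using h.comp_ofReal
  have h2 : HasDerivAt (fun θ : ℝ => coordT n (1 + (Complex.exp (θ * Complex.I) - 1) • Q) w)
      (Complex.I • coordDeriv n Q w) 0 := by
    refine HasDerivAt.scomp (h := fun θ : ℝ => Complex.exp (θ * Complex.I) - 1) (0 : ℝ)
      (g₁ := fun s : ℂ => coordT n (1 + s • Q) w) ?_ h1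
    simpa using hasDerivAt_coordT Q w
  have hmem : ∀ θ : ℝ, coordT n (1 + (Complex.exp (θ * Complex.I) - 1) • Q) w ∈ W := by
    intro θ
    refine hW _ ?_ w hw
    rw [Matrix.mem_unitaryGroup_iff, Matrix.star_eq_conjTranspose, Matrix.conjTranspose_add,
      Matrix.conjTranspose_smul, hQ2, Matrix.conjTranspose_one]
    have h3 : Complex.exp (θ * Complex.I) * star (Complex.exp (θ * Complex.I)) = 1 := by
      rw [← starRingEnd_apply, Complex.mul_conj, Complex.normSq_eq_norm_sq,
        Complex.norm_exp_ofReal_mul_I]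
      simp
    rw [star_sub, star_one]
    have h4 : ∀ s r : ℂ, (1 + s • Q) * (1 + r • Q) = 1 + (s + r + s * r) • Q := by
      intro s r
      rw [add_mul, mul_add, mul_add, one_mul, mul_one, one_mul, smul_mul_smul_comm, hQ1]
      module
    rw [h4]
    have h5 : (Complex.exp (θ * Complex.I) - 1) + (star (Complex.exp (θ * Complex.I)) - 1)
        + (Complex.exp (θ * Complex.I) - 1) * (star (Complex.exp (θ * Complex.I)) - 1) = 0 := by
      linear_combination h3
    rw [h5, zero_smul, add_zero]
  have hclosed : IsClosed (W : Set (TensorCoord N n)) := W.closed_of_finiteDimensional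
  have hlim := hasDerivAt_iff_tendsto_slope.1 h2
  have h6 : Complex.I • coordDeriv n Q w ∈ W := by
    refine hclosed.mem_of_tendsto hlim (Filter.Eventually.of_forall fun θ => ?_)
    rw [slope_def_module]
    have h7 : ∀ (r : ℝ) (x : TensorCoord N n), r • x = (r : ℂ) • x := fun r x => by
      ext f; simp
    rw [h7]
    exact W.smul_mem _ (W.sub_mem (hmem _) (hmem _))
  have h8 := W.smul_mem (-Complex.I) h6
  rwa [smul_smul, neg_mul, Complex.I_mul_I, neg_neg, one_smul] at h8

/-- Rank-one orthogonal projections span all matrices over `ℂ`. -/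
theorem UnitaryStable.coordE_mem {W : Submodule ℂ (TensorCoord N n)} (hW : UnitaryStable W)
    (a b : Fin N) {w : TensorCoord N n} (hw : w ∈ W) : coordE n a b w ∈ W := by
  have hproj : ∀ v : Fin N → ℂ, star v ⬝ᵥ v = 1 → coordDeriv n (Matrix.vecMulVec v (star v)) w ∈ W := by
    intro v hv
    refine hW.coordDeriv_mem ?_ ?_ hw
    · rw [Matrix.vecMulVec_mul_vecMulVec, hv]; simp
    · rw [Matrix.conjTranspose_vecMulVec, star_star]
  by_cases hab : a = b
  · subst hab
    have h := hproj (Pi.single a 1) (by simp [← Pi.single_star])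
    convert h using 1
    ext f
    rw [coordE_apply, coordDeriv_apply]
    refine Finset.sum_congr rfl fun j _ => ?_
    rw [Finset.sum_eq_single a]
    · by_cases hf : f j = a <;> simp [Matrix.vecMulVec_apply, hf]
    · intro c _ hc
      simp [Matrix.vecMulVec_apply, hc]
    · simp
  · set s : ℂ := ((Real.sqrt 2 : ℝ) : ℂ)⁻¹ with hs
    have hs2 : s * s = 1 / 2 := by
      rw [hs, ← mul_inv, ← Complex.ofReal_mul, Real.mul_self_sqrt (by norm_num)]; norm_num
    have hss : star s = s := by
      rw [hs, star_inv₀]; simp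
    let v : ℂ → Fin N → ℂ := fun ω => s • (Pi.single a 1 + ω • Pi.single b 1)
    have hv : ∀ ω : ℂ, star ω * ω = 1 → coordDeriv n (Matrix.vecMulVec (v ω) (star (v ω))) w ∈ W := by
      intro ω hω
      refine hproj _ ?_
      have e : v ω = Pi.single a s + Pi.single b (s * ω) := by
        funext c
        by_cases h1 : c = a <;> by_cases h2 : c = b <;> simp [v, Pi.single_apply, h1, h2]
      rw [e, star_add, add_dotProduct, dotProduct_add, dotProduct_add, ← Pi.single_star,
        ← Pi.single_star]
      simp only [single_dotProduct, Pi.single_apply, hab, Ne.symm hab, star_mul, hss, if_true, if_false]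
      linear_combination hs2 + s * s * hω + hs2
    have hI : star Complex.I = -Complex.I := by simp
    -- Weighting the projection onto `e_a + ω e_b` by `ω` and summing over the fourth roots of unity
    -- kills the diagonal entries and the entry `(b, a)`, as `∑ ω = ∑ ω² = 0`, and leaves twice the
    -- unit at `(a, b)`.
    have m1 := hv 1 (by simp)
    have m2 := W.smul_mem Complex.I (hv Complex.I (by simp))
    have m3 := W.smul_mem (-1) (hv (-1) (by simp))
    have m4 := W.smul_mem (-Complex.I) (hv (-Complex.I) (by simp))
    have hsum := W.smul_mem (1 / 2 : ℂ) (W.add_mem (W.add_mem m1 m2) (W.add_mem m3 m4))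
    convert hsum using 1
    ext f
    simp only [Pi.smul_apply, Pi.add_apply, smul_eq_mul, coordE_apply, coordDeriv_apply,
      Finset.mul_sum, ← Finset.sum_add_distrib]
    refine Finset.sum_congr rfl fun j _ => ?_
    have hterm : ∀ c : Fin N, (1 / 2 : ℂ) * (Matrix.vecMulVec (v 1) (star (v 1)) (f j) c
          * w (Function.update f j c)
        + Complex.I * (Matrix.vecMulVec (v Complex.I) (star (v Complex.I)) (f j) c
          * w (Function.update f j c))
        + (-1 * (Matrix.vecMulVec (v (-1)) (star (v (-1))) (f j) c * w (Function.update f j c))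
        + -Complex.I * (Matrix.vecMulVec (v (-Complex.I)) (star (v (-Complex.I))) (f j) c
          * w (Function.update f j c))))
        = (if f j = a then 1 else 0) * (if c = b then 1 else 0) * w (Function.update f j c) := by
      intro c
      have hst : ∀ p : Prop, ∀ _ : Decidable p, star (if p then (1 : ℂ) else 0) = if p then 1 else 0 := by
        intro p _; split_ifs <;> simp
      simp only [Matrix.vecMulVec_apply, v, Pi.star_apply, Pi.smul_apply, Pi.add_apply, smul_eq_mul,
        star_mul, star_add, hss, Pi.single_apply, star_neg, star_one, hI, hst]
      generalize (if f j = a then (1 : ℂ) else 0) = p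
      generalize (if f j = b then (1 : ℂ) else 0) = q
      generalize (if c = a then (1 : ℂ) else 0) = p'
      generalize (if c = b then (1 : ℂ) else 0) = q'
      linear_combination (p * q' * w (Function.update f j c) * (1 - Complex.I * Complex.I)) * hs2
        - (1 / 2) * p * q' * w (Function.update f j c) * Complex.I_mul_I
        + s * s * q * p' * w (Function.update f j c) * Complex.I_mul_I
    rw [Finset.sum_congr rfl fun c _ => hterm c, Finset.sum_eq_single b]
    · by_cases hf : f j = a <;> simp [hf]
    · intro c _ hc; simp [hc]
    · simp

end InvariantSubspaces

/-! ### Weights and highest vectors of stable subspaces. -/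

section Weights

variable {N n : ℕ}

/-- The weight of a basis vector of the `n`-th tensor power. -/
def indexWeight (f : Fin n → Fin N) (a : Fin N) : ℤ := (Finset.univ.filter fun j => f j = a).card

theorem indexWeight_eq_sum (f : Fin n → Fin N) (a : Fin N) :
    indexWeight f a = ∑ j, if f j = a then 1 else 0 := by
  simp [indexWeight]

theorem indexWeight_update (f : Fin n → Fin N) (j : Fin n) (b : Fin N) :
    indexWeight (Function.update f j b) = indexWeight f - Pi.single (f j) 1 + Pi.single b 1 := by
  funext c
  simp only [Pi.add_apply, Pi.sub_apply, indexWeight_eq_sum]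
  rw [← Finset.add_sum_erase _ _ (Finset.mem_univ j),
    ← Finset.add_sum_erase _ (fun i => if f i = c then (1 : ℤ) else 0) (Finset.mem_univ j)]
  have h : ∑ x ∈ Finset.univ.erase j, (if Function.update f j b x = c then (1 : ℤ) else 0)
      = ∑ x ∈ Finset.univ.erase j, if f x = c then 1 else 0 :=
    Finset.sum_congr rfl fun x hx => by rw [Function.update_of_ne (Finset.ne_of_mem_erase hx)]
  rw [h, Function.update_self]
  simp only [Pi.single_apply, eq_comm (a := c)]
  ring

theorem coordE_self_apply (a : Fin N) (ψ : TensorCoord N n) (f : Fin n → Fin N) :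
    coordE n a a ψ f = (indexWeight f a : ℂ) * ψ f := by
  rw [coordE_apply, indexWeight_eq_sum]
  push_cast
  rw [Finset.sum_mul]
  refine Finset.sum_congr rfl fun j _ => ?_
  by_cases h : f j = a
  · simp [← h]
  · simp [h]

theorem coordT_diagonal_apply (t : Fin N → ℂ) (ψ : TensorCoord N n) (f : Fin n → Fin N) :
    coordT n (Matrix.diagonal t) ψ f = (∏ a, t a ^ indexWeight f a) * ψ f := by
  rw [coordT_apply, Finset.sum_eq_single f]
  · congr 1
    simp only [Matrix.diagonal_apply_eq, indexWeight, zpow_natCast]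
    rw [← Finset.prod_fiberwise Finset.univ f]
    refine Finset.prod_congr rfl fun a _ => ?_
    rw [← Finset.prod_const]
    exact Finset.prod_congr rfl fun j hj => by rw [(Finset.mem_filter.1 hj).2]
  · intro h _ hh
    obtain ⟨j, hj⟩ := Function.ne_iff.1 (Ne.symm hh)
    have h0 : ∏ j, Matrix.diagonal t (f j) (h j) = 0 :=
      Finset.prod_eq_zero (Finset.mem_univ j) (Matrix.diagonal_apply_ne _ hj)
    rw [h0, zero_mul]
  · simp

theorem lex_lt_raise (lam : Fin N → ℤ) {a b : Fin N} (hab : a < b) :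
    toLex lam < toLex (lam + Pi.single a 1 - Pi.single b 1) := by
  refine ⟨a, fun j hj => ?_, ?_⟩
  · simp [Pi.single_apply, hj.ne, (hj.trans hab).ne]
  · simp [Pi.single_apply, hab.ne]

/-- If raising operators lead from `v` out of the allowed weights, then `v` is a highest vector. -/
theorem isHighestVector_of_support {v : TensorCoord N n} {lam : Fin N → ℤ}
    (hv : ∀ f, v f ≠ 0 → indexWeight f = lam)
    (hmax : ∀ a b, a < b → ∀ f, coordE n a b v f ≠ 0 → ¬ toLex lam < toLex (indexWeight f)) :
    IsHighestVector (coordE n) lam v := by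
  constructor
  · intro a b hab
    ext f
    by_contra hne
    refine hmax a b hab f hne ?_
    rw [coordE_apply] at hne
    obtain ⟨j, -, hj⟩ := Finset.exists_ne_zero_of_sum_ne_zero hne
    have hfj : f j = a := by
      by_contra h
      exact hj (if_neg h)
    rw [if_pos hfj] at hj
    have hw := hv _ hj
    rw [indexWeight_update, hfj] at hw
    have : indexWeight f = lam + Pi.single a 1 - Pi.single b 1 := by rw [← hw]; abel
    rw [this]
    exact lex_lt_raise lam hab
  · intro a
    ext f
    rw [coordE_self_apply, Pi.smul_apply, smul_eq_mul]
    by_cases h : v f = 0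
    · simp [h]
    · rw [hv f h]

/-- If some `f` in the support has a weight differing from that of `f₀` in coordinate `a`, then
`E_{aa} - indexWeight f a` removes `f` from the support and keeps `f₀`; iterate. -/
theorem UnitaryStable.exists_pure_weight {W : Submodule ℂ (TensorCoord N n)} (hW : UnitaryStable W)
    {w : TensorCoord N n} (hw : w ∈ W) {f₀ : Fin n → Fin N} (hf₀ : w f₀ ≠ 0) :
    ∃ v ∈ W, v f₀ ≠ 0 ∧ ∀ f, v f ≠ 0 → indexWeight f = indexWeight f₀ := by
  classical
  let supp : TensorCoord N n → ℕ := fun v => (Finset.univ.filter fun f => v f ≠ 0).card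
  induction hk : supp w using Nat.strong_induction_on generalizing w with
  | _ k ih =>
    by_cases h : ∀ f, w f ≠ 0 → indexWeight f = indexWeight f₀
    · exact ⟨w, hw, hf₀, h⟩
    · push Not at h
      obtain ⟨f, hf, hne⟩ := h
      obtain ⟨a, ha⟩ := Function.ne_iff.1 hne
      set w' : TensorCoord N n := coordE n a a w - (indexWeight f a : ℂ) • w with hw'
      have happ : ∀ g, w' g = ((indexWeight g a : ℂ) - indexWeight f a) * w g := fun g => by
        rw [hw', Pi.sub_apply, coordE_self_apply, Pi.smul_apply, smul_eq_mul, sub_mul]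
      refine ih (supp w') ?_ (W.sub_mem (hW.coordE_mem a a hw) (W.smul_mem _ hw)) ?_ rfl
      · rw [← hk]
        refine Finset.card_lt_card ⟨fun g hg => ?_, fun hcon => ?_⟩
        · have := (Finset.mem_filter.1 hg).2
          rw [happ] at this
          exact Finset.mem_filter.2 ⟨Finset.mem_univ _, right_ne_zero_of_mul this⟩
        · have := (Finset.mem_filter.1 (hcon (Finset.mem_filter.2 ⟨Finset.mem_univ f, hf⟩))).2
          rw [happ, sub_self, zero_mul] at this
          exact this rfl
      · have h0 : w' f₀ ≠ 0 := ?_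
        exact h0
        rw [happ]
        refine mul_ne_zero (sub_ne_zero.2 ?_) hf₀
        exact_mod_cast ha.symm

/-- A nonzero stable subspace contains a highest vector, whose weight is the largest one. -/
theorem UnitaryStable.exists_highest {W : Submodule ℂ (TensorCoord N n)} (hW : UnitaryStable W)
    (hne : W ≠ ⊥) : ∃ lam : Fin N → ℤ, ∃ v ∈ W, v ≠ 0 ∧ IsHighestVector (coordE n) lam v ∧
      (∀ f, v f ≠ 0 → indexWeight f = lam) ∧
      ∀ w ∈ W, ∀ f, w f ≠ 0 → toLex (indexWeight f) ≤ toLex lam := by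
  classical
  obtain ⟨w, hw, hw0⟩ := (Submodule.ne_bot_iff W).1 hne
  obtain ⟨f, hf⟩ := Function.ne_iff.1 hw0
  obtain ⟨f₀, hf₀, hmax⟩ := Finset.exists_max_image
    (Finset.univ.filter fun f : Fin n → Fin N => ∃ w ∈ W, w f ≠ 0) (fun f => toLex (indexWeight f))
    ⟨f, Finset.mem_filter.2 ⟨Finset.mem_univ _, w, hw, hf⟩⟩
  obtain ⟨-, w₀, hw₀, hw₀f⟩ := Finset.mem_filter.1 hf₀
  have hmax' : ∀ w ∈ W, ∀ f, w f ≠ 0 → toLex (indexWeight f) ≤ toLex (indexWeight f₀) :=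
    fun w hw f hf => hmax f (Finset.mem_filter.2 ⟨Finset.mem_univ _, w, hw, hf⟩)
  obtain ⟨v, hv, hv0, hvw⟩ := hW.exists_pure_weight hw₀ hw₀f
  refine ⟨indexWeight f₀, v, hv, fun h => hv0 (by rw [h]; rfl), ?_, hvw, hmax'⟩
  exact isHighestVector_of_support hvw fun a b _ f hf =>
    not_lt.2 (hmax' _ (hW.coordE_mem a b hv) f hf)

/-- Unitary trick: the adjoint of `g ⊗ ⋯ ⊗ g` is `g* ⊗ ⋯ ⊗ g*`, which preserves `W`. -/
theorem UnitaryStable.orthogonal {W : Submodule ℂ (TensorCoord N n)} (hW : UnitaryStable W)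
    {v : TensorCoord N n} (hv : ∀ w ∈ W, star w ⬝ᵥ v = 0) {g : Matrix (Fin N) (Fin N) ℂ}
    (hg : g ∈ Matrix.unitaryGroup (Fin N) ℂ) : ∀ w ∈ W, star w ⬝ᵥ coordT n g v = 0 := by
  intro w hw
  have h1 := hv (coordT n (star g) w) (hW _ (Unitary.star_mem hg) w hw)
  rw [← h1]
  change star w ⬝ᵥ Matrix.mulVec (tensorMatrix n g) v
    = star (Matrix.mulVec (tensorMatrix n (star g)) w) ⬝ᵥ v
  rw [Matrix.star_mulVec, Matrix.dotProduct_mulVec, tensorMatrix_conjTranspose,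
    Matrix.star_eq_conjTranspose, Matrix.conjTranspose_conjTranspose]

end Weights

/-! ### Subrepresentations of the tensor power and their highest weights. -/

section TensorPower

variable {N n : ℕ}

/-- Coordinates on the `n`-th tensor power. -/
noncomputable def tensorCoordEquiv (N n : ℕ) : (⨂[ℂ] _ : Fin n, (Fin N → ℂ)) ≃ₗ[ℂ] TensorCoord N n :=
  (Basis.piTensorProduct fun _ : Fin n => Pi.basisFun ℂ (Fin N)).equivFun

theorem tensorCoordEquiv_tprod (v : Fin n → Fin N → ℂ) (f : Fin n → Fin N) :
    tensorCoordEquiv N n (PiTensorProduct.tprod ℂ v) f = ∏ j, v j (f j) := by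
  rw [tensorCoordEquiv, Module.Basis.equivFun_apply, Basis.piTensorProduct_repr_tprod_apply]
  simp

theorem tensorCoordEquiv_tensorPowerRep (g : UnitaryGp N) (x : ⨂[ℂ] _ : Fin n, (Fin N → ℂ)) :
    tensorCoordEquiv N n (tensorPowerRep N n g x) = coordT n g.1 (tensorCoordEquiv N n x) := by
  have h : (tensorCoordEquiv N n).toLinearMap ∘ₗ tensorPowerRep N n g
      = coordT n g.1 ∘ₗ (tensorCoordEquiv N n).toLinearMap := by
    refine PiTensorProduct.ext (MultilinearMap.ext fun v => ?_)
    simp only [LinearMap.compMultilinearMap_apply, LinearMap.comp_apply, LinearEquiv.coe_coe]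
    ext f
    have e : tensorPowerRep N n g (PiTensorProduct.tprod ℂ v)
        = PiTensorProduct.tprod ℂ fun j => Matrix.mulVec g.1 (v j) :=
      PiTensorProduct.map_tprod _ _
    rw [e, tensorCoordEquiv_tprod, coordT_apply]
    simp only [tensorCoordEquiv_tprod, ← Finset.prod_mul_distrib, Matrix.mulVec, dotProduct]
    rw [Finset.prod_univ_sum, Fintype.piFinset_univ]
  exact LinearMap.congr_fun h x

/-- The coordinate image of a subrepresentation. -/
noncomputable def coordImage (W : Subrepresentation (tensorPowerRep N n)) :
    Submodule ℂ (TensorCoord N n) :=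
  W.toSubmodule.map (tensorCoordEquiv N n).toLinearMap

theorem mem_coordImage {W : Subrepresentation (tensorPowerRep N n)} {v : TensorCoord N n} :
    v ∈ coordImage W ↔ (tensorCoordEquiv N n).symm v ∈ W.toSubmodule :=
  Submodule.mem_map_equiv W.toSubmodule (e := tensorCoordEquiv N n)

theorem unitaryStable_coordImage (W : Subrepresentation (tensorPowerRep N n)) :
    UnitaryStable (coordImage W) := by
  intro g hg w hw
  rw [mem_coordImage] at hw ⊢
  have h := W.apply_mem_toSubmodule ⟨g, hg⟩ hw
  have e : (tensorCoordEquiv N n).symm (coordT n g w)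
      = tensorPowerRep N n ⟨g, hg⟩ ((tensorCoordEquiv N n).symm w) := by
    rw [LinearEquiv.symm_apply_eq, tensorCoordEquiv_tensorPowerRep, LinearEquiv.apply_symm_apply]
  rw [e]
  exact h

/-- The subrepresentation with given coordinate image. -/
noncomputable def ofUnitaryStable {W : Submodule ℂ (TensorCoord N n)} (hW : UnitaryStable W) :
    Subrepresentation (tensorPowerRep N n) where
  toSubmodule := W.comap (tensorCoordEquiv N n).toLinearMap
  apply_mem_toSubmodule g v hv := by
    rw [Submodule.mem_comap] at hv ⊢
    change tensorCoordEquiv N n _ ∈ W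
    rw [tensorCoordEquiv_tensorPowerRep]
    exact hW _ g.2 _ hv

theorem mem_ofUnitaryStable {W : Submodule ℂ (TensorCoord N n)} (hW : UnitaryStable W)
    {x : ⨂[ℂ] _ : Fin n, (Fin N → ℂ)} :
    x ∈ (ofUnitaryStable hW).toSubmodule ↔ tensorCoordEquiv N n x ∈ W := Iff.rfl

/-- `exp(i)` is not a root of unity because `π` is irrational; one element of the circle thus
separates all integer weights. -/
theorem circle_zpow_injective : Function.Injective fun k : ℤ => ((Circle.exp 1 : Circle) : ℂ) ^ k := by
  intro k l hkl
  simp only [Circle.coe_exp, ← Complex.exp_int_mul] at hkl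
  rw [Complex.exp_eq_exp_iff_exists_int] at hkl
  obtain ⟨m, hm⟩ := hkl
  have h1 : ((k : ℂ) - l - m * (2 * Real.pi)) * Complex.I = 0 := by
    push_cast at hm
    linear_combination hm
  have h2 : (k : ℂ) - l - m * (2 * Real.pi) = 0 := (mul_eq_zero.1 h1).resolve_right Complex.I_ne_zero
  have h3 : (k : ℝ) - l - m * (2 * Real.pi) = 0 := by exact_mod_cast h2
  by_cases hm0 : m = 0
  · rw [hm0] at h3
    have : (k : ℝ) = l := by push_cast at h3; linarith
    exact_mod_cast this
  · exfalso
    refine irrational_pi ⟨((k - l : ℤ) : ℚ) / (2 * m), ?_⟩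
    have hm' : (m : ℝ) ≠ 0 := by exact_mod_cast hm0
    push_cast
    field_simp
    linarith

/-- Torus weights in coordinates. -/
theorem torus_weight_iff (v : TensorCoord N n) (mu : Fin N → ℤ) :
    (∀ t : Fin N → Circle, coordT n (Matrix.diagonal fun i => (t i : ℂ)) v
      = (∏ i, (t i : ℂ) ^ mu i) • v) ↔ ∀ f, v f ≠ 0 → indexWeight f = mu := by
  constructor
  · intro h f hf
    funext a
    have h1 := congrFun (h (Pi.mulSingle a (Circle.exp 1))) f
    rw [coordT_diagonal_apply, Pi.smul_apply, smul_eq_mul] at h1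
    have h2 := mul_right_cancel₀ hf h1
    have h3 : ∀ w : Fin N → ℤ, ∏ i, ((Pi.mulSingle a (Circle.exp 1) : Fin N → Circle) i : ℂ) ^ w i
        = ((Circle.exp 1 : Circle) : ℂ) ^ w a := by
      intro w
      rw [Finset.prod_eq_single a]
      · rw [Pi.mulSingle_eq_same]
      · intro b _ hb; rw [Pi.mulSingle_eq_of_ne hb]; simp
      · simp
    rw [h3, h3] at h2
    exact circle_zpow_injective h2
  · intro h t
    ext f
    rw [coordT_diagonal_apply, Pi.smul_apply, smul_eq_mul]
    by_cases hf : v f = 0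
    · simp [hf]
    · rw [h f hf]

theorem isTorusWeight_iff (W : Subrepresentation (tensorPowerRep N n)) (mu : Fin N → ℤ) :
    IsTorusWeight (V := W.toSubmodule) W.toRepresentation mu ↔
      ∃ v ∈ coordImage W, v ≠ 0 ∧ ∀ f, v f ≠ 0 → indexWeight f = mu := by
  constructor
  · rintro ⟨⟨x, hx⟩, hne, h⟩
    refine ⟨tensorCoordEquiv N n x, ?_, ?_, ?_⟩
    · rw [mem_coordImage, LinearEquiv.symm_apply_apply]; exact hx
    · rw [Ne, LinearEquiv.map_eq_zero_iff]
      intro h0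
      exact hne (Subtype.ext h0)
    · rw [← torus_weight_iff]
      intro t
      have h1 := congrArg Subtype.val (h t)
      have h2 : tensorPowerRep N n (torusElt t) x = (∏ i, (t i : ℂ) ^ mu i) • x := h1
      rw [← map_smul, ← h2, tensorCoordEquiv_tensorPowerRep]
      rfl
  · rintro ⟨v, hv, hne, h⟩
    rw [mem_coordImage] at hv
    refine ⟨⟨(tensorCoordEquiv N n).symm v, hv⟩, ?_, ?_⟩
    · intro h0
      have := congrArg Subtype.val h0
      exact hne ((LinearEquiv.map_eq_zero_iff _).1 this)
    · intro t
      refine Subtype.ext ?_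
      change tensorPowerRep N n (torusElt t) ((tensorCoordEquiv N n).symm v)
        = (∏ i, (t i : ℂ) ^ mu i) • (tensorCoordEquiv N n).symm v
      apply (tensorCoordEquiv N n).injective
      rw [tensorCoordEquiv_tensorPowerRep, map_smul, LinearEquiv.apply_symm_apply]
      exact (torus_weight_iff v mu).2 h t

/-- Raising operators increase weights lexicographically, so they must kill a vector whose weight is
the largest. -/
theorem exists_highest_of_hasHighestWeight {W : Subrepresentation (tensorPowerRep N n)}
    {lam : Fin N → ℤ} (h : HasHighestWeight (V := W.toSubmodule) W.toRepresentation lam) :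
    ∃ v ∈ coordImage W, v ≠ 0 ∧ IsHighestVector (coordE n) lam v := by
  obtain ⟨v, hv, hne, hvw⟩ := (isTorusWeight_iff W lam).1 h.1
  refine ⟨v, hv, hne, isHighestVector_of_support hvw fun a b _ f hf => not_lt.2 ?_⟩
  have hmem := (unitaryStable_coordImage W).coordE_mem a b hv
  obtain ⟨w, hw, hwf, hww⟩ := (unitaryStable_coordImage W).exists_pure_weight hmem hf
  exact h.2 _ ((isTorusWeight_iff W _).2 ⟨w, hw, fun h0 => hwf (by rw [h0]; rfl), hww⟩)

theorem exists_hasHighestWeight {W : Subrepresentation (tensorPowerRep N n)}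
    (hW : W.toSubmodule ≠ ⊥) : ∃ lam : Signature N, HasHighestWeight (V := W.toSubmodule) W.toRepresentation lam.1 := by
  have hne : coordImage W ≠ ⊥ := by
    intro h
    refine hW ((Submodule.eq_bot_iff _).2 fun x hx => ?_)
    have hx' : tensorCoordEquiv N n x ∈ coordImage W := Submodule.mem_map_of_mem hx
    rw [h, Submodule.mem_bot] at hx'
    exact (LinearEquiv.map_eq_zero_iff _).1 hx'
  obtain ⟨lam, v, hv, hv0, hvh, hvw, hmax⟩ := (unitaryStable_coordImage W).exists_highest hne
  refine ⟨⟨lam, hvh.antitone hv0⟩, (isTorusWeight_iff W _).2 ⟨v, hv, hv0, hvw⟩, fun mu hmu => ?_⟩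
  obtain ⟨w, hw, hw0, hww⟩ := (isTorusWeight_iff W _).1 hmu
  obtain ⟨f, hf⟩ := Function.ne_iff.1 hw0
  rw [← hww f hf]
  exact hmax w hw f hf

end TensorPower

/-! ### The isotypic decomposition. -/

section Isotypic

variable {N n : ℕ}

/-- An operator commuting with the group and acting by a scalar on highest vectors of weight `lam`
acts by this scalar on the isotypic part. -/
theorem apply_of_mem_isotypicPart {A : Module.End ℂ (TensorCoord N n)} {lam : Signature N} {s : ℂ}
    (hA : ∀ g ∈ Matrix.unitaryGroup (Fin N) ℂ, Commute A (coordT n g))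
    (hs : ∀ v, IsHighestVector (coordE n) lam.1 v → A v = s • v)
    {x : ⨂[ℂ] _ : Fin n, (Fin N → ℂ)} (hx : x ∈ isotypicPart (tensorPowerRep N n) lam) :
    A (tensorCoordEquiv N n x) = s • tensorCoordEquiv N n x := by
  let K : Submodule ℂ (⨂[ℂ] _ : Fin n, (Fin N → ℂ)) :=
    LinearMap.ker ((A - s • LinearMap.id) ∘ₗ (tensorCoordEquiv N n).toLinearMap)
  have hK : ∀ y, y ∈ K ↔ A (tensorCoordEquiv N n y) = s • tensorCoordEquiv N n y := fun y => by
    simp [K, sub_eq_zero]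
  rw [← hK]
  refine (?_ : isotypicPart (tensorPowerRep N n) lam ≤ K) hx
  refine iSup_le fun W => iSup_le fun hirr => iSup_le fun hhw => ?_
  let L : Subrepresentation W.toRepresentation :=
    { toSubmodule := K.comap W.toSubmodule.subtype
      apply_mem_toSubmodule := by
        intro g v hv
        rw [Submodule.mem_comap] at hv ⊢
        change tensorPowerRep N n g v.1 ∈ K
        rw [hK, tensorCoordEquiv_tensorPowerRep]
        have h1 := LinearMap.congr_fun (hA g.1 g.2).eq (tensorCoordEquiv N n v.1)
        rw [Module.End.mul_apply, Module.End.mul_apply] at h1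
        rw [h1, (hK v.1).1 hv, map_smul] }
  have hLtop : L = ⊤ := by
    refine (hirr.eq_bot_or_eq_top L).resolve_left fun hbot => ?_
    obtain ⟨v, hv, hne, hvh⟩ := exists_highest_of_hasHighestWeight hhw
    rw [mem_coordImage] at hv
    have hmem : (⟨(tensorCoordEquiv N n).symm v, hv⟩ : W.toSubmodule) ∈ L.toSubmodule := by
      change (tensorCoordEquiv N n).symm v ∈ K
      rw [hK, LinearEquiv.apply_symm_apply]
      exact hs v hvh
    rw [hbot] at hmem
    have h0 := (Submodule.mem_bot ℂ).1 hmem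
    exact hne ((LinearEquiv.map_eq_zero_iff _).1 (congrArg Subtype.val h0))
  intro w hw
  have hmem : (⟨w, hw⟩ : W.toSubmodule) ∈ L.toSubmodule := by
    rw [hLtop]; exact Submodule.mem_top
  exact hmem

/-- Take a minimal nonzero stable subspace of `O`: any subrepresentation of it is itself a stable
subspace, so it is irreducible. -/
theorem exists_irreducible_le {O : Submodule ℂ (TensorCoord N n)} (hO : UnitaryStable O)
    (hne : O ≠ ⊥) : ∃ W : Subrepresentation (tensorPowerRep N n),
      Representation.IsIrreducible (V := W.toSubmodule) W.toRepresentation ∧ W.toSubmodule ≠ ⊥ ∧ coordImage W ≤ O := by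
  obtain ⟨M, ⟨hM1, hM2, hM3⟩, hmin⟩ := (wellFounded_lt (α := Submodule ℂ (TensorCoord N n))).has_min
    {M | UnitaryStable M ∧ M ≠ ⊥ ∧ M ≤ O} ⟨O, hO, hne, le_rfl⟩
  set W := ofUnitaryStable hM1 with hW
  have himg : coordImage W = M := by
    ext v
    rw [mem_coordImage, hW, mem_ofUnitaryStable, LinearEquiv.apply_symm_apply]
  have hWne : W.toSubmodule ≠ ⊥ := by
    intro h
    apply hM2
    rw [← himg, coordImage, h, Submodule.map_bot]
  refine ⟨W, ?_, hWne, himg.le.trans hM3⟩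
  have hnt : Nontrivial (Subrepresentation W.toRepresentation) := by
    refine ⟨⊥, ⊤, fun h => hWne ?_⟩
    rw [Submodule.eq_bot_iff]
    intro x hx
    have h1 : (⟨x, hx⟩ : W.toSubmodule) ∈ (⊤ : Subrepresentation W.toRepresentation).toSubmodule :=
      Submodule.mem_top
    rw [← h] at h1
    exact congrArg Subtype.val ((Submodule.mem_bot ℂ).1 h1)
  refine { exists_pair_ne := hnt.exists_pair_ne, eq_bot_or_eq_top := fun L => ?_ }
  set L' : Submodule ℂ (TensorCoord N n) :=
    (L.toSubmodule.map W.toSubmodule.subtype).map (tensorCoordEquiv N n).toLinearMap with hL'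
  have hmem : ∀ x : W.toSubmodule, tensorCoordEquiv N n x.1 ∈ L' ↔ x ∈ L.toSubmodule := by
    intro x
    constructor
    · rintro ⟨_, ⟨y, hy, rfl⟩, h⟩
      have : y = x := Subtype.ext ((tensorCoordEquiv N n).injective h)
      rwa [← this]
    · intro hx
      exact Submodule.mem_map_of_mem (Submodule.mem_map_of_mem hx)
  have hst : UnitaryStable L' := by
    rintro g hg _ ⟨_, ⟨y, hy, rfl⟩, rfl⟩
    have h1 := L.apply_mem_toSubmodule ⟨g, hg⟩ hy
    have h2 := (hmem _).2 h1
    change tensorCoordEquiv N n (tensorPowerRep N n ⟨g, hg⟩ y.1) ∈ L' at h2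
    rw [tensorCoordEquiv_tensorPowerRep] at h2
    exact h2
  have hle : L' ≤ M := by
    rw [← himg]
    exact Submodule.map_mono (Submodule.map_subtype_le _ _)
  by_cases hbot : L' = ⊥
  · left
    apply Subrepresentation.toSubmodule_injective
    refine (Submodule.eq_bot_iff _).2 fun x hx => ?_
    have h1 := (hmem x).2 hx
    rw [hbot, Submodule.mem_bot] at h1
    exact Subtype.ext ((LinearEquiv.map_eq_zero_iff _).1 h1)
  · right
    have hLM : L' = M := by
      by_contra h
      exact hmin L' ⟨hst, hbot, hle.trans hM3⟩ (lt_of_le_of_ne hle h)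
    apply Subrepresentation.toSubmodule_injective
    refine (Submodule.eq_top_iff' (p := L.toSubmodule)).2 fun x => ?_
    rw [← hmem, hLM, ← himg]
    exact Submodule.mem_map_of_mem x.2

theorem isotypicPart_stable (lam : Signature N) (g : UnitaryGp N)
    {x : ⨂[ℂ] _ : Fin n, (Fin N → ℂ)} (hx : x ∈ isotypicPart (tensorPowerRep N n) lam) :
    tensorPowerRep N n g x ∈ isotypicPart (tensorPowerRep N n) lam := by
  have h : isotypicPart (tensorPowerRep N n) lam ≤
      (isotypicPart (tensorPowerRep N n) lam).comap (tensorPowerRep N n g) := by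
    refine iSup_le fun W => iSup_le fun hirr => iSup_le fun hhw => ?_
    intro w hw
    have h1 : W.toSubmodule ≤ isotypicPart (tensorPowerRep N n) lam :=
      le_iSup_of_le W (le_iSup_of_le hirr (le_iSup_of_le hhw le_rfl))
    exact h1 (W.apply_mem_toSubmodule g hw)
  exact h hx

/-- Complete reducibility of the tensor power. -/
theorem iSup_isotypicPart : ⨆ lam, isotypicPart (tensorPowerRep N n) lam = ⊤ := by
  by_contra hcon
  set S : Submodule ℂ (⨂[ℂ] _ : Fin n, (Fin N → ℂ)) :=
    ⨆ lam, isotypicPart (tensorPowerRep N n) lam with hS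
  set S' : Submodule ℂ (TensorCoord N n) := S.map (tensorCoordEquiv N n).toLinearMap with hS'
  have hS'mem : ∀ v, v ∈ S' ↔ (tensorCoordEquiv N n).symm v ∈ S := fun v =>
    Submodule.mem_map_equiv S (e := tensorCoordEquiv N n)
  have hstS : ∀ g : UnitaryGp N, ∀ x ∈ S, tensorPowerRep N n g x ∈ S := by
    intro g x hx
    have h : S ≤ S.comap (tensorPowerRep N n g) :=
      iSup_le fun lam w hw => Submodule.mem_iSup_of_mem lam (isotypicPart_stable lam g hw)
    exact h hx
  have hst : UnitaryStable S' := by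
    intro g hg w hw
    rw [hS'mem] at hw ⊢
    have e : (tensorCoordEquiv N n).symm (coordT n g w)
        = tensorPowerRep N n ⟨g, hg⟩ ((tensorCoordEquiv N n).symm w) := by
      rw [LinearEquiv.symm_apply_eq, tensorCoordEquiv_tensorPowerRep, LinearEquiv.apply_symm_apply]
    rw [e]
    exact hstS _ _ hw
  have hS'top : S' < ⊤ := by
    refine lt_top_iff_ne_top.2 fun h => hcon ((Submodule.eq_top_iff' (p := S)).2 fun x => ?_)
    have h1 : tensorCoordEquiv N n x ∈ S' := by rw [h]; exact Submodule.mem_top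
    rwa [hS'mem, LinearEquiv.symm_apply_apply] at h1
  -- A nonzero functional vanishing on `S'` is represented by a nonzero vector orthogonal to `S'`.
  -- An irreducible subspace of the orthogonal complement `O` has a highest weight, hence lies in
  -- `S` and is orthogonal to itself.
  obtain ⟨φ, hφ, hker⟩ := Submodule.exists_le_ker_of_lt_top S' hS'top
  let O : Submodule ℂ (TensorCoord N n) :=
    { carrier := {v | ∀ w ∈ S', star w ⬝ᵥ v = 0}
      add_mem' := fun {a b} ha hb w hw => by rw [dotProduct_add, ha w hw, hb w hw, add_zero]
      zero_mem' := fun w _ => dotProduct_zero _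
      smul_mem' := fun r v hv w hw => by rw [dotProduct_smul, hv w hw, smul_zero] }
  have hOst : UnitaryStable O := fun g hg v hv w hw => hst.orthogonal hv hg w hw
  have hOne : O ≠ ⊥ := by
    intro h
    apply hφ
    set v : TensorCoord N n := fun f => star (φ (Pi.single f 1)) with hv
    have hrep : ∀ w, φ w = ∑ f, w f * φ (Pi.single f 1) := by
      intro w
      conv_lhs => rw [← Finset.univ_sum_single w]
      rw [map_sum]
      refine Finset.sum_congr rfl fun f _ => ?_
      rw [← smul_eq_mul, ← map_smul]
      congr 1
      ext k
      by_cases hk : k = f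
      · subst hk; simp
      · simp [hk]
    have hvO : v ∈ O := by
      intro w hw
      have h1 : φ w = 0 := hker hw
      rw [hrep] at h1
      rw [dotProduct, ← star_zero, ← h1, star_sum]
      refine Finset.sum_congr rfl fun f _ => ?_
      rw [star_mul, Pi.star_apply, mul_comm]
    rw [h, Submodule.mem_bot] at hvO
    refine LinearMap.ext fun w => ?_
    rw [hrep, LinearMap.zero_apply]
    refine Finset.sum_eq_zero fun f _ => ?_
    have : star (φ (Pi.single f 1)) = 0 := congrFun hvO f
    rw [star_eq_zero.1 this, mul_zero]
  obtain ⟨W, hirr, hWne, hWO⟩ := exists_irreducible_le hOst hOne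
  obtain ⟨lam, hlam⟩ := exists_hasHighestWeight hWne
  have hWS : W.toSubmodule ≤ S :=
    (le_iSup_of_le W (le_iSup_of_le hirr (le_iSup_of_le hlam le_rfl)) :
      W.toSubmodule ≤ isotypicPart (tensorPowerRep N n) lam).trans
      (le_iSup (fun lam => isotypicPart (tensorPowerRep N n) lam) lam)
  apply hWne
  rw [Submodule.eq_bot_iff]
  intro x hx
  have h1 : tensorCoordEquiv N n x ∈ coordImage W := Submodule.mem_map_of_mem hx
  have h2 := hWO h1 _ ((hS'mem (tensorCoordEquiv N n x)).2
    (by rw [LinearEquiv.symm_apply_apply]; exact hWS hx))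
  open scoped ComplexOrder in
  exact (LinearEquiv.map_eq_zero_iff _).1 (dotProduct_star_self_eq_zero.1 h2)

theorem statOp_apply_isotypic (φ : Polynomial ℂ) {lam : Signature N}
    {x : ⨂[ℂ] _ : Fin n, (Fin N → ℂ)} (hx : x ∈ isotypicPart (tensorPowerRep N n) lam) :
    statOp φ n (tensorCoordEquiv N n x) = linStat φ lam.1 • tensorCoordEquiv N n x :=
  apply_of_mem_isotypicPart (fun g _ => commute_statOp_coordT φ n g)
    (fun v hv => statOp_apply_highest φ n lam.1 v hv) hx

open Polynomial in
theorem partialTrace_apply_isotypic (p : ℂ[X]) {lam : Signature N}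
    {x : ⨂[ℂ] _ : Fin n, (Fin N → ℂ)} (hx : x ∈ isotypicPart (tensorPowerRep N n) lam) :
    partialTrace (aeval (tensX (coordE n)) p) (tensorCoordEquiv N n x) =
      (∑ i, ((jumpCoeff (shiftedCoord lam.1) 1 i : ℝ) : ℂ) *
        p.eval ((shiftedCoord lam.1 i : ℝ) : ℂ)) • tensorCoordEquiv N n x := by
  refine apply_of_mem_isotypicPart (fun g hg => ?_)
    (fun v hv => partialTrace_aeval_tensX (glRelations_coordE n) lam.2 hv p) hx
  exact commute_partialTrace (Matrix.mem_unitaryGroup_iff.1 hg)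
    (commute_aeval (commute_tensX_tensT (glEquivariant_coordE n g)) p)

open Polynomial in
-- A shifted coordinate of `lam` missing from those of `mu` would be detected by a polynomial
-- vanishing at all coordinates of `mu` and at the other coordinates of `lam`. The coordinates,
-- being strictly decreasing, are then determined by their set.
theorem linStat_injective {lam mu : Signature N}
    (h : ∀ φ : ℂ[X], linStat φ lam.1 = linStat φ mu.1) : lam = mu := by
  have key : ∀ lam mu : Signature N, (∀ φ : ℂ[X], linStat φ lam.1 = linStat φ mu.1) →
      Set.range (shiftedCoord lam.1) ⊆ Set.range (shiftedCoord mu.1) := by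
    rintro lam mu h _ ⟨i, rfl⟩
    by_contra hcon
    set φ : ℂ[X] := (∏ j, (X - C ((shiftedCoord mu.1 j : ℝ) : ℂ))) *
      ∏ j ∈ Finset.univ.erase i, (X - C ((shiftedCoord lam.1 j : ℝ) : ℂ)) with hφ
    have h1 : linStat φ mu.1 = 0 := by
      refine Finset.sum_eq_zero fun j _ => ?_
      rw [hφ, eval_mul, eval_prod, Finset.prod_eq_zero (Finset.mem_univ j) (by simp), zero_mul]
    have h2 : linStat φ lam.1 = φ.eval ((shiftedCoord lam.1 i : ℝ) : ℂ) := by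
      refine Finset.sum_eq_single i (fun j _ hj => ?_) (by simp)
      rw [hφ, eval_mul, eval_prod (Finset.univ.erase i),
        Finset.prod_eq_zero (Finset.mem_erase.2 ⟨hj, Finset.mem_univ j⟩) (by simp), mul_zero]
    have h3 := h φ
    rw [h1, h2, hφ, eval_mul, eval_prod, eval_prod, mul_eq_zero, Finset.prod_eq_zero_iff,
      Finset.prod_eq_zero_iff] at h3
    rcases h3 with ⟨j, -, hj⟩ | ⟨j, hj, hj'⟩
    · rw [eval_sub, eval_X, eval_C, sub_eq_zero] at hj
      exact hcon ⟨j, (Complex.ofReal_injective hj).symm⟩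
    · rw [eval_sub, eval_X, eval_C, sub_eq_zero] at hj'
      exact Finset.ne_of_mem_erase hj
        ((shiftedCoord_strictAnti lam.2).injective (Complex.ofReal_injective hj').symm)
  have hr : Set.range (shiftedCoord lam.1) = Set.range (shiftedCoord mu.1) :=
    (key lam mu h).antisymm (key mu lam fun φ => (h φ).symm)
  have hneg : (fun i => -shiftedCoord lam.1 i) = fun i => -shiftedCoord mu.1 i := by
    refine (StrictMono.range_inj (fun i j hij => neg_lt_neg (shiftedCoord_strictAnti lam.2 hij))
      (fun i j hij => neg_lt_neg (shiftedCoord_strictAnti mu.2 hij))).1 ?_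
    have e : ∀ f : Fin N → ℝ, Set.range (fun i => -f i) = (fun x => -x) '' Set.range f := fun f => by
      rw [← Set.range_comp]; rfl
    rw [e, e, hr]
  refine Subtype.ext (funext fun i => ?_)
  have h1 := congrFun hneg i
  simp only [shiftedCoord] at h1
  have h2 : (lam.1 i : ℝ) = mu.1 i := by linarith
  exact_mod_cast h2

/-- The isotypic parts lie in joint eigenspaces of the operators coming from `statOp`, and distinct
signatures give distinct systems of eigenvalues. -/
theorem iSupIndep_isotypicPart : iSupIndep fun lam => isotypicPart (tensorPowerRep N n) lam := by
  let A : Polynomial ℂ → Module.End ℂ (⨂[ℂ] _ : Fin n, (Fin N → ℂ)) := fun φ =>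
    (tensorCoordEquiv N n).symm.conj (statOp φ n)
  have hA : ∀ φ lam x, x ∈ isotypicPart (tensorPowerRep N n) lam → A φ x = linStat φ lam.1 • x := by
    intro φ lam x hx
    apply (tensorCoordEquiv N n).injective
    rw [map_smul, ← statOp_apply_isotypic φ hx]
    simp [A, LinearEquiv.conj_apply]
  -- Both operators are scalar on each isotypic part, and these parts span.
  have hcomm : ∀ φ ψ, Commute (A φ) (A ψ) := by
    intro φ ψ
    have h : (⊤ : Submodule ℂ (⨂[ℂ] _ : Fin n, (Fin N → ℂ))) ≤ LinearMap.ker (A φ * A ψ - A ψ * A φ) := by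
      rw [← iSup_isotypicPart]
      refine iSup_le fun lam x hx => ?_
      rw [LinearMap.mem_ker, LinearMap.sub_apply, Module.End.mul_apply, Module.End.mul_apply,
        hA _ _ _ hx, hA _ _ _ hx, map_smul, map_smul, hA _ _ _ hx, hA _ _ _ hx, smul_comm, sub_self]
    exact LinearMap.ext fun x => sub_eq_zero.1 (h (x := x) Submodule.mem_top)
  have h1 := Module.End.independent_iInf_maxGenEigenspace_of_forall_mapsTo A fun φ ψ s =>
    Module.End.mapsTo_maxGenEigenspace_of_comm (hcomm ψ φ) s
  have h2 := h1.comp (f := fun (lam : Signature N) (φ : Polynomial ℂ) => linStat φ lam.1)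
    fun lam mu h => linStat_injective fun φ => congrFun h φ
  refine h2.mono fun lam x hx => ?_
  rw [Function.comp_apply, Submodule.mem_iInf]
  intro φ
  exact Module.End.eigenspace_le_maxGenEigenspace (Module.End.mem_eigenspace_iff.2 (hA φ lam x hx))

end Isotypic

/-! ### The Schur–Weyl measure: normalized traces as expectations. -/

section Interface

variable {N n : ℕ}

theorem finrank_tensorPower (N n : ℕ) :
    Module.finrank ℂ (⨂[ℂ] _ : Fin n, (Fin N → ℂ)) = N ^ n := by
  rw [(tensorCoordEquiv N n).finrank_eq, Module.finrank_fintype_fun_eq_card, Fintype.card_fun,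
    Fintype.card_fin, Fintype.card_fin]

instance finite_tensorPower (N n : ℕ) : Module.Finite ℂ (⨂[ℂ] _ : Fin n, (Fin N → ℂ)) :=
  Module.Finite.equiv (tensorCoordEquiv N n).symm

theorem finite_isotypicPart_ne_bot (N n : ℕ) :
    {lam : Signature N | isotypicPart (tensorPowerRep N n) lam ≠ ⊥}.Finite :=
  WellFoundedGT.finite_ne_bot_of_iSupIndep iSupIndep_isotypicPart

/-- The probability of a signature under the Schur–Weyl measure. -/
noncomputable def schurWeylWeight (N n : ℕ) (lam : Signature N) : ℝ :=
  (Module.finrank ℂ (isotypicPart (tensorPowerRep N n) lam) : ℝ) / (N : ℝ) ^ n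

theorem schurWeylWeight_nonneg (N n : ℕ) (lam : Signature N) : 0 ≤ schurWeylWeight N n lam := by
  unfold schurWeylWeight; positivity

/-- The finite set of signatures occurring in the tensor power. -/
noncomputable def schurWeylSupport (N n : ℕ) : Finset (Signature N) :=
  (finite_isotypicPart_ne_bot N n).toFinset

theorem schurWeylMeasure_eq_sum (N n : ℕ) (hN : 1 ≤ N) : schurWeylMeasure N n =
    ∑ lam ∈ schurWeylSupport N n, ENNReal.ofReal (schurWeylWeight N n lam) • Measure.dirac lam := by
  have hw : ∀ lam : Signature N, ENNReal.ofReal (schurWeylWeight N n lam) =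
      (Module.finrank ℂ (isotypicPart (tensorPowerRep N n) lam) : ENNReal) /
        (Module.finrank ℂ (⨂[ℂ] _ : Fin n, (Fin N → ℂ)) : ENNReal) := by
    intro lam
    have hpos : (0 : ℝ) < (N : ℝ) ^ n := by positivity
    rw [schurWeylWeight, ENNReal.ofReal_div_of_pos hpos, ENNReal.ofReal_natCast, finrank_tensorPower,
      ← Nat.cast_pow, ENNReal.ofReal_natCast]
  ext s hs
  rw [schurWeylMeasure, decompositionMeasure, Measure.sum_apply _ hs, Measure.finsetSum_apply]
  rw [tsum_eq_sum (s := schurWeylSupport N n)]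
  · exact Finset.sum_congr rfl fun lam _ => by rw [hw]
  · intro lam hlam
    have : isotypicPart (tensorPowerRep N n) lam = ⊥ := by
      by_contra h
      exact hlam ((Set.Finite.mem_toFinset _).2 h)
    rw [this]
    simp

theorem integrable_schurWeyl (hN : 1 ≤ N) (f : Signature N → ℝ) :
    Integrable f (schurWeylMeasure N n) := by
  rw [schurWeylMeasure_eq_sum N n hN, integrable_finsetSum_measure]
  intro lam _
  exact (integrable_dirac (by simp)).smul_measure ENNReal.ofReal_ne_top

theorem integral_schurWeyl (hN : 1 ≤ N) (f : Signature N → ℝ) :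
    ∫ lam, f lam ∂(schurWeylMeasure N n) =
      ∑ lam ∈ schurWeylSupport N n, schurWeylWeight N n lam * f lam := by
  have h := integrable_schurWeyl (n := n) hN f
  rw [schurWeylMeasure_eq_sum N n hN] at h ⊢
  rw [integral_finsetSum_measure fun i hi => integrable_finsetSum_measure.1 h i hi]
  refine Finset.sum_congr rfl fun lam _ => ?_
  rw [integral_smul_measure, integral_dirac, ENNReal.toReal_ofReal (schurWeylWeight_nonneg _ _ _),
    smul_eq_mul]

/-- Each isotypic part contributes its dimension times `a lam` to the trace, and its dimension over
`N ^ n` is the mass of `lam`. -/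
theorem trace_eq_integral (hN : 1 ≤ N) {A : Module.End ℂ (TensorCoord N n)} {a : Signature N → ℝ}
    (hA : ∀ (lam : Signature N), ∀ x ∈ isotypicPart (tensorPowerRep N n) lam,
      A (tensorCoordEquiv N n x) = ((a lam : ℝ) : ℂ) • tensorCoordEquiv N n x) :
    LinearMap.trace ℂ _ A = (N : ℂ) ^ n * ((∫ lam, a lam ∂(schurWeylMeasure N n) : ℝ) : ℂ) := by
  classical
  set B := (tensorCoordEquiv N n).symm.conj A with hB
  have hBx : ∀ (lam : Signature N), ∀ x ∈ isotypicPart (tensorPowerRep N n) lam,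
      B x = ((a lam : ℝ) : ℂ) • x := by
    intro lam x hx
    apply (tensorCoordEquiv N n).injective
    rw [map_smul, ← hA lam x hx]
    simp [hB, LinearEquiv.conj_apply]
  have hmaps : ∀ lam : Signature N, Set.MapsTo B (isotypicPart (tensorPowerRep N n) lam : Set _)
      (isotypicPart (tensorPowerRep N n) lam : Set _) := fun lam x hx => by
    rw [SetLike.mem_coe, hBx lam x hx]
    exact Submodule.smul_mem _ _ hx
  rw [← LinearMap.trace_conj' A (tensorCoordEquiv N n).symm, ← hB,
    LinearMap.trace_eq_sum_trace_restrict'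
      (DirectSum.isInternal_submodule_of_iSupIndep_of_iSup_eq_top iSupIndep_isotypicPart
        iSup_isotypicPart) (finite_isotypicPart_ne_bot N n) hmaps, integral_schurWeyl hN,
    Complex.ofReal_sum, Finset.mul_sum]
  refine Finset.sum_congr rfl fun lam _ => ?_
  have hr : B.restrict (hmaps lam) = ((a lam : ℝ) : ℂ) • LinearMap.id := by
    exact LinearMap.ext fun x => Subtype.ext (hBx lam x.1 x.2)
  have hN' : (N : ℂ) ^ n ≠ 0 := pow_ne_zero _ (by exact_mod_cast (by omega : N ≠ 0))
  have htr : ∀ (s : ℂ) (p : Submodule ℂ (⨂[ℂ] _ : Fin n, (Fin N → ℂ))),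
      LinearMap.trace ℂ p (s • LinearMap.id) = s * Module.finrank ℂ p := fun s p => by
    have : Module.Free ℂ p := Module.Free.of_divisionRing ℂ p
    rw [map_smul, smul_eq_mul]; congr 1; exact LinearMap.trace_id ℂ p
  rw [hr, htr, schurWeylWeight]
  push_cast
  field_simp

theorem isProbabilityMeasure_schurWeyl (hN : 1 ≤ N) :
    IsProbabilityMeasure (schurWeylMeasure N n) := by
  have h := trace_eq_integral (n := n) hN (A := 1) (a := fun _ => 1) (fun lam x _ => by simp)
  have hN' : (N : ℂ) ^ n ≠ 0 := pow_ne_zero _ (by exact_mod_cast (by omega : N ≠ 0))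
  rw [LinearMap.trace_one, Module.finrank_fintype_fun_eq_card, Fintype.card_fun,
    Fintype.card_fin, Fintype.card_fin, Nat.cast_pow] at h
  have h1 : ((∫ _, (1 : ℝ) ∂(schurWeylMeasure N n) : ℝ) : ℂ) = 1 :=
    mul_left_cancel₀ hN' (h.symm.trans (mul_one _).symm)
  have h2 : ∫ _, (1 : ℝ) ∂(schurWeylMeasure N n) = 1 := by exact_mod_cast h1
  rw [integral_const, smul_eq_mul, mul_one, measureReal_def] at h2
  refine ⟨?_⟩
  rwa [ENNReal.toReal_eq_one_iff] at h2

theorem linStat_map (φ : Polynomial ℝ) (lam : Fin N → ℤ) :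
    linStat (φ.map (algebraMap ℝ ℂ)) lam = ((linStat φ lam : ℝ) : ℂ) := by
  simp only [linStat, Complex.ofReal_sum]
  refine Finset.sum_congr rfl fun j _ => ?_
  rw [Polynomial.eval_map_algebraMap, Polynomial.aeval_algebraMap_apply]
  simp

theorem statOp_pow_apply_isotypic (φ : Polynomial ℂ) (r : ℕ) {lam : Signature N}
    {x : ⨂[ℂ] _ : Fin n, (Fin N → ℂ)} (hx : x ∈ isotypicPart (tensorPowerRep N n) lam) :
    (statOp φ n ^ r) (tensorCoordEquiv N n x) = linStat φ lam.1 ^ r • tensorCoordEquiv N n x := by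
  induction r with
  | zero => simp
  | succ r ih =>
    rw [pow_succ, Module.End.mul_apply, statOp_apply_isotypic φ hx, map_smul, ih, smul_smul]
    congr 1; ring

/-- The moments of a linear statistic at time `0`. -/
theorem integral_linStat_zero (hN : 1 ≤ N) (φ : Polynomial ℝ) (r : ℕ) :
    ∫ lam, linStat φ lam.1 ^ r ∂(schurWeylMeasure N 0) = linStat φ (0 : Fin N → ℤ) ^ r := by
  have h := trace_eq_integral (n := 0) hN (A := statOp (φ.map (algebraMap ℝ ℂ)) 0 ^ r)
    (a := fun lam => linStat φ lam.1 ^ r) (fun lam x hx => by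
      rw [statOp_pow_apply_isotypic _ _ hx, linStat_map, Complex.ofReal_pow])
  have e : (statOp (φ.map (algebraMap ℝ ℂ)) 0 ^ r : Module.End ℂ (TensorCoord N 0)) =
      (((linStat φ (0 : Fin N → ℤ)) ^ r : ℝ) : ℂ) • 1 := by
    rw [statOp, linStat_map, smul_pow, one_pow, Complex.ofReal_pow]
  rw [e, map_smul, LinearMap.trace_one, Module.finrank_fintype_fun_eq_card, Fintype.card_fun,
    Fintype.card_fin, Fintype.card_fin, pow_zero, pow_zero, one_mul, Nat.cast_one, smul_eq_mul,
    mul_one] at h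
  exact_mod_cast h.symm

/-- One step of the Schur–Weyl growth process. -/
theorem integral_linStat_succ (hN : 1 ≤ N) (φ : Polynomial ℝ) (n r : ℕ) :
    ∫ lam, linStat φ lam.1 ^ r ∂(schurWeylMeasure N (n + 1)) =
      ∫ lam, ∑ i, jumpCoeff (shiftedCoord lam.1) 1 i / N *
        (linStat φ lam.1 + (φ.eval (shiftedCoord lam.1 i + 1) - φ.eval (shiftedCoord lam.1 i))) ^ r
        ∂(schurWeylMeasure N n) := by
  set ψ := φ.map (algebraMap ℝ ℂ) with hψ
  have hψe : ∀ s : ℝ, (ψ.comp (Polynomial.X + 1) - ψ).eval (s : ℂ) =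
      ((φ.eval (s + 1) - φ.eval s : ℝ) : ℂ) := by
    intro s
    have h1 : ∀ s : ℝ, ψ.eval (s : ℂ) = ((φ.eval s : ℝ) : ℂ) := fun s => by
      rw [hψ, Polynomial.eval_map_algebraMap]
      exact Polynomial.aeval_algebraMap_apply ℂ s φ
    rw [Polynomial.eval_sub, Polynomial.eval_comp, h1, Polynomial.eval_add, Polynomial.eval_X,
      Polynomial.eval_one, Complex.ofReal_sub, ← h1, ← h1]
    push_cast
    rfl
  have h1 := trace_eq_integral (n := n + 1) hN (A := statOp ψ (n + 1) ^ r)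
    (a := fun lam => linStat φ lam.1 ^ r) (fun lam x hx => by
      rw [statOp_pow_apply_isotypic _ _ hx, linStat_map, Complex.ofReal_pow])
  have hψl : ∀ lam : Signature N, linStat ψ lam.1 = ((linStat φ lam.1 : ℝ) : ℂ) := fun lam =>
    linStat_map φ lam.1
  have hN' : (N : ℂ) ≠ 0 := by exact_mod_cast (by omega : N ≠ 0)
  -- By the binomial theorem, the operator under the trace in `trace_statOp_succ_pow` acts on each
  -- isotypic part as `N` times the jump average; this `N` is the ratio of the dimensions `N ^ (n +
  -- 1)` and `N ^ n`.
  have h2 := trace_eq_integral (n := n) hN (A := ∑ k ∈ Finset.range (r + 1), (r.choose k : ℂ) •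
      (statOp ψ n ^ k * partialTrace (Polynomial.aeval (tensX (coordE n))
        ((ψ.comp (Polynomial.X + 1) - ψ) ^ (r - k)))))
    (a := fun lam => N * ∑ i, jumpCoeff (shiftedCoord lam.1) 1 i / N *
        (linStat φ lam.1 + (φ.eval (shiftedCoord lam.1 i + 1) - φ.eval (shiftedCoord lam.1 i))) ^ r)
    (fun lam x hx => by
      rw [LinearMap.sum_apply]
      simp only [LinearMap.smul_apply, Module.End.mul_apply, partialTrace_apply_isotypic _ hx,
        map_smul, statOp_pow_apply_isotypic _ _ hx, Polynomial.eval_pow, hψe, hψl]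
      simp only [smul_smul, ← Finset.sum_smul]
      congr 1
      push_cast
      simp only [add_pow, Finset.mul_sum, Finset.sum_mul]
      rw [Finset.sum_comm]
      refine Finset.sum_congr rfl fun i _ => Finset.sum_congr rfl fun k _ => ?_
      field_simp)
  rw [trace_statOp_succ_pow, h2, integral_const_mul, pow_succ, mul_assoc] at h1
  have h3 := mul_left_cancel₀ (pow_ne_zero n hN') h1
  rw [Complex.ofReal_mul] at h3
  have h4 := mul_left_cancel₀ hN' h3
  exact_mod_cast h4.symm

end Interface

/-! ### Averaging operators and functions with bounded moments. -/

/-- A normalized positive linear operator between spaces of functions. -/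
structure Averaging (X Y : Type*) where
  /-- the underlying linear map -/
  op : (X → ℝ) →ₗ[ℝ] (Y → ℝ)
  nonneg : ∀ f, 0 ≤ f → 0 ≤ op f
  one : op 1 = 1

namespace Averaging

variable {X Y Z : Type*} (L : Averaging X Y)

theorem mono {f g : X → ℝ} (h : f ≤ g) : L.op f ≤ L.op g := by
  have := L.nonneg (g - f) (sub_nonneg.2 h)
  rwa [map_sub, sub_nonneg] at this

theorem abs_op_le (f : X → ℝ) : |L.op f| ≤ L.op |f| := by
  rw [abs_le']
  refine ⟨L.mono (le_abs_self f), ?_⟩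
  rw [← map_neg]
  exact L.mono (neg_le_abs f)

theorem op_const (r : ℝ) : L.op (fun _ => r) = fun _ => r := by
  have h : (fun _ => r : X → ℝ) = r • 1 := by ext; simp
  rw [h, map_smul, L.one]; ext; simp

/-- Tangent line at `m` of the convex function `z ^ (p + 1)`. In the induction, `z` times one
tangent line exceeds the next by `(p + 1) m ^ p (z - m) ^ 2`. -/
theorem pow_tangent {z m : ℝ} (hz : 0 ≤ z) (hm : 0 ≤ m) (p : ℕ) :
    (p + 1) * m ^ p * z - p * m ^ (p + 1) ≤ z ^ (p + 1) := by
  induction p with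
  | zero => simp
  | succ p ih =>
    have h1 := mul_le_mul_of_nonneg_left ih hz
    have h2 : 0 ≤ (p + 1) * m ^ p * (z - m) ^ 2 := by positivity
    push_cast
    calc _ ≤ z * ((p + 1) * m ^ p * z - p * m ^ (p + 1)) := by
            have e : z * ((p + 1) * m ^ p * z - p * m ^ (p + 1)) -
              ((p + 1 + 1) * m ^ (p + 1) * z - (p + 1) * m ^ (p + 1 + 1)) =
              (p + 1) * m ^ p * (z - m) ^ 2 := by ring
            linarith
      _ ≤ z * z ^ (p + 1) := h1
      _ = _ := by ring

/-- Jensen's inequality for powers. -/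
theorem op_pow_le {f : X → ℝ} (hf : 0 ≤ f) (p : ℕ) : L.op f ^ p ≤ L.op (f ^ p) := by
  cases p with
  | zero => rw [pow_zero, pow_zero, L.one]
  | succ p =>
    intro y
    set m := L.op f y with hm
    have hm0 : 0 ≤ m := L.nonneg f hf y
    have h : ((p + 1) * m ^ p) • f - (fun _ => p * m ^ (p + 1)) ≤ f ^ (p + 1) := by
      intro x
      simp only [Pi.sub_apply, Pi.smul_apply, smul_eq_mul, Pi.pow_apply]
      exact pow_tangent (hf x) hm0 p
    have h2 := L.mono h y
    rw [map_sub, map_smul, L.op_const] at h2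
    simp only [Pi.sub_apply, Pi.smul_apply, smul_eq_mul, ← hm] at h2
    rw [Pi.pow_apply, ← hm]
    refine le_trans (le_of_eq ?_) h2
    ring

theorem abs_op_pow_le (f : X → ℝ) (p : ℕ) : |L.op f| ^ p ≤ L.op (|f| ^ p) := by
  refine le_trans ?_ (L.op_pow_le (abs_nonneg f) p)
  intro y
  exact pow_le_pow_left₀ (abs_nonneg _) (L.abs_op_le f y) p

/-- Composition of averaging operators. -/
def comp (M : Averaging Y Z) (L : Averaging X Y) : Averaging X Z where
  op := M.op ∘ₗ L.op
  nonneg f hf := M.nonneg _ (L.nonneg f hf)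
  one := by rw [LinearMap.comp_apply, L.one, M.one]

@[simp] theorem comp_op (M : Averaging Y Z) (L : Averaging X Y) (f : X → ℝ) :
    (M.comp L).op f = M.op (L.op f) := rfl

/-- The functions all of whose absolute moments are bounded. -/
def bddMoments : Subalgebra ℝ (X → ℝ) where
  carrier := {f | ∀ p : ℕ, ∃ C, ∀ y, L.op (|f| ^ p) y ≤ C}
  add_mem' := by
    intro f g hf hg p
    obtain ⟨C, hC⟩ := hf p
    obtain ⟨D, hD⟩ := hg p
    refine ⟨2 ^ p * (C + D), fun y => ?_⟩
    have h : |f + g| ^ p ≤ (2 ^ p : ℝ) • (|f| ^ p + |g| ^ p) := by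
      intro x
      simp only [Pi.pow_apply, Pi.abs_apply, Pi.add_apply, Pi.smul_apply, smul_eq_mul]
      have h1 : |f x + g x| ≤ 2 * max |f x| |g x| := by
        refine (abs_add_le _ _).trans ?_
        have := le_max_left |f x| |g x|
        have := le_max_right |f x| |g x|
        linarith
      refine (pow_le_pow_left₀ (abs_nonneg _) h1 p).trans ?_
      rw [mul_pow]
      refine mul_le_mul_of_nonneg_left ?_ (by positivity)
      rcases max_choice |f x| |g x| with h | h <;> rw [h]
      · have := pow_nonneg (abs_nonneg (g x)) p; linarith
      · have := pow_nonneg (abs_nonneg (f x)) p; linarith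
    refine (L.mono h y).trans ?_
    rw [map_smul, map_add, Pi.smul_apply, smul_eq_mul, Pi.add_apply]
    exact mul_le_mul_of_nonneg_left (add_le_add (hC y) (hD y)) (by positivity)
  mul_mem' := by
    intro f g hf hg p
    obtain ⟨C, hC⟩ := hf (2 * p)
    obtain ⟨D, hD⟩ := hg (2 * p)
    refine ⟨C + D, fun y => ?_⟩
    have h : |f * g| ^ p ≤ |f| ^ (2 * p) + |g| ^ (2 * p) := by
      intro x
      simp only [Pi.pow_apply, Pi.abs_apply, Pi.add_apply, Pi.mul_apply, abs_mul, mul_pow, pow_mul']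
      nlinarith [sq_nonneg (|f x| ^ p - |g x| ^ p), sq_nonneg (|f x| ^ p), sq_nonneg (|g x| ^ p)]
    refine (L.mono h y).trans ?_
    rw [map_add, Pi.add_apply]
    exact add_le_add (hC y) (hD y)
  algebraMap_mem' := by
    intro r p
    refine ⟨|r| ^ p, fun y => ?_⟩
    have h : |algebraMap ℝ (X → ℝ) r| ^ p = fun _ => |r| ^ p := by ext; simp
    rw [h, L.op_const]

theorem mem_bddMoments_of_even {f : X → ℝ}
    (h : ∀ p : ℕ, ∃ C, ∀ y, L.op (f ^ (2 * p)) y ≤ C) : f ∈ L.bddMoments := by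
  intro p
  obtain ⟨C, hC⟩ := h p
  refine ⟨1 + C, fun y => ?_⟩
  have h : |f| ^ p ≤ 1 + f ^ (2 * p) := by
    intro x
    simp only [Pi.pow_apply, Pi.abs_apply, Pi.add_apply, Pi.one_apply]
    rw [pow_mul, ← sq_abs, ← pow_mul, pow_mul']
    nlinarith [sq_nonneg (|f x| ^ p - 1)]
  refine (L.mono h y).trans ?_
  rw [map_add, L.one, Pi.add_apply, Pi.one_apply]
  exact add_le_add le_rfl (hC y)

theorem mem_bddMoments_of_le {f g : X → ℝ} (hg : g ∈ L.bddMoments) (h : |f| ≤ |g|) :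
    f ∈ L.bddMoments := by
  intro p
  obtain ⟨C, hC⟩ := hg p
  refine ⟨C, fun y => (L.mono ?_ y).trans (hC y)⟩
  intro x
  exact pow_le_pow_left₀ (abs_nonneg _) (h x) p

theorem mem_bddMoments_of_bounded {f : X → ℝ} {C : ℝ} (h : ∀ x, |f x| ≤ C) : f ∈ L.bddMoments := by
  refine L.mem_bddMoments_of_le (L.bddMoments.algebraMap_mem C) fun x => ?_
  simpa using (h x).trans (le_abs_self C)

theorem exists_bound_of_mem {f : X → ℝ} (hf : f ∈ L.bddMoments) : ∃ C, ∀ y, |L.op f y| ≤ C := by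
  obtain ⟨C, hC⟩ := hf 1
  refine ⟨C, fun y => (L.abs_op_le f y).trans ?_⟩
  simpa using hC y

theorem op_mem_bddMoments {M : Averaging Y Z} {f : X → ℝ} (hf : f ∈ (M.comp L).bddMoments) :
    L.op f ∈ M.bddMoments := by
  intro p
  obtain ⟨C, hC⟩ := hf p
  exact ⟨C, fun y => (M.mono (L.abs_op_pow_le f p) y).trans (hC y)⟩

end Averaging

/-! ### The growth process, with all `N` and all `n ≤ c N²` treated at once. -/

/-- Admissible pairs of a dimension `N` and a tensor power `n ≤ c N ^ 2`. -/
structure SWIndex (c : ℝ) where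
  /-- the dimension -/
  N : ℕ
  /-- the tensor power -/
  n : ℕ
  one_le : 1 ≤ N
  le : (n : ℝ) ≤ c * (N : ℝ) ^ 2

/-- Functions of the base point of a dependent pair. -/
def sigmaPull {A : Type*} {B : A → Type*} : (A → ℝ) →ₐ[ℝ] ((Σ a, B a) → ℝ) where
  toFun f ω := f ω.1
  map_one' := rfl
  map_mul' _ _ := rfl
  map_zero' := rfl
  map_add' _ _ := rfl
  commutes' _ := rfl

@[simp] theorem sigmaPull_apply {A : Type*} {B : A → Type*} (f : A → ℝ) (ω : Σ a, B a) :
    sigmaPull f ω = f ω.1 := rfl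

theorem sum_jumpCoeff {ι : Type*} [Fintype ι] [DecidableEq ι] {x : ι → ℝ}
    (hx : Function.Injective x) : ∑ i, jumpCoeff x 1 i = Fintype.card ι := by
  have h := newtonP_rec x hx 1 0 0
  simpa [newtonP, dicksonU, dicksonD] using h

theorem jumpCoeff_scale {ι : Type*} [Fintype ι] [DecidableEq ι] (x : ι → ℝ) {e : ℝ} (he : e ≠ 0)
    (s : ℝ) (i : ι) : jumpCoeff (fun j => e * x j - s) e i = jumpCoeff x 1 i := by
  unfold jumpCoeff
  refine Finset.prod_congr rfl fun j _ => ?_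
  have : e * x i - s - (e * x j - s) = e * (x i - x j) := by ring
  rw [this, ← div_div, div_self he]

/-- The shifted coordinates are distinct and differ by integers, so each factor is `1 + 1 / k` with
`k` a nonzero integer. -/
theorem jumpCoeff_nonneg {N : ℕ} {lam : Fin N → ℤ} (h : Antitone lam) (i : Fin N) :
    0 ≤ jumpCoeff (shiftedCoord lam) 1 i := by
  refine Finset.prod_nonneg fun j hj => ?_
  have hne : shiftedCoord lam i ≠ shiftedCoord lam j := fun e =>
    (Finset.ne_of_mem_erase hj) ((shiftedCoord_strictAnti h).injective e).symm
  obtain ⟨k, hk⟩ : ∃ k : ℤ, shiftedCoord lam i - shiftedCoord lam j = k :=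
    ⟨lam i - i - (lam j - j), by simp only [shiftedCoord]; push_cast; ring⟩
  have hk0 : k ≠ 0 := by
    rintro rfl
    exact hne (sub_eq_zero.1 (by simpa using hk))
  rw [hk]
  rcases lt_or_gt_of_ne hk0 with h1 | h1
  · have h2 : (k : ℝ) ≤ -1 := by exact_mod_cast (by omega : k ≤ -1)
    have h3 : -1 ≤ 1 / (k : ℝ) := by
      rw [le_div_iff_of_neg (by linarith)]; linarith
    linarith
  · have h2 : (0 : ℝ) < k := by exact_mod_cast h1
    positivity

section Framework

variable {c : ℝ}

namespace SWIndex

/-- The next tensor power. -/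
def succ (a : SWIndex c) (h : ((a.n + 1 : ℕ) : ℝ) ≤ c * (a.N : ℝ) ^ 2) : SWIndex c :=
  ⟨a.N, a.n + 1, a.one_le, h⟩

theorem induction {P : SWIndex c → Prop} (h0 : ∀ a : SWIndex c, a.n = 0 → P a)
    (hs : ∀ (a : SWIndex c) h, P a → P (a.succ h)) (a : SWIndex c) : P a := by
  obtain ⟨N, n, hN, hn⟩ := a
  induction n with
  | zero => exact h0 _ rfl
  | succ n ih =>
    have h1 : (n : ℝ) ≤ c * (N : ℝ) ^ 2 := le_trans (by push_cast; linarith) hn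
    exact hs ⟨N, n, hN, h1⟩ hn (ih h1)

theorem N_pos (a : SWIndex c) : (0 : ℝ) < a.N := by exact_mod_cast a.one_le

end SWIndex

/-- The inverse dimension. -/
noncomputable def swEps (a : SWIndex c) : ℝ := 1 / (a.N : ℝ)

/-- The rescaled tensor power. -/
noncomputable def swTime (a : SWIndex c) : ℝ := (a.n : ℝ) / (a.N : ℝ) ^ 2

theorem swEps_pos (a : SWIndex c) : 0 < swEps a := one_div_pos.2 a.N_pos

theorem swEps_le_one (a : SWIndex c) : swEps a ≤ 1 := by
  rw [swEps, div_le_one a.N_pos]; exact_mod_cast a.one_le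

theorem swTime_nonneg (a : SWIndex c) : 0 ≤ swTime a := by unfold swTime; positivity

theorem swTime_le (a : SWIndex c) : swTime a ≤ c := by
  rw [swTime, div_le_iff₀ (pow_pos a.N_pos 2)]; exact a.le

theorem swTime_succ (a : SWIndex c) (h) : swTime (a.succ h) = swTime a + swEps a ^ 2 := by
  simp only [swTime, swEps, SWIndex.succ]; push_cast; ring

theorem swEps_succ (a : SWIndex c) (h) : swEps (a.succ h) = swEps a := rfl

theorem swTime_zero {a : SWIndex c} (h : a.n = 0) : swTime a = 0 := by simp [swTime, h]

variable (c) in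
/-- An admissible pair together with a signature. -/
abbrev SWState : Type := Σ a : SWIndex c, Signature a.N

variable (c) in
/-- A state together with a row. -/
abbrev SWPoint : Type := Σ s : SWState c, Fin s.1.N

/-- Expectation with respect to the Schur–Weyl measures. -/
noncomputable def expect : Averaging (SWState c) (SWIndex c) where
  op :=
    { toFun := fun f a => ∫ lam, f ⟨a, lam⟩ ∂(schurWeylMeasure a.N a.n)
      map_add' := fun f g => funext fun a =>
        integral_add (integrable_schurWeyl a.one_le _) (integrable_schurWeyl a.one_le _)
      map_smul' := fun r f => funext fun a => integral_const_mul r _ }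
  nonneg f hf a := integral_nonneg fun lam => hf ⟨a, lam⟩
  one := funext fun a => by
    have := isProbabilityMeasure_schurWeyl (n := a.n) a.one_le
    simp

/-- Average over the next box of the growth process. -/
noncomputable def jump : Averaging (SWPoint c) (SWState c) where
  op :=
    { toFun := fun Z s => ∑ i, jumpCoeff (shiftedCoord s.2.1) 1 i / s.1.N * Z ⟨s, i⟩
      map_add' := fun f g => funext fun s => by
        simp only [Pi.add_apply, mul_add, Finset.sum_add_distrib]
      map_smul' := fun r f => funext fun s => by
        simp only [Pi.smul_apply, smul_eq_mul, Finset.mul_sum, RingHom.id_apply]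
        exact Finset.sum_congr rfl fun i _ => by ring }
  nonneg Z hZ s := by
    change (0 : ℝ) ≤ ∑ i, jumpCoeff (shiftedCoord s.2.1) 1 i / s.1.N * Z ⟨s, i⟩
    exact Finset.sum_nonneg fun i _ => mul_nonneg (div_nonneg (jumpCoeff_nonneg s.2.2 i) s.1.N_pos.le) (hZ ⟨s, i⟩)
  one := funext fun s => by
    have h := sum_jumpCoeff (shiftedCoord_strictAnti s.2.2).injective
    rw [Fintype.card_fin] at h
    change ∑ i, jumpCoeff (shiftedCoord s.2.1) 1 i / s.1.N * 1 = 1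
    simp only [mul_one]
    rw [← Finset.sum_div, h, div_self s.1.N_pos.ne']

/-- Average over all rows. -/
noncomputable def empirical : Averaging (SWPoint c) (SWState c) where
  op :=
    { toFun := fun Z s => ∑ i, 1 / (s.1.N : ℝ) * Z ⟨s, i⟩
      map_add' := fun f g => funext fun s => by
        simp only [Pi.add_apply, mul_add, Finset.sum_add_distrib]
      map_smul' := fun r f => funext fun s => by
        simp only [Pi.smul_apply, smul_eq_mul, Finset.mul_sum, RingHom.id_apply]
        exact Finset.sum_congr rfl fun i _ => by ring }
  nonneg Z hZ s := by
    change (0 : ℝ) ≤ ∑ i, 1 / (s.1.N : ℝ) * Z ⟨s, i⟩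
    exact Finset.sum_nonneg fun i _ => mul_nonneg (one_div_pos.2 s.1.N_pos).le (hZ ⟨s, i⟩)
  one := funext fun s => by
    change ∑ i : Fin s.1.N, 1 / (s.1.N : ℝ) * 1 = 1
    have := s.1.N_pos.ne'
    simp [this]

theorem expect_op_apply (f : SWState c → ℝ) (a : SWIndex c) :
    expect.op f a = ∫ lam, f ⟨a, lam⟩ ∂(schurWeylMeasure a.N a.n) := rfl

theorem jump_op_apply (Z : SWPoint c → ℝ) (s : SWState c) :
    jump.op Z s = ∑ i, jumpCoeff (shiftedCoord s.2.1) 1 i / s.1.N * Z ⟨s, i⟩ := rfl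

theorem empirical_op_apply (Z : SWPoint c → ℝ) (s : SWState c) :
    empirical.op Z s = ∑ i, 1 / (s.1.N : ℝ) * Z ⟨s, i⟩ := rfl

theorem expect_op_pull (d : SWIndex c → ℝ) (f : SWState c → ℝ) :
    expect.op (sigmaPull d * f) = d * expect.op f :=
  funext fun a => integral_const_mul (d a) _

theorem jump_op_pull (f : SWState c → ℝ) (Z : SWPoint c → ℝ) :
    jump.op (sigmaPull f * Z) = f * jump.op Z := funext fun s => by
  simp only [jump_op_apply, Pi.mul_apply, sigmaPull_apply, Finset.mul_sum]
  exact Finset.sum_congr rfl fun i _ => by ring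

theorem empirical_op_pull (f : SWState c → ℝ) (Z : SWPoint c → ℝ) :
    empirical.op (sigmaPull f * Z) = f * empirical.op Z := funext fun s => by
  simp only [empirical_op_apply, Pi.mul_apply, sigmaPull_apply, Finset.mul_sum]
  exact Finset.sum_congr rfl fun i _ => by ring

theorem jump_op_pull' (f : SWState c → ℝ) : jump.op (sigmaPull f) = f := by
  have := jump_op_pull f 1
  rwa [mul_one, jump.one, mul_one] at this

theorem empirical_op_pull' (f : SWState c → ℝ) : empirical.op (sigmaPull f) = f := by
  have := empirical_op_pull f 1
  rwa [mul_one, empirical.one, mul_one] at this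

theorem expect_op_pull' (f : SWIndex c → ℝ) : expect.op (sigmaPull f) = f := by
  have := expect_op_pull f 1
  rwa [mul_one, expect.one, mul_one] at this

/-- A family of linear statistics. -/
noncomputable def swStat (Φ : ℕ → ℕ → Polynomial ℝ) (s : SWState c) : ℝ :=
  linStat (Φ s.1.N s.1.n) s.2.1

/-- The increment of a family of linear statistics when a box is added. -/
noncomputable def swIncr (Φ : ℕ → ℕ → Polynomial ℝ) (ω : SWPoint c) : ℝ :=
  linStat (Φ ω.1.1.N (ω.1.1.n + 1)) ω.1.2.1 +
    ((Φ ω.1.1.N (ω.1.1.n + 1)).eval (shiftedCoord ω.1.2.1 ω.2 + 1) -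
      (Φ ω.1.1.N (ω.1.1.n + 1)).eval (shiftedCoord ω.1.2.1 ω.2)) -
    linStat (Φ ω.1.1.N ω.1.1.n) ω.1.2.1

theorem expect_succ (Φ : ℕ → ℕ → Polynomial ℝ) (r : ℕ) (a : SWIndex c) (h) :
    expect.op (swStat Φ ^ r) (a.succ h) =
      expect.op (jump.op ((sigmaPull (swStat Φ) + swIncr Φ) ^ r)) a := by
  rw [expect_op_apply, expect_op_apply]
  refine (integral_linStat_succ a.one_le (Φ a.N (a.n + 1)) a.n r).trans ?_
  refine integral_congr_ae (Eventually.of_forall fun lam => ?_)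
  beta_reduce
  rw [jump_op_apply]
  refine Finset.sum_congr rfl fun i _ => ?_
  simp only [Pi.pow_apply, Pi.add_apply, sigmaPull_apply, swStat, swIncr]
  congr 2
  ring

theorem expect_zero (Φ : ℕ → ℕ → Polynomial ℝ) (r : ℕ) {a : SWIndex c} (h : a.n = 0) :
    expect.op (swStat Φ ^ r) a = linStat (Φ a.N 0) (0 : Fin a.N → ℤ) ^ r := by
  obtain ⟨N, n, hN, hn⟩ := a
  subst h
  exact integral_linStat_zero hN (Φ N 0) r

/-- Each step multiplies the bound on `F + 1` by `1 + K / N² ≤ exp (K / N²)`, and there are at most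
`c N²` steps; hence uniformity in both `N` and `n`. -/
theorem gronwall {F : SWIndex c → ℝ} {B K : ℝ} (hK : 0 ≤ K) (h0 : ∀ a : SWIndex c, a.n = 0 → F a ≤ B)
    (hs : ∀ (a : SWIndex c) h, F (a.succ h) ≤ (1 + K * swEps a ^ 2) * F a + K * swEps a ^ 2) :
    ∃ C, ∀ a, F a ≤ C := by
  have key : ∀ a : SWIndex c, F a + 1 ≤ Real.exp (K * swTime a) * (|B| + 1) := by
    refine SWIndex.induction (fun a ha => ?_) (fun a h ih => ?_)
    · rw [swTime_zero ha, mul_zero, Real.exp_zero, one_mul]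
      exact add_le_add ((h0 a ha).trans (le_abs_self B)) le_rfl
    · rw [swTime_succ, mul_add K, Real.exp_add]
      have h1 : 1 + K * swEps a ^ 2 ≤ Real.exp (K * swEps a ^ 2) := by
        rw [add_comm]; exact Real.add_one_le_exp _
      have h2 : 0 ≤ K * swEps a ^ 2 := by positivity
      calc F (a.succ h) + 1 ≤ (1 + K * swEps a ^ 2) * (F a + 1) := by
            have := hs a h; nlinarith
        _ ≤ (1 + K * swEps a ^ 2) * (Real.exp (K * swTime a) * (|B| + 1)) :=
            mul_le_mul_of_nonneg_left ih (by linarith)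
        _ ≤ Real.exp (K * swEps a ^ 2) * (Real.exp (K * swTime a) * (|B| + 1)) :=
            mul_le_mul_of_nonneg_right h1 (by positivity)
        _ = _ := by ring
  refine ⟨Real.exp (K * c) * (|B| + 1), fun a => ?_⟩
  have h1 : Real.exp (K * swTime a) ≤ Real.exp (K * c) :=
    Real.exp_le_exp.2 (mul_le_mul_of_nonneg_left (swTime_le a) hK)
  have := mul_le_mul_of_nonneg_right h1 (by positivity : 0 ≤ |B| + 1)
  linarith [key a]

/-- The rescaled coordinate. -/
noncomputable def swY (ω : SWPoint c) : ℝ := shiftedCoord ω.1.2.1 ω.2 / ω.1.1.N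

/-- `1 / N` as a function of points. -/
noncomputable def pEps : SWPoint c → ℝ := sigmaPull (sigmaPull swEps)

/-- The rescaled time as a function of points. -/
noncomputable def pTime : SWPoint c → ℝ := sigmaPull (sigmaPull swTime)

/-- The recentred coordinate. -/
noncomputable def swX : SWPoint c → ℝ := swY - 1 - pTime

/-- Newton's identity for jump averages. -/
theorem newton_shift (s : SWState c) (u t : ℝ) (m : ℕ) :
    newtonP (fun i => swY ⟨s, i⟩ - u) (swEps s.1) t (m + 1) =
      ∑ i, jumpCoeff (shiftedCoord s.2.1) 1 i / s.1.N * dicksonU (swY ⟨s, i⟩ - u) t m := by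
  rw [newtonP]
  refine Finset.sum_congr rfl fun i _ => ?_
  have h := jumpCoeff_scale (shiftedCoord s.2.1) (swEps_pos s.1).ne' u i
  have e : (fun i => swY ⟨s, i⟩ - u) = fun j => swEps s.1 * shiftedCoord s.2.1 j - u := by
    funext j; simp only [swY, swEps]; ring
  rw [e, h, swEps]
  ring

theorem swY_sub_injective (s : SWState c) (u : ℝ) :
    Function.Injective fun i => swY ⟨s, i⟩ - u := by
  intro i j hij
  have h1 := sub_left_inj.1 hij
  simp only [swY] at h1
  rw [div_left_inj' s.1.N_pos.ne'] at h1
  exact (shiftedCoord_strictAnti s.2.2).injective h1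

end Framework

/-! ### A priori bounds on the moments of the rescaled coordinates. -/

section Moments

variable {c : ℝ}

variable (c) in
/-- Functions of states with bounded moments. -/
noncomputable def bddS : Subalgebra ℝ (SWState c → ℝ) := expect.bddMoments

variable (c) in
/-- Functions of points with bounded moments. -/
noncomputable def bddP : Subalgebra ℝ (SWPoint c → ℝ) :=
  (expect.comp jump).bddMoments ⊓ (expect.comp empirical).bddMoments

theorem jump_mem_bddS {Z : SWPoint c → ℝ} (h : Z ∈ bddP c) : jump.op Z ∈ bddS c :=
  Averaging.op_mem_bddMoments _ h.1

theorem empirical_mem_bddS {Z : SWPoint c → ℝ} (h : Z ∈ bddP c) : empirical.op Z ∈ bddS c :=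
  Averaging.op_mem_bddMoments _ h.2

theorem pull_mem_bddP {f : SWState c → ℝ} (h : f ∈ bddS c) : sigmaPull f ∈ bddP c := by
  have e : ∀ p : ℕ, (|(sigmaPull f : SWPoint c → ℝ)| ^ p) = sigmaPull (|f| ^ p) := fun p => rfl
  constructor
  · intro p
    obtain ⟨C, hC⟩ := h p
    refine ⟨C, fun y => ?_⟩
    rw [e, Averaging.comp_op, jump_op_pull']
    exact hC y
  · intro p
    obtain ⟨C, hC⟩ := h p
    refine ⟨C, fun y => ?_⟩
    rw [e, Averaging.comp_op, empirical_op_pull']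
    exact hC y

theorem bounded_mem_bddS {d : SWIndex c → ℝ} {C : ℝ} (h : ∀ a, |d a| ≤ C) :
    (sigmaPull d : SWState c → ℝ) ∈ bddS c :=
  Averaging.mem_bddMoments_of_bounded _ fun s => h s.1

theorem abs_swEps_le (a : SWIndex c) : |swEps a| ≤ 1 := by
  rw [abs_of_pos (swEps_pos a)]; exact swEps_le_one a

theorem abs_swTime_le (a : SWIndex c) : |swTime a| ≤ c := by
  rw [abs_of_nonneg (swTime_nonneg a)]; exact swTime_le a

theorem pEps_mem_bddP : (pEps : SWPoint c → ℝ) ∈ bddP c :=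
  pull_mem_bddP (bounded_mem_bddS abs_swEps_le)

theorem pTime_mem_bddP : (pTime : SWPoint c → ℝ) ∈ bddP c :=
  pull_mem_bddP (bounded_mem_bddS abs_swTime_le)

/-- Empirical moments of `1 + |y|`. -/
noncomputable def absMoment (k : ℕ) : SWState c → ℝ := empirical.op ((1 + |swY|) ^ k)

theorem absMoment_apply (k : ℕ) (s : SWState c) :
    absMoment k s = 1 / (s.1.N : ℝ) * ∑ i, (1 + |swY ⟨s, i⟩|) ^ k := by
  rw [absMoment, empirical_op_apply, Finset.mul_sum]; rfl

theorem one_le_one_add_abs (x : ℝ) : 1 ≤ 1 + |x| := by linarith [abs_nonneg x]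

theorem absMoment_mono {j k : ℕ} (h : j ≤ k) (s : SWState c) : absMoment j s ≤ absMoment k s :=
  empirical.mono (fun _ => pow_le_pow_right₀ (one_le_one_add_abs _) h) s

theorem absMoment_nonneg (k : ℕ) (s : SWState c) : 0 ≤ absMoment k s :=
  empirical.nonneg _ (fun ω => pow_nonneg (zero_le_one.trans (one_le_one_add_abs (swY ω))) k) s

theorem absMoment_zero (s : SWState c) : absMoment 0 s = 1 := by
  rw [absMoment, pow_zero, empirical.one]; rfl

/-- Chebyshev's sum inequality. -/
theorem absMoment_mul_le (j k : ℕ) (s : SWState c) :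
    absMoment j s * absMoment k s ≤ absMoment (j + k) s := by
  have hm : Monovary (fun i => (1 + |swY ⟨s, i⟩|) ^ j) fun i => (1 + |swY ⟨s, i⟩|) ^ k := by
    intro a b hab
    have h1 : 1 + |swY ⟨s, a⟩| < 1 + |swY ⟨s, b⟩| :=
      lt_of_pow_lt_pow_left₀ k (by positivity) hab
    exact pow_le_pow_left₀ (by positivity) h1.le j
  have h := hm.sum_mul_sum_le_card_mul_sum
  rw [Fintype.card_fin] at h
  simp only [absMoment_apply, pow_add]
  have hN := s.1.N_pos
  calc _ = 1 / (s.1.N : ℝ) ^ 2 * ((∑ i, (1 + |swY ⟨s, i⟩|) ^ j) * ∑ i, (1 + |swY ⟨s, i⟩|) ^ k) := by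
        ring
    _ ≤ 1 / (s.1.N : ℝ) ^ 2 * (s.1.N * ∑ i, (1 + |swY ⟨s, i⟩|) ^ j * (1 + |swY ⟨s, i⟩|) ^ k) :=
        mul_le_mul_of_nonneg_left h (by positivity)
    _ = _ := by field_simp

/-- Newton's recursion at `t = 0`: a row sum is made of differences of powers at distance `1 / N`,
hence at most `(k + 1) * absMoment k s`; Chebyshev's inequality merges products of moments, and
`∑_{b ≤ m} 2 ^ b ≤ 2 ^ (m + 1)` closes the induction. Jump averages are thus controlled by row
averages, even if the jump weights concentrate on few rows. -/
theorem abs_newtonP_le (s : SWState c) (m : ℕ) :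
    |newtonP (fun i => swY ⟨s, i⟩ - 0) (swEps s.1) 0 (m + 1)| ≤ 2 ^ (m + 1) * absMoment m s := by
  induction m using Nat.strong_induction_on with
  | _ m ih =>
    set P := newtonP (fun i => swY ⟨s, i⟩ - 0) (swEps s.1) 0 with hP
    have hP' : ∀ b ≤ m, |P b| ≤ 2 ^ b * absMoment b s := by
      intro b hb
      cases b with
      | zero => simp [hP, newtonP, absMoment_zero]
      | succ b =>
        exact (ih b hb).trans (mul_le_mul_of_nonneg_left (absMoment_mono (by omega) s) (by positivity))
    have hrec := newtonP_rec _ (swY_sub_injective s 0) (swEps s.1) 0 m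
    rw [← hP] at hrec
    have hΛ : ∀ k : ℕ, |∑ j, (dicksonD (swY ⟨s, j⟩ - 0) 0 (k + 1) -
        dicksonD (swY ⟨s, j⟩ - 0 - swEps s.1) 0 (k + 1))| ≤ (k + 1) * absMoment k s := by
      intro k
      rw [absMoment_apply]
      calc _ ≤ ∑ j, |dicksonD (swY ⟨s, j⟩ - 0) 0 (k + 1) -
              dicksonD (swY ⟨s, j⟩ - 0 - swEps s.1) 0 (k + 1)| := Finset.abs_sum_le_sum_abs _ _
        _ ≤ ∑ j, swEps s.1 * (k + 1) * (1 + |swY ⟨s, j⟩|) ^ k := by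
            refine Finset.sum_le_sum fun j _ => ?_
            rw [dicksonD_zero_right, dicksonD_zero_right, sub_zero]
            refine (abs_pow_sub_pow_le _ _ _).trans ?_
            have e : |swY ⟨s, j⟩ - (swY ⟨s, j⟩ - swEps s.1)| = swEps s.1 := by
              rw [sub_sub_cancel, abs_of_pos (swEps_pos _)]
            rw [e, Nat.add_sub_cancel]
            push_cast
            refine mul_le_mul_of_nonneg_left (pow_le_pow_left₀ (by positivity) ?_ k)
              (mul_nonneg (swEps_pos _).le (by positivity))
            refine max_le (by linarith) ((abs_sub _ _).trans ?_)
            linarith [abs_swEps_le s.1]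
        _ = _ := by rw [← Finset.mul_sum, swEps]; ring
    have h1 : |((m : ℝ) + 1) * P (m + 1)| ≤
        ∑ p ∈ Finset.HasAntidiagonal.antidiagonal m, (m + 1) * absMoment m s * 2 ^ p.2 := by
      rw [hrec]
      refine (Finset.abs_sum_le_sum_abs _ _).trans (Finset.sum_le_sum fun p hp => ?_)
      have hpm := Finset.HasAntidiagonal.mem_antidiagonal.1 hp
      rw [abs_mul]
      have h2 := mul_le_mul (hΛ p.1) (hP' p.2 (by omega)) (abs_nonneg _)
        (mul_nonneg (by positivity) (absMoment_nonneg _ _))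
      refine h2.trans ?_
      have h3 := absMoment_mul_le p.1 p.2 s
      rw [hpm] at h3
      have h4 : (p.1 : ℝ) + 1 ≤ m + 1 := by
        have : p.1 ≤ m := by omega
        have : (p.1 : ℝ) ≤ m := by exact_mod_cast this
        linarith
      calc _ = ((p.1 : ℝ) + 1) * 2 ^ p.2 * (absMoment p.1 s * absMoment p.2 s) := by ring
        _ ≤ ((m : ℝ) + 1) * 2 ^ p.2 * absMoment m s := by
            refine mul_le_mul (mul_le_mul_of_nonneg_right h4 (by positivity)) h3 ?_ (by positivity)
            exact mul_nonneg (absMoment_nonneg _ _) (absMoment_nonneg _ _)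
        _ = _ := by ring
    rw [Finset.Nat.sum_antidiagonal_eq_sum_range_succ_mk, ← Finset.mul_sum, abs_mul,
      abs_of_pos (by positivity : (0 : ℝ) < m + 1)] at h1
    have h5 : ∑ k ∈ Finset.range m.succ, (2 : ℝ) ^ (m - k) ≤ 2 ^ (m + 1) := by
      have h6 := Finset.sum_range_reflect (fun k => (2 : ℝ) ^ k) (m + 1)
      have h7 := geom_sum_eq (x := (2 : ℝ)) (by norm_num) (m + 1)
      simp only [Nat.add_sub_cancel] at h6
      rw [Nat.succ_eq_add_one, h6, h7]
      norm_num
    have h8 : ((m : ℝ) + 1) * |P (m + 1)| ≤ (m + 1) * (absMoment m s * 2 ^ (m + 1)) := by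
      refine h1.trans ?_
      rw [mul_assoc]
      exact mul_le_mul_of_nonneg_left (mul_le_mul_of_nonneg_left h5 (absMoment_nonneg _ _))
        (by positivity)
    have h9 := le_of_mul_le_mul_left h8 (by positivity)
    linarith

theorem abs_jump_pow_le (m : ℕ) (s : SWState c) :
    |jump.op (swY ^ m) s| ≤ 2 ^ (m + 1) * absMoment m s := by
  refine le_trans (le_of_eq ?_) (abs_newtonP_le s m)
  rw [newton_shift, jump_op_apply]
  congr 1
  refine Finset.sum_congr rfl fun i _ => ?_
  rw [dicksonU_zero_right, sub_zero]
  rfl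

theorem absMoment_even_le (k : ℕ) (s : SWState c) :
    absMoment (2 * k) s ≤ 2 ^ (2 * k) * (1 + empirical.op (swY ^ (2 * k)) s) := by
  have h : (1 + |swY (c := c)|) ^ (2 * k) ≤ (2 ^ (2 * k) : ℝ) • (1 + swY ^ (2 * k)) := by
    intro ω
    simp only [Pi.pow_apply, Pi.add_apply, Pi.one_apply, Pi.abs_apply, Pi.smul_apply, smul_eq_mul]
    have h0 : swY ω ^ (2 * k) = |swY ω| ^ (2 * k) := by rw [pow_mul, pow_mul, sq_abs]
    rw [h0]
    have h1 : 1 + |swY ω| ≤ 2 * max 1 |swY ω| := by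
      linarith [le_max_left 1 |swY ω|, le_max_right 1 |swY ω|]
    refine (pow_le_pow_left₀ (by positivity) h1 _).trans ?_
    rw [mul_pow]
    refine mul_le_mul_of_nonneg_left ?_ (by positivity)
    rcases max_choice 1 |swY ω| with h | h <;> rw [h]
    · rw [one_pow]; have : 0 ≤ |swY ω| ^ (2 * k) := by positivity
      linarith
    · linarith
  refine (empirical.mono h s).trans (le_of_eq ?_)
  rw [map_smul, map_add, empirical.one]
  rfl

/-- The statistic `N⁻¹ ∑ y_i ^ k`. -/
noncomputable def momentPoly (k : ℕ) (N _n : ℕ) : Polynomial ℝ :=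
  Polynomial.C (1 / (N : ℝ)) * (Polynomial.C (1 / (N : ℝ)) * Polynomial.X) ^ k

theorem swStat_momentPoly (k : ℕ) :
    (swStat (momentPoly k) : SWState c → ℝ) = empirical.op (swY ^ k) := by
  funext s
  rw [swStat, linStat, empirical_op_apply]
  refine Finset.sum_congr rfl fun i _ => ?_
  simp only [momentPoly, Polynomial.eval_mul, Polynomial.eval_C, Polynomial.eval_pow,
    Polynomial.eval_X, Pi.pow_apply, swY, Algebra.algebraMap_self, RingHom.id_apply]
  congr 2; ring

theorem swIncr_momentPoly (k : ℕ) : (swIncr (momentPoly k) : SWPoint c → ℝ) =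
    ∑ j ∈ Finset.range k, (k.choose j : ℝ) • (pEps ^ (k - j + 1) * swY ^ j) := by
  funext ω
  have h1 : (1 / (ω.1.1.N : ℝ) * (shiftedCoord ω.1.2.1 ω.2 + 1)) ^ k =
      ∑ j ∈ Finset.range (k + 1), (swY ω) ^ j * swEps ω.1.1 ^ (k - j) * k.choose j := by
    rw [← add_pow]; simp only [swY, swEps]; congr 1; ring
  have h2 : (1 / (ω.1.1.N : ℝ) * shiftedCoord ω.1.2.1 ω.2) = swY ω := by simp only [swY]; ring
  rw [swIncr]
  simp only [momentPoly, Polynomial.eval_mul, Polynomial.eval_C, Polynomial.eval_pow,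
    Polynomial.eval_X, h1, h2]
  rw [Finset.sum_range_succ, add_sub_cancel_left]
  simp only [Nat.sub_self, pow_zero, mul_one, Nat.choose_self, Nat.cast_one, Finset.sum_apply,
    Pi.smul_apply, smul_eq_mul, Pi.mul_apply, Pi.pow_apply]
  rw [mul_add, add_sub_cancel_right, Finset.mul_sum]
  refine Finset.sum_congr rfl fun j _ => ?_
  simp only [pEps, sigmaPull_apply, pow_succ, swEps]
  ring

theorem linStat_zero_mem_unit {N : ℕ} (hN : 1 ≤ N) (j : Fin N) :
    0 ≤ 1 / (N : ℝ) * shiftedCoord (0 : Fin N → ℤ) j ∧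
      1 / (N : ℝ) * shiftedCoord (0 : Fin N → ℤ) j ≤ 1 := by
  have h0 : (0 : ℝ) < N := by exact_mod_cast hN
  have h1 : ((j : ℕ) + 1 : ℝ) ≤ N := by exact_mod_cast j.2
  have h2 : (0 : ℝ) ≤ (j : ℕ) := by positivity
  have e : shiftedCoord (0 : Fin N → ℤ) j = N - ((j : ℕ) + 1) := by simp [shiftedCoord]
  rw [e]
  constructor
  · have : (0 : ℝ) ≤ N - ((j : ℕ) + 1) := by linarith
    positivity
  · rw [one_div, inv_mul_le_iff₀ h0]; linarith

/-- A box in row `i` changes `N⁻¹ ∑ y ^ (2k)` by multiples of `N ^ (-(2k - j + 1)) y_i ^ j` with `j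
< 2k`, all of order at most `N⁻²`. Their jump averages are controlled by the statistic itself, so
the Gronwall bound applies. -/
theorem exists_bound_empirical_even (k : ℕ) :
    ∃ C, ∀ a : SWIndex c, expect.op (empirical.op (swY ^ (2 * k))) a ≤ C := by
  set K : ℝ := 2 ^ (2 * k) * 2 ^ (2 * k + 1) * 2 ^ (2 * k) with hK
  refine gronwall (B := 1) (K := K) (by positivity) (fun a ha => ?_) (fun a h => ?_)
  · rw [← swStat_momentPoly, ← pow_one (swStat _), expect_zero _ _ ha, pow_one, linStat]
    calc _ ≤ ∑ _j : Fin a.N, 1 / (a.N : ℝ) := by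
          refine Finset.sum_le_sum fun j _ => ?_
          obtain ⟨h0, h1⟩ := linStat_zero_mem_unit a.one_le j
          simp only [momentPoly, Polynomial.eval_mul, Polynomial.eval_C, Polynomial.eval_pow,
            Polynomial.eval_X, Algebra.algebraMap_self, RingHom.id_apply]
          refine mul_le_of_le_one_right (one_div_pos.2 a.N_pos).le (pow_le_one₀ h0 h1)
      _ = 1 := by have := a.N_pos.ne'; simp [this]
  · rw [← swStat_momentPoly, ← pow_one (swStat _), expect_succ, pow_one, pow_one, map_add,
      jump_op_pull', map_add, Pi.add_apply]
    have h1 : jump.op (swIncr (momentPoly (2 * k)) : SWPoint c → ℝ) ≤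
        sigmaPull (fun a => swEps a ^ 2 * K) * (1 + swStat (momentPoly (2 * k))) := by
      intro s
      rw [swIncr_momentPoly, map_sum, Finset.sum_apply, swStat_momentPoly]
      have hs : 0 ≤ 1 + empirical.op (swY ^ (2 * k)) s := by
        have : 0 ≤ empirical.op (swY ^ (2 * k)) s :=
          empirical.nonneg _ (fun ω => by rw [pow_mul]; exact pow_nonneg (sq_nonneg _) k) s
        linarith
      calc _ ≤ ∑ j ∈ Finset.range (2 * k), ((2 * k).choose j : ℝ) *
              (swEps s.1 ^ 2 * (2 ^ (2 * k + 1) * (2 ^ (2 * k) *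
                (1 + empirical.op (swY ^ (2 * k)) s)))) := by
            refine Finset.sum_le_sum fun j hj => ?_
            have hj' := Finset.mem_range.1 hj
            rw [map_smul, Pi.smul_apply, smul_eq_mul]
            refine mul_le_mul_of_nonneg_left ?_ (by positivity)
            have e : (pEps ^ (2 * k - j + 1) : SWPoint c → ℝ) =
              sigmaPull (sigmaPull (swEps ^ (2 * k - j + 1))) := rfl
            rw [e, jump_op_pull, Pi.mul_apply, sigmaPull_apply, Pi.pow_apply]
            have hb : jump.op (swY ^ j) s ≤ 2 ^ (2 * k + 1) * (2 ^ (2 * k) *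
                (1 + empirical.op (swY ^ (2 * k)) s)) := by
              refine (le_abs_self _).trans ((abs_jump_pow_le j s).trans ?_)
              refine mul_le_mul (pow_le_pow_right₀ one_le_two (by omega)) ?_
                (absMoment_nonneg _ _) (by positivity)
              exact (absMoment_mono hj'.le s).trans (absMoment_even_le k s)
            refine (mul_le_mul_of_nonneg_left hb (pow_nonneg (swEps_pos _).le _)).trans ?_
            refine mul_le_mul_of_nonneg_right ?_ (by positivity)
            exact pow_le_pow_of_le_one (swEps_pos _).le (swEps_le_one _) (by omega)
        _ ≤ _ := by
            rw [← Finset.sum_mul]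
            have h3 : ∑ j ∈ Finset.range (2 * k), ((2 * k).choose j : ℝ) ≤ 2 ^ (2 * k) := by
              have := Nat.sum_range_choose (2 * k)
              rw [Finset.sum_range_succ] at this
              have h4 : ∑ j ∈ Finset.range (2 * k), (2 * k).choose j ≤ 2 ^ (2 * k) := by omega
              exact_mod_cast h4
            refine (mul_le_mul_of_nonneg_right h3 (by positivity)).trans (le_of_eq ?_)
            simp only [Pi.mul_apply, sigmaPull_apply, Pi.add_apply, Pi.one_apply, hK]
            ring
    have h2 := expect.mono h1 a
    rw [expect_op_pull, map_add, expect.one, Pi.mul_apply, Pi.add_apply, Pi.one_apply] at h2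
    linarith

theorem swY_mem_bddP : (swY : SWPoint c → ℝ) ∈ bddP c := by
  constructor
  · refine Averaging.mem_bddMoments_of_even _ fun k => ?_
    obtain ⟨C, hC⟩ := exists_bound_empirical_even (c := c) k
    refine ⟨2 ^ (2 * k + 1) * (2 ^ (2 * k) * (1 + C)), fun a => ?_⟩
    have h1 : jump.op (swY ^ (2 * k)) ≤
        (2 ^ (2 * k + 1) * 2 ^ (2 * k) : ℝ) • (1 + empirical.op (swY (c := c) ^ (2 * k))) := by
      intro s
      refine (le_abs_self _).trans ((abs_jump_pow_le _ s).trans ?_)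
      refine (mul_le_mul_of_nonneg_left (absMoment_even_le k s) (by positivity)).trans (le_of_eq ?_)
      simp only [Pi.smul_apply, smul_eq_mul, Pi.add_apply, Pi.one_apply]; ring
    refine (expect.mono h1 a).trans ?_
    rw [map_smul, map_add, expect.one]
    simp only [Pi.smul_apply, smul_eq_mul, Pi.add_apply, Pi.one_apply]
    rw [mul_assoc]
    gcongr
    exact hC a
  · refine Averaging.mem_bddMoments_of_even _ fun k => ?_
    obtain ⟨C, hC⟩ := exists_bound_empirical_even (c := c) k
    exact ⟨C, hC⟩

theorem swX_mem_bddP : (swX : SWPoint c → ℝ) ∈ bddP c :=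
  sub_mem (sub_mem swY_mem_bddP (one_mem _)) pTime_mem_bddP

variable (c) in
/-- Polynomials in the recentred coordinate, the time and `1 / N`. -/
noncomputable def polyP : Subalgebra ℝ (SWPoint c → ℝ) :=
  Algebra.adjoin ℝ {swX, pTime, pEps}

theorem polyP_le_bddP : polyP c ≤ bddP c := by
  refine Algebra.adjoin_le ?_
  rintro f (rfl | rfl | rfl)
  · exact swX_mem_bddP
  · exact pTime_mem_bddP
  · exact pEps_mem_bddP

end Moments

/-! ### First-order expansion of Dickson polynomials. -/

/-- Shift of a sequence by one place, starting with `0`. -/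
def shiftSeq {R : Type*} [Zero R] (f : ℕ → R) : ℕ → R
  | 0 => 0
  | k + 1 => f k

section Taylor

variable {R : Type*} [CommRing R] [Algebra ℝ R]

theorem dicksonU_succ_eq (x t : R) (m : ℕ) :
    dicksonU x t (m + 1) = x * dicksonU x t m - t * shiftSeq (dicksonU x t) m := by
  cases m <;> simp [dicksonU, shiftSeq]

theorem dicksonD_succ_eq (x t : R) (m : ℕ) :
    dicksonD x t (m + 1) = dicksonU x t (m + 1) - t * shiftSeq (dicksonU x t) m := by
  cases m
  · simp [dicksonD, dicksonU, shiftSeq]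
  · exact dicksonD_eq_dicksonU x t _

/-- First order expansion of Dickson polynomials. -/
theorem dicksonD_taylor (S : Subalgebra ℝ R) {x t a b e : R} (hx : x ∈ S) (ht : t ∈ S) (ha : a ∈ S)
    (hb : b ∈ S) (he : e ∈ S) (m : ℕ) : ∃ w ∈ S, dicksonD (x + e * a) (t + e * b) (m + 1) =
      dicksonD x t (m + 1) +
        e * ((m + 1) * (a * dicksonU x t m - b * shiftSeq (dicksonU x t) m)) + e ^ 2 * w := by
  have hU : ∀ k, dicksonU x t k ∈ S := fun k => by
    induction k using Nat.twoStepInduction with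
    | zero => exact S.one_mem
    | one => exact hx
    | more n h1 h2 => exact S.sub_mem (S.mul_mem hx h2) (S.mul_mem ht h1)
  have hU' : ∀ k, shiftSeq (dicksonU x t) k ∈ S := fun k => by
    cases k
    · exact S.zero_mem
    · exact hU _
  have hcast : ∀ k : ℕ, (k : R) ∈ S := fun k => S.natCast_mem k
  induction m using Nat.twoStepInduction with
  | zero => exact ⟨0, S.zero_mem, by simp [dicksonD, dicksonU, shiftSeq]⟩
  | one =>
    refine ⟨a ^ 2, S.pow_mem ha 2, ?_⟩
    simp [dicksonD, dicksonU, shiftSeq]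
    ring
  | more m h1 h2 =>
    obtain ⟨w1, hw1, e1⟩ := h1
    obtain ⟨w2, hw2, e2⟩ := h2
    refine ⟨(x + e * a) * w2 - (t + e * b) * w1 +
      a * ((m + 2 : ℕ) * (a * dicksonU x t (m + 1) - b * shiftSeq (dicksonU x t) (m + 1))) -
      b * ((m + 1 : ℕ) * (a * dicksonU x t m - b * shiftSeq (dicksonU x t) m)), ?_, ?_⟩
    · refine S.sub_mem (S.add_mem (S.sub_mem (S.mul_mem (S.add_mem hx (S.mul_mem he ha)) hw2)
        (S.mul_mem (S.add_mem ht (S.mul_mem he hb)) hw1)) (S.mul_mem ha (S.mul_mem (hcast _)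
          (S.sub_mem (S.mul_mem ha (hU _)) (S.mul_mem hb (hU' _))))))
          (S.mul_mem hb (S.mul_mem (hcast _)
          (S.sub_mem (S.mul_mem ha (hU _)) (S.mul_mem hb (hU' _)))))
    · have d1 := dicksonD_succ_eq x t (m + 1)
      have d0 := dicksonD_succ_eq x t m
      have u1 := dicksonU_succ_eq x t m
      have hd : ∀ x t : R, dicksonD x t (m + 2 + 1) =
        x * dicksonD x t (m + 1 + 1) - t * dicksonD x t (m + 1) := fun _ _ => rfl
      have hu2 : dicksonU x t (m + 1 + 1) = x * dicksonU x t (m + 1) - t * dicksonU x t m := rfl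
      have hs : shiftSeq (dicksonU x t) (m + 1) = dicksonU x t m := rfl
      have hs2 : shiftSeq (dicksonU x t) (m + 2) = dicksonU x t (m + 1) := rfl
      rw [hd, hd, e1, e2, hs, hs2, d1, d0, hs, show m + 2 = m + 1 + 1 from rfl, hu2, u1]
      push_cast
      ring

end Taylor

/-! ### Dickson statistics and their increments. -/

section Statistics

variable {c : ℝ}

/-- The deterministic leading term of the Dickson statistics. -/
noncomputable def detTerm (m : ℕ) (t : ℝ) : ℝ := (-1) ^ m * (1 / (m + 1) - t / (m - 1))

/-- The polynomials of the centred Dickson statistics. -/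
noncomputable def dicksonPoly (m N n : ℕ) : Polynomial ℝ :=
  dicksonD (Polynomial.C (1 / (N : ℝ)) * Polynomial.X - Polynomial.C (1 + (n : ℝ) / (N : ℝ) ^ 2))
    (Polynomial.C ((n : ℝ) / (N : ℝ) ^ 2)) m - Polynomial.C (detTerm m ((n : ℝ) / (N : ℝ) ^ 2))

theorem eval_dicksonPoly (m N n : ℕ) (l : ℝ) : (dicksonPoly m N n).eval l =
    dicksonD (1 / (N : ℝ) * l - (1 + (n : ℝ) / (N : ℝ) ^ 2)) ((n : ℝ) / (N : ℝ) ^ 2) m -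
      detTerm m ((n : ℝ) / (N : ℝ) ^ 2) := by
  have h := map_dicksonD (Polynomial.evalRingHom l) (Polynomial.C (1 / (N : ℝ)) * Polynomial.X -
    Polynomial.C (1 + (n : ℝ) / (N : ℝ) ^ 2)) (Polynomial.C ((n : ℝ) / (N : ℝ) ^ 2)) m
  rw [Polynomial.coe_evalRingHom] at h
  rw [dicksonPoly, Polynomial.eval_sub, h]
  simp

/-- The centred Dickson statistics. -/
noncomputable def swH (m : ℕ) : SWState c → ℝ := swStat (dicksonPoly m)

/-- Dickson polynomials of the first kind of the recentred coordinate. -/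
noncomputable def pD (m : ℕ) : SWPoint c → ℝ := dicksonD swX pTime m

/-- Dickson polynomials of the second kind of the recentred coordinate. -/
noncomputable def pU (m : ℕ) : SWPoint c → ℝ := dicksonU swX pTime m

/-- `1 / N` as a function of states. -/
noncomputable def sEps : SWState c → ℝ := sigmaPull swEps

/-- The rescaled time as a function of states. -/
noncomputable def sTime : SWState c → ℝ := sigmaPull swTime

theorem swX_mem_polyP : (swX : SWPoint c → ℝ) ∈ polyP c := Algebra.subset_adjoin (by simp)
theorem pTime_mem_polyP : (pTime : SWPoint c → ℝ) ∈ polyP c := Algebra.subset_adjoin (by simp)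
theorem pEps_mem_polyP : (pEps : SWPoint c → ℝ) ∈ polyP c := Algebra.subset_adjoin (by simp)

theorem pU_mem_polyP (m : ℕ) : (pU m : SWPoint c → ℝ) ∈ polyP c := by
  induction m using Nat.twoStepInduction with
  | zero => exact one_mem _
  | one => exact swX_mem_polyP
  | more n h1 h2 => exact sub_mem (mul_mem swX_mem_polyP h2) (mul_mem pTime_mem_polyP h1)

theorem dicksonD_fun_apply (f g : SWPoint c → ℝ) (m : ℕ) (ω : SWPoint c) :
    dicksonD f g m ω = dicksonD (f ω) (g ω) m :=
  map_dicksonD (Pi.evalRingHom (fun _ : SWPoint c => ℝ) ω) f g m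

theorem dicksonU_fun_apply (f g : SWPoint c → ℝ) (m : ℕ) (ω : SWPoint c) :
    dicksonU f g m ω = dicksonU (f ω) (g ω) m :=
  map_dicksonU (Pi.evalRingHom (fun _ : SWPoint c => ℝ) ω) f g m

theorem swX_apply (ω : SWPoint c) : swX ω =
    1 / (ω.1.1.N : ℝ) * shiftedCoord ω.1.2.1 ω.2 - (1 + (ω.1.1.n : ℝ) / (ω.1.1.N : ℝ) ^ 2) := by
  change shiftedCoord ω.1.2.1 ω.2 / ω.1.1.N - 1 - (ω.1.1.n : ℝ) / (ω.1.1.N : ℝ) ^ 2 = _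
  ring

theorem empirical_pD (m : ℕ) (s : SWState c) :
    empirical.op (pD m) s = detTerm m (sTime s) + sEps s * swH m s := by
  have hN := s.1.N_pos.ne'
  have h : ∀ i, (dicksonPoly m s.1.N s.1.n).eval (shiftedCoord s.2.1 i) =
      pD m ⟨s, i⟩ - detTerm m (sTime s) := by
    intro i
    rw [eval_dicksonPoly, pD, dicksonD_fun_apply, swX_apply]
    rfl
  rw [swH, swStat, linStat, empirical_op_apply]
  simp only [Algebra.algebraMap_self, RingHom.id_apply, h, Finset.sum_sub_distrib, Finset.sum_const,
    Finset.card_univ, Fintype.card_fin, nsmul_eq_mul]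
  simp only [sEps, sigmaPull_apply, swEps, ← Finset.mul_sum]
  field_simp
  ring

/-- The fluctuations of the empirical averages of Dickson polynomials of the second kind. -/
noncomputable def swEta : ℕ → SWState c → ℝ
  | 0 => 0
  | 1 => swH 1
  | m + 2 => swH (m + 2) + sTime * swEta m

/-- From `U_{m+2} = D_{m+2} + t U_m`: the part of `detTerm (m + 2)` proportional to `t` is minus `t`
times the leading term of `U_m`, so the leading terms for `U` do not depend on time. -/
theorem empirical_pU (m : ℕ) (s : SWState c) :
    empirical.op (pU m) s = (-1) ^ m / (m + 1) + sEps s * swEta m s := by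
  induction m using Nat.twoStepInduction with
  | zero =>
    have : (pU 0 : SWPoint c → ℝ) = 1 := rfl
    rw [this, empirical.one]; simp [swEta]
  | one =>
    have : (pU 1 : SWPoint c → ℝ) = pD 1 := rfl
    rw [this, empirical_pD]
    -- At `m = 1` the quotient `t / (m - 1)` is `0` by convention, which is the right value: the row
    -- average of `x` is near `-1 / 2` at all times.
    simp [swEta, detTerm]; norm_num
  | more m h1 _ =>
    have h : (pU (m + 2) : SWPoint c → ℝ) = pD (m + 2) + sigmaPull sTime * pU m := by
      rw [pD, pU, pU, dicksonD_eq_dicksonU]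
      change _ = _ - sigmaPull sTime * dicksonU swX pTime m + _
      ring
    rw [h, map_add, empirical_op_pull, Pi.add_apply, Pi.mul_apply, h1, empirical_pD, swEta]
    simp only [Pi.add_apply, Pi.mul_apply, detTerm]
    have : (m : ℝ) + 1 ≠ 0 := by positivity
    have : (m : ℝ) + 2 + 1 ≠ 0 := by positivity
    push_cast
    have e : (m : ℝ) + 2 - 1 = m + 1 := by ring
    rw [e]
    field_simp
    ring

theorem dicksonPoly_eval_eq (m : ℕ) (ω : SWPoint c) :
    (dicksonPoly m ω.1.1.N ω.1.1.n).eval (shiftedCoord ω.1.2.1 ω.2) =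
      pD m ω - detTerm m (sTime ω.1) := by
  rw [eval_dicksonPoly, pD, dicksonD_fun_apply, swX_apply]; rfl

theorem dicksonPoly_eval_succ (m : ℕ) (ω : SWPoint c) :
    (dicksonPoly m ω.1.1.N (ω.1.1.n + 1)).eval (shiftedCoord ω.1.2.1 ω.2) =
      (dicksonD (swX + pEps ^ 2 * (-1)) (pTime + pEps ^ 2 * 1) m : SWPoint c → ℝ) ω -
        detTerm m (sTime ω.1 + sEps ω.1 ^ 2) := by
  rw [eval_dicksonPoly, dicksonD_fun_apply]
  have e1 : (((ω.1.1.n + 1 : ℕ) : ℝ) / (ω.1.1.N : ℝ) ^ 2) = sTime ω.1 + sEps ω.1 ^ 2 := by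
    simp only [sTime, sEps, swTime, swEps, sigmaPull_apply]; push_cast; ring
  have e2 : (swX + pEps ^ 2 * (-1) : SWPoint c → ℝ) ω = 1 / (ω.1.1.N : ℝ) * shiftedCoord ω.1.2.1 ω.2 -
      (1 + (sTime ω.1 + sEps ω.1 ^ 2)) := by
    simp only [Pi.add_apply, Pi.mul_apply, Pi.pow_apply, Pi.neg_apply, Pi.one_apply, swX_apply,
      pEps, sTime, sEps, swTime, swEps, sigmaPull_apply]
    ring
  have e3 : (pTime + pEps ^ 2 * 1 : SWPoint c → ℝ) ω = sTime ω.1 + sEps ω.1 ^ 2 := by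
    rw [mul_one]; rfl
  rw [e1, e2, e3]

theorem dicksonPoly_eval_succ_add (m : ℕ) (ω : SWPoint c) :
    (dicksonPoly m ω.1.1.N (ω.1.1.n + 1)).eval (shiftedCoord ω.1.2.1 ω.2 + 1) =
      (dicksonD (swX + pEps * (1 - pEps)) (pTime + pEps * pEps) m : SWPoint c → ℝ) ω -
        detTerm m (sTime ω.1 + sEps ω.1 ^ 2) := by
  rw [eval_dicksonPoly, dicksonD_fun_apply]
  have e1 : (((ω.1.1.n + 1 : ℕ) : ℝ) / (ω.1.1.N : ℝ) ^ 2) = sTime ω.1 + sEps ω.1 ^ 2 := by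
    simp only [sTime, sEps, swTime, swEps, sigmaPull_apply]; push_cast; ring
  have e2 : (swX + pEps * (1 - pEps) : SWPoint c → ℝ) ω = 1 / (ω.1.1.N : ℝ) * (shiftedCoord ω.1.2.1 ω.2 + 1) -
      (1 + (sTime ω.1 + sEps ω.1 ^ 2)) := by
    simp only [Pi.add_apply, Pi.mul_apply, Pi.sub_apply, Pi.one_apply, swX_apply,
      pEps, sTime, sEps, swTime, swEps, sigmaPull_apply]
    ring
  have e3 : (pTime + pEps * pEps : SWPoint c → ℝ) ω = sTime ω.1 + sEps ω.1 ^ 2 := by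
    rw [← sq]; rfl
  rw [e1, e2, e3]

theorem detTerm_add (m : ℕ) (t δ : ℝ) :
    detTerm (m + 1) (t + δ) = detTerm (m + 1) t + (-1) ^ m * δ / m := by
  simp only [detTerm]; push_cast; rw [add_sub_cancel_right]; ring

/-- The shift of the centre and of time moves every row by order `N⁻²`, hence the sum over rows by
order `N⁻¹`; the motion of `detTerm` compensates this. For `m = 0` the quotient `(-1) ^ m / m` is
`0` by convention, and the remaining `-1` offsets `U_0 = 1` in the increment. -/
theorem det_cancel (m : ℕ) :
    -((m : ℝ) + 1) * ((-1) ^ m / (m + 1) + shiftSeq (fun k : ℕ => (-1 : ℝ) ^ k / (k + 1)) m) -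
      (-1) ^ m / m = if m = 0 then -1 else 0 := by
  cases m with
  | zero => simp [shiftSeq]
  | succ m =>
    have : (m : ℝ) + 1 ≠ 0 := by positivity
    have : (m : ℝ) + 1 + 1 ≠ 0 := by positivity
    simp only [shiftSeq, Nat.add_eq_zero_iff, one_ne_zero, and_false, if_false]
    push_cast
    field_simp
    ring

theorem empirical_shift_pU (m : ℕ) (s : SWState c) : empirical.op (shiftSeq pU m) s =
    shiftSeq (fun k : ℕ => (-1 : ℝ) ^ k / (k + 1)) m + sEps s * shiftSeq swEta m s := by
  cases m with
  | zero => simp [shiftSeq]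
  | succ m => exact empirical_pU m s

/-- The increment of the centred Dickson statistics. -/
theorem swIncr_dicksonPoly (m : ℕ) : ∃ w ∈ polyP c, ∃ v ∈ polyP c,
    swIncr (dicksonPoly (m + 1)) = pEps * (((m : SWPoint c → ℝ) + 1) * pU m + (fun _ => if m = 0 then -1 else 0)) +
      pEps ^ 2 * (w - sigmaPull (((m : SWState c → ℝ) + 1) * (swEta m + shiftSeq swEta m) - sEps * empirical.op v)) := by
  have hE := pEps_mem_polyP (c := c)
  -- Two expansions: in every row the change of centre and of time alone moves `x` by `-N⁻²`; the
  -- row receiving the box moves by `N⁻¹ - N⁻²` in total.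
  obtain ⟨v, hv, ev⟩ := dicksonD_taylor (polyP c) swX_mem_polyP pTime_mem_polyP
    (neg_mem (one_mem _)) (one_mem _) (pow_mem hE 2) m
  obtain ⟨w1, hw1, e1⟩ := dicksonD_taylor (polyP c) swX_mem_polyP pTime_mem_polyP
    (sub_mem (one_mem _) hE) hE hE m
  refine ⟨w1 - pEps ^ 2 * v, sub_mem hw1 (mul_mem (pow_mem hE 2) hv), v, hv, ?_⟩
  funext ω
  obtain ⟨s, i⟩ := ω
  have hN := s.1.N_pos.ne'
  have hv' : ∀ j, (dicksonD (swX + pEps ^ 2 * (-1)) (pTime + pEps ^ 2 * 1) (m + 1) : SWPoint c → ℝ) ⟨s, j⟩ =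
      pD (m + 1) ⟨s, j⟩ + sEps s ^ 2 * ((m + 1) * (-pU m ⟨s, j⟩ - shiftSeq pU m ⟨s, j⟩)) +
        sEps s ^ 4 * v ⟨s, j⟩ := by
    intro j
    rw [ev]
    simp only [Pi.add_apply, Pi.mul_apply, Pi.pow_apply, Pi.sub_apply, Pi.neg_apply, Pi.one_apply,
      Pi.natCast_apply]
    change _ + sEps s ^ 2 * _ + (sEps s ^ 2) ^ 2 * _ = _
    rw [← pow_mul]
    congr 2
    change sEps s ^ 2 * (((m : ℝ) + 1) * (-1 * pU m ⟨s, j⟩ - 1 * shiftSeq pU m ⟨s, j⟩)) = _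
    ring
  have h1 : linStat (dicksonPoly (m + 1) s.1.N (s.1.n + 1)) s.2.1 = ∑ j,
      (pD (m + 1) ⟨s, j⟩ + sEps s ^ 2 * ((m + 1) * (-pU m ⟨s, j⟩ - shiftSeq pU m ⟨s, j⟩)) +
        sEps s ^ 4 * v ⟨s, j⟩ - detTerm (m + 1) (sTime s + sEps s ^ 2)) := by
    refine Finset.sum_congr rfl fun j _ => ?_
    rw [← hv' j]
    exact dicksonPoly_eval_succ (m + 1) ⟨s, j⟩
  have h2 : linStat (dicksonPoly (m + 1) s.1.N s.1.n) s.2.1 =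
      ∑ j, (pD (m + 1) ⟨s, j⟩ - detTerm (m + 1) (sTime s)) :=
    Finset.sum_congr rfl fun j _ => dicksonPoly_eval_eq (m + 1) ⟨s, j⟩
  have h3 : ∀ Z : SWPoint c → ℝ, ∑ j, Z ⟨s, j⟩ = s.1.N * empirical.op Z s := by
    intro Z
    rw [empirical_op_apply, ← Finset.mul_sum, ← mul_assoc, mul_one_div_cancel hN, one_mul]
  have hu := empirical_pU m s
  have hu' := empirical_shift_pU m s
  have hdet := det_cancel m
  have h4 := dicksonPoly_eval_succ (m + 1) ⟨s, i⟩
  have h5 := dicksonPoly_eval_succ_add (m + 1) ⟨s, i⟩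
  rw [hv' i] at h4
  have e1' := congrFun e1 ⟨s, i⟩
  simp only [Pi.add_apply, Pi.mul_apply, Pi.pow_apply, Pi.sub_apply, Pi.neg_apply, Pi.one_apply,
    Pi.natCast_apply] at e1'
  change _ = pD (m + 1) ⟨s, i⟩ + sEps s * (((m : ℝ) + 1) * ((1 - sEps s) * pU m ⟨s, i⟩ -
    sEps s * shiftSeq pU m ⟨s, i⟩)) + sEps s ^ 2 * w1 ⟨s, i⟩ at e1'
  rw [e1'] at h5
  have h12 : linStat (dicksonPoly (m + 1) s.1.N (s.1.n + 1)) s.2.1 -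
      linStat (dicksonPoly (m + 1) s.1.N s.1.n) s.2.1 =
      s.1.N * (sEps s ^ 2 * ((m + 1) * (-empirical.op (pU m) s -
        empirical.op (shiftSeq pU m) s)) + sEps s ^ 4 * empirical.op v s) -
      s.1.N * ((-1) ^ m * sEps s ^ 2 / m) := by
    rw [h1, h2, ← Finset.sum_sub_distrib, detTerm_add]
    have : ∀ j : Fin s.1.N, pD (m + 1) ⟨s, j⟩ + sEps s ^ 2 * ((m + 1) * (-pU m ⟨s, j⟩ -
        shiftSeq pU m ⟨s, j⟩)) + sEps s ^ 4 * v ⟨s, j⟩ -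
        (detTerm (m + 1) (sTime s) + (-1) ^ m * sEps s ^ 2 / m) -
        (pD (m + 1) ⟨s, j⟩ - detTerm (m + 1) (sTime s)) =
        -(sEps s ^ 2 * (m + 1)) * pU m ⟨s, j⟩ - sEps s ^ 2 * (m + 1) * shiftSeq pU m ⟨s, j⟩ +
        sEps s ^ 4 * v ⟨s, j⟩ - (-1) ^ m * sEps s ^ 2 / m := fun j => by ring
    simp only [this, Finset.sum_sub_distrib, Finset.sum_add_distrib, ← Finset.mul_sum, h3,
      Finset.sum_const, Finset.card_univ, Fintype.card_fin, nsmul_eq_mul]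
    ring
  have hNe : (s.1.N : ℝ) * sEps s = 1 := by
    simp only [sEps, sigmaPull_apply, swEps]; field_simp
  rw [hu, hu'] at h12
  set δ : ℝ := if m = 0 then -1 else 0 with hδ
  change linStat (dicksonPoly (m + 1) s.1.N (s.1.n + 1)) s.2.1 +
    ((dicksonPoly (m + 1) s.1.N (s.1.n + 1)).eval (shiftedCoord s.2.1 i + 1) -
      (dicksonPoly (m + 1) s.1.N (s.1.n + 1)).eval (shiftedCoord s.2.1 i)) -
      linStat (dicksonPoly (m + 1) s.1.N s.1.n) s.2.1 =
    sEps s * (((m : ℝ) + 1) * pU m ⟨s, i⟩ + δ) + sEps s ^ 2 * (w1 ⟨s, i⟩ - sEps s ^ 2 * v ⟨s, i⟩ -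
      ((m + 1) * (swEta m s + shiftSeq swEta m s) - sEps s * empirical.op v s))
  rw [h5, h4]
  set vv := shiftSeq (fun k : ℕ => (-1 : ℝ) ^ k / (k + 1)) m
  have h6 : (s.1.N : ℝ) * (sEps s ^ 2 * ((m + 1) * (-((-1) ^ m / (m + 1) + sEps s * swEta m s) -
      (vv + sEps s * shiftSeq swEta m s))) + sEps s ^ 4 * empirical.op v s) -
      s.1.N * ((-1) ^ m * sEps s ^ 2 / m) = sEps s * δ +
      sEps s ^ 2 * (-((m + 1) * (swEta m s + shiftSeq swEta m s)) + sEps s * empirical.op v s) := by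
    linear_combination (sEps s * ((m + 1) * (-((-1) ^ m / (m + 1) + sEps s * swEta m s) -
      (vv + sEps s * shiftSeq swEta m s))) + sEps s ^ 3 * empirical.op v s -
      ((-1) ^ m * sEps s / m)) * hNe + sEps s * hdet
  linear_combination h12 + h6

end Statistics

/-! ### Moment bounds for statistics with small drift. -/

section Bounds

variable {c : ℝ}

theorem sEps_mem_bddS : (sEps : SWState c → ℝ) ∈ bddS c := bounded_mem_bddS abs_swEps_le

theorem sTime_mem_bddS : (sTime : SWState c → ℝ) ∈ bddS c := bounded_mem_bddS abs_swTime_le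

theorem pow_mul_abs_le (x y : ℝ) {r k : ℕ} (hk : 1 ≤ k) (hkr : k ≤ r) :
    |x| ^ (r - k) * |y| ≤ |x| ^ r + |y| ^ r + 1 := by
  have h1 : |x| ^ (r - k) * |y| ≤ (max 1 (max |x| |y|)) ^ r := by
    calc |x| ^ (r - k) * |y| ≤ (max 1 (max |x| |y|)) ^ (r - k) * (max 1 (max |x| |y|)) ^ k := by
          refine mul_le_mul (pow_le_pow_left₀ (abs_nonneg _)
            ((le_max_left _ _).trans (le_max_right _ _)) _) ?_ (abs_nonneg _) (by positivity)
          exact ((le_max_right _ _).trans (le_max_right _ _)).trans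
            (le_self_pow₀ (le_max_left _ _) (by omega))
      _ = _ := by rw [← pow_add]; congr 1; omega
  refine h1.trans ?_
  have hx : 0 ≤ |x| ^ r := by positivity
  have hy : 0 ≤ |y| ^ r := by positivity
  rcases max_choice 1 (max |x| |y|) with h | h <;> rw [h]
  · rw [one_pow]; linarith
  · rcases max_choice |x| |y| with h | h <;> rw [h] <;> linarith

/-- A family of linear statistics with increments of order `N⁻¹` and drift of order `N⁻²` has
bounded moments. -/
theorem swStat_mem_bddS {Φ : ℕ → ℕ → Polynomial ℝ} {B : ℝ}
    (h0 : ∀ N : ℕ, 1 ≤ N → |linStat (Φ N 0) (0 : Fin N → ℤ)| ≤ B)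
    {Z : SWPoint c → ℝ} (hZ : Z ∈ bddP c) (hΔ : swIncr Φ = pEps * Z)
    {Y : SWState c → ℝ} (hY : Y ∈ bddS c) (hQ : jump.op Z = sEps * Y) :
    (swStat Φ : SWState c → ℝ) ∈ bddS c := by
  refine Averaging.mem_bddMoments_of_even _ fun p => ?_
  set r := 2 * p with hr
  set H : SWState c → ℝ := swStat Φ with hH
  -- For `k ≥ 2` the factor `ε ^ k` is at most `ε ^ 2`; for `k = 1` the second factor `ε` comes from
  -- the drift hypothesis. So every correction in the binomial expansion carries `ε ^ 2`, as the
  -- Gronwall bound requires.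
  set R : ℕ → SWState c → ℝ := fun k => if k = 1 then Y else jump.op (Z ^ k) with hR
  have hRb : ∀ k, R k ∈ bddS c := fun k => by
    simp only [hR]; split_ifs
    · exact hY
    · exact jump_mem_bddS (pow_mem hZ k)
  have hRle : ∀ k, 1 ≤ k → ∀ s, |sEps s ^ k * jump.op (Z ^ k) s| ≤ sEps s ^ 2 * |R k s| := by
    intro k hk s
    have he : 0 ≤ sEps s := (swEps_pos s.1).le
    by_cases h1 : k = 1
    · subst h1
      rw [pow_one, pow_one, hQ]
      simp only [hR, if_true, Pi.mul_apply, abs_mul, abs_of_nonneg he]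
      exact le_of_eq (by ring)
    · simp only [hR, h1, if_false, abs_mul, abs_pow, abs_of_nonneg he]
      refine mul_le_mul_of_nonneg_right ?_ (abs_nonneg _)
      exact pow_le_pow_of_le_one he (swEps_le_one s.1) (by omega)
  choose C hC using fun k => hRb k r
  have hC0 : ∀ k, 0 ≤ |C k| := fun k => abs_nonneg _
  set K : ℝ := ∑ k ∈ Finset.range r, (r.choose (k + 1) : ℝ) * (|C (k + 1)| + 1) with hK
  have hKsum : ∑ k ∈ Finset.range r, (r.choose (k + 1) : ℝ) ≤ K := by
    refine Finset.sum_le_sum fun k _ => ?_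
    have := hC0 (k + 1)
    have h2 : (0 : ℝ) ≤ r.choose (k + 1) := by positivity
    nlinarith
  have hK0 : 0 ≤ K := Finset.sum_nonneg fun k _ => mul_nonneg (by positivity) (by linarith [hC0 (k+1)])
  have habs : ∀ s, |H s| ^ r = H s ^ r := fun s => by rw [hr, pow_mul, pow_mul, sq_abs]
  have hEH0 : ∀ a, 0 ≤ expect.op (H ^ r) a := expect.nonneg _ fun s => by
    rw [Pi.pow_apply, ← habs]; exact pow_nonneg (abs_nonneg _) _
  refine gronwall (B := |B| ^ r) hK0 (fun a ha => ?_) (fun a h => ?_)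
  · rw [expect_zero _ _ ha, hr, pow_mul, ← sq_abs, ← pow_mul]
    exact pow_le_pow_left₀ (abs_nonneg _) ((h0 a.N a.one_le).trans (le_abs_self B)) _
  · rw [expect_succ, ← hH]
    have h1 : jump.op ((sigmaPull H + swIncr Φ) ^ r) ≤ H ^ r +
        sigmaPull (fun a => swEps a ^ 2) * ∑ k ∈ Finset.range r,
          (r.choose (k + 1) : ℝ) • (H ^ r + |R (k + 1)| ^ r + 1) := by
      intro s
      have e : ((sigmaPull H + swIncr Φ) ^ r : SWPoint c → ℝ) = ∑ k ∈ Finset.range (r + 1),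
          (r.choose k : ℝ) • (sigmaPull (sEps ^ k * H ^ (r - k)) * Z ^ k) := by
        rw [add_comm, add_pow, hΔ]
        refine Finset.sum_congr rfl fun k _ => ?_
        funext ω
        simp only [Pi.mul_apply, Pi.pow_apply, Pi.smul_apply, smul_eq_mul, sigmaPull_apply,
          Pi.natCast_apply]
        change (sEps ω.1 * Z ω) ^ k * _ * _ = _
        ring
      rw [e, map_sum, Finset.sum_apply, Finset.sum_range_succ']
      simp only [map_smul, jump_op_pull, Pi.smul_apply, smul_eq_mul, Pi.mul_apply, Pi.pow_apply,
        pow_zero, jump.one, Nat.choose_zero_right, Nat.cast_one, Pi.one_apply, one_mul, mul_one,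
        Nat.sub_zero, Pi.add_apply, Finset.sum_apply, sigmaPull_apply, Finset.mul_sum, Pi.abs_apply]
      rw [add_comm]
      refine add_le_add (le_of_eq (congrFun (jump_op_pull' (H ^ r)) s)) (Finset.sum_le_sum fun k hk => ?_)
      rw [mul_left_comm (swEps s.1 ^ 2)]
      refine mul_le_mul_of_nonneg_left ?_ (by positivity)
      have hk' := Finset.mem_range.1 hk
      calc sEps s ^ (k + 1) * H s ^ (r - (k + 1)) * jump.op (Z ^ (k + 1)) s
          ≤ |H s| ^ (r - (k + 1)) * |sEps s ^ (k + 1) * jump.op (Z ^ (k + 1)) s| := by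
            refine (le_abs_self _).trans (le_of_eq ?_)
            rw [← abs_pow, ← abs_mul]; congr 1; ring
        _ ≤ |H s| ^ (r - (k + 1)) * (sEps s ^ 2 * |R (k + 1) s|) :=
            mul_le_mul_of_nonneg_left (hRle _ (by omega) s) (by positivity)
        _ = sEps s ^ 2 * (|H s| ^ (r - (k + 1)) * |R (k + 1) s|) := by ring
        _ ≤ sEps s ^ 2 * (|H s| ^ r + |R (k + 1) s| ^ r + 1) :=
            mul_le_mul_of_nonneg_left (pow_mul_abs_le _ _ (by omega) (by omega)) (sq_nonneg _)
        _ = _ := by rw [habs]; rfl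
    refine (expect.mono h1 a).trans ?_
    rw [map_add, expect_op_pull, map_sum]
    simp only [map_smul, map_add, expect.one, Pi.add_apply, Pi.mul_apply, Finset.sum_apply,
      Pi.smul_apply, smul_eq_mul, Pi.one_apply]
    have h2 : ∑ k ∈ Finset.range r, (r.choose (k + 1) : ℝ) *
        (expect.op (H ^ r) a + expect.op (|R (k + 1)| ^ r) a + 1) ≤
        K * expect.op (H ^ r) a + K := by
      calc _ ≤ ∑ k ∈ Finset.range r, ((r.choose (k + 1) : ℝ) * expect.op (H ^ r) a +
              (r.choose (k + 1) : ℝ) * (|C (k + 1)| + 1)) := by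
            refine Finset.sum_le_sum fun k _ => ?_
            rw [← mul_add]
            refine mul_le_mul_of_nonneg_left ?_ (by positivity)
            have := (hC (k + 1) a).trans (le_abs_self _)
            linarith
        _ ≤ _ := by
            rw [Finset.sum_add_distrib, ← Finset.sum_mul]
            exact add_le_add (mul_le_mul_of_nonneg_right hKsum (hEH0 a)) le_rfl
    have h3 := mul_le_mul_of_nonneg_left h2 (sq_nonneg (swEps a))
    linarith

/-- Comparison of a Riemann sum with `∫ x ^ m`: `pow_tangent`, used at both endpoints, bounds `(M +
1) ^ (m + 1) - M ^ (m + 1)` from above and below. It controls the statistics at time `0`, where the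
rows are equally spaced. -/
theorem abs_sum_pow_sub_le {N : ℕ} (hN : 1 ≤ N) (m : ℕ) :
    |∑ j : Fin N, (((j : ℕ) + 1 : ℝ) / N) ^ m - N / (m + 1)| ≤ 1 := by
  have hN0 : (0 : ℝ) < N := by exact_mod_cast hN
  have hm : (0 : ℝ) < m + 1 := by positivity
  rw [Fin.sum_univ_eq_sum_range (fun j => (((j : ℕ) + 1 : ℝ) / N) ^ m) N]
  have key : ∀ M : ℕ, (M : ℝ) ^ (m + 1) ≤ (m + 1) * ∑ j ∈ Finset.range M, ((j : ℝ) + 1) ^ m ∧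
      (m + 1) * ∑ j ∈ Finset.range M, ((j : ℝ) + 1) ^ m ≤
        (M : ℝ) ^ (m + 1) + (m + 1) * (M : ℝ) ^ m := by
    intro M
    induction M with
    | zero => simp; positivity
    | succ M ih =>
      have h1 := Averaging.pow_tangent (z := M) (m := M + 1) (by positivity) (by positivity) m
      have h2 := Averaging.pow_tangent (z := M + 1) (m := M) (by positivity) (by positivity) m
      rw [Finset.sum_range_succ]
      push_cast
      constructor
      · have e : ((m : ℝ) + 1) * ((M : ℝ) + 1) ^ m * M - m * ((M : ℝ) + 1) ^ (m + 1) =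
          ((M : ℝ) + 1) ^ (m + 1) - (m + 1) * ((M : ℝ) + 1) ^ m := by ring
        linarith [ih.1]
      · have e : ((m : ℝ) + 1) * (M : ℝ) ^ m * (M + 1) - m * (M : ℝ) ^ (m + 1) =
          (M : ℝ) ^ (m + 1) + (m + 1) * (M : ℝ) ^ m := by ring
        linarith [ih.2]
  obtain ⟨k1, k2⟩ := key N
  have e : ∑ j ∈ Finset.range N, (((j : ℕ) + 1 : ℝ) / N) ^ m =
      (∑ j ∈ Finset.range N, ((j : ℝ) + 1) ^ m) / N ^ m := by
    rw [Finset.sum_div]; exact Finset.sum_congr rfl fun j _ => div_pow _ _ _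
  rw [e, abs_le]
  set S := ∑ j ∈ Finset.range N, ((j : ℝ) + 1) ^ m
  have hp : (0 : ℝ) < (N : ℝ) ^ m := by positivity
  have l1 : (N : ℝ) / (m + 1) ≤ S / N ^ m := by
    rw [div_le_div_iff₀ hm hp]
    calc (N : ℝ) * N ^ m = N ^ (m + 1) := by ring
      _ ≤ _ := by linarith
  have l2 : S / N ^ m ≤ (N : ℝ) / (m + 1) + 1 := by
    rw [div_le_iff₀ hp]
    have : (m + 1) * S ≤ (m + 1) * (((N : ℝ) / (m + 1) + 1) * N ^ m) := by
      have e2 : (m + 1) * (((N : ℝ) / (m + 1) + 1) * N ^ m) = N ^ (m + 1) + (m + 1) * N ^ m := by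
        field_simp
        ring
      rw [e2]; exact k2
    exact le_of_mul_le_mul_left this hm
  constructor <;> linarith

theorem abs_linStat_dicksonPoly_zero_le (m N : ℕ) (hN : 1 ≤ N) :
    |linStat (dicksonPoly (m + 1) N 0) (0 : Fin N → ℤ)| ≤ 1 := by
  have hN0 : (N : ℝ) ≠ 0 := by exact_mod_cast (by omega : N ≠ 0)
  have e : linStat (dicksonPoly (m + 1) N 0) (0 : Fin N → ℤ) =
      (-1) ^ (m + 1) * (∑ j : Fin N, (((j : ℕ) + 1 : ℝ) / N) ^ (m + 1) - N / ((m + 1 : ℕ) + 1)) := by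
    have h1 : ∀ j : Fin N, (dicksonPoly (m + 1) N 0).eval (shiftedCoord (0 : Fin N → ℤ) j) =
        (-1) ^ (m + 1) * ((((j : ℕ) + 1 : ℝ) / N) ^ (m + 1) - 1 / ((m + 1 : ℕ) + 1)) := by
      intro j
      rw [eval_dicksonPoly, Nat.cast_zero, zero_div, dicksonD_zero_right, detTerm, zero_div, sub_zero,
        mul_sub, ← mul_pow]
      congr 2
      simp only [shiftedCoord, Pi.zero_apply]
      field_simp
      push_cast
      ring
    rw [linStat]
    simp only [Algebra.algebraMap_self, RingHom.id_apply, h1]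
    rw [← Finset.mul_sum, Finset.sum_sub_distrib, Finset.sum_const, Finset.card_univ,
      Fintype.card_fin, nsmul_eq_mul]
    ring
  rw [e, abs_mul, abs_pow, abs_neg, abs_one, one_pow, one_mul]
  exact abs_sum_pow_sub_le hN (m + 1)

end Bounds

/-! ### Deviations of the jump averages from their leading terms. -/

section Theta

variable {c : ℝ}

/-- The leading terms of the jump averages of Dickson polynomials. -/
def leadTerm (m : ℕ) : ℝ := if m ≤ 1 then 1 else 0

theorem sum_mul_leadTerm (f : ℕ → ℝ) (m : ℕ) :
    ∑ p ∈ Finset.HasAntidiagonal.antidiagonal m, f p.1 * leadTerm p.2 = f m + shiftSeq f m := by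
  cases m with
  | zero => simp [leadTerm, shiftSeq]
  | succ m =>
    rw [Finset.Nat.sum_antidiagonal_succ']
    cases m with
    | zero => simp [leadTerm, shiftSeq]
    | succ m =>
      rw [Finset.Nat.sum_antidiagonal_succ']
      simp [leadTerm, shiftSeq]

/-- The generating function `1 + w` of `leadTerm` solves `P' = P / (1 + w)`, which is Newton's
recursion with each row average replaced by its leading term. -/
theorem sum_neg_one_mul_leadTerm (m : ℕ) :
    ∑ p ∈ Finset.HasAntidiagonal.antidiagonal m, (-1 : ℝ) ^ p.1 * leadTerm p.2 =
      (m + 1) * leadTerm (m + 1) := by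
  rw [sum_mul_leadTerm (fun k => (-1 : ℝ) ^ k)]
  cases m with
  | zero => simp [leadTerm, shiftSeq]
  | succ m => simp [leadTerm, shiftSeq, pow_succ]

/-- The jump averages of Dickson polynomials of the second kind, shifted by one. -/
noncomputable def swP : ℕ → SWState c → ℝ
  | 0 => 1
  | m + 1 => jump.op (pU m)

/-- The rescaled deviations of `swP` from its leading term. -/
noncomputable def swTheta (m : ℕ) (s : SWState c) : ℝ := s.1.N * (swP m s - leadTerm m)

theorem N_mul_sEps (s : SWState c) : (s.1.N : ℝ) * sEps s = 1 := by
  have := s.1.N_pos.ne'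
  simp only [sEps, sigmaPull_apply, swEps]; field_simp

theorem swP_eq (m : ℕ) (s : SWState c) : swP m s = leadTerm m + sEps s * swTheta m s := by
  rw [swTheta]
  linear_combination -(swP m s - leadTerm m) * N_mul_sEps s

theorem swP_eq_newtonP (m : ℕ) (s : SWState c) :
    swP m s = newtonP (fun i => swY ⟨s, i⟩ - (1 + sTime s)) (swEps s.1) (sTime s) m := by
  cases m with
  | zero => rfl
  | succ m =>
    rw [newton_shift, swP, jump_op_apply]
    refine Finset.sum_congr rfl fun i _ => ?_
    rw [pU, dicksonU_fun_apply]
    congr 2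
    change swY ⟨s, i⟩ - 1 - sTime s = _
    ring

/-- Newton's recursion for jump averages, in terms of empirical averages. -/
theorem swP_rec : ∃ w : ℕ → SWPoint c → ℝ, (∀ k, w k ∈ polyP c) ∧ ∀ m s, (m + 1) * swP (m + 1) s =
    ∑ p ∈ Finset.HasAntidiagonal.antidiagonal m,
      ((p.1 + 1) * empirical.op (pU p.1) s - sEps s * empirical.op (w p.1) s) * swP p.2 s := by
  choose w hw ew using fun k => dicksonD_taylor (polyP c) swX_mem_polyP pTime_mem_polyP
    (neg_mem (one_mem _)) (zero_mem _) pEps_mem_polyP k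
  refine ⟨w, hw, fun m s => ?_⟩
  rw [swP_eq_newtonP, newtonP_rec _ (swY_sub_injective s _)]
  refine Finset.sum_congr rfl fun p _ => ?_
  rw [← swP_eq_newtonP]
  congr 1
  have hx : ∀ j, swX ⟨s, j⟩ = swY ⟨s, j⟩ - (1 + sTime s) := fun j => by
    change swY ⟨s, j⟩ - 1 - sTime s = _
    ring
  have h1 : ∀ j, dicksonD (swY ⟨s, j⟩ - (1 + sTime s)) (sTime s) (p.1 + 1) -
      dicksonD (swY ⟨s, j⟩ - (1 + sTime s) - swEps s.1) (sTime s) (p.1 + 1) =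
      (p.1 + 1) * (sEps s * pU p.1 ⟨s, j⟩) - sEps s ^ 2 * w p.1 ⟨s, j⟩ := by
    intro j
    have h2 := congrFun (ew p.1) ⟨s, j⟩
    simp only [Pi.add_apply, Pi.mul_apply, Pi.pow_apply, Pi.sub_apply, Pi.neg_apply, Pi.one_apply,
      Pi.natCast_apply, dicksonD_fun_apply, Pi.zero_apply] at h2
    rw [hx] at h2
    change dicksonD (_ + sEps s * -1) (sTime s + sEps s * 0) _ = dicksonD _ (sTime s) _ +
      sEps s * ((p.1 + 1) * (-1 * pU p.1 ⟨s, j⟩ - 0 * _)) + sEps s ^ 2 * _ at h2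
    rw [mul_zero, add_zero, mul_neg_one, ← sub_eq_add_neg] at h2
    change _ - dicksonD (_ - sEps s) _ _ = _
    rw [h2]
    ring
  simp only [h1, Finset.sum_sub_distrib, ← Finset.mul_sum]
  rw [empirical_op_apply, empirical_op_apply, ← Finset.mul_sum, ← Finset.mul_sum]
  simp only [sEps, sigmaPull_apply, swEps]
  ring

/-- The recursion for the deviations `swTheta`. -/
theorem swTheta_rec : ∃ w : ℕ → SWPoint c → ℝ, (∀ k, w k ∈ polyP c) ∧ ∀ m s,
    (m + 1) * swTheta (m + 1) s = ∑ p ∈ Finset.HasAntidiagonal.antidiagonal m, (-1) ^ p.1 * swTheta p.2 s +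
      (((m + 1) * swEta m s + m * shiftSeq swEta m s) -
        (empirical.op (w m) s + empirical.op (shiftSeq w m) s)) +
      sEps s * ∑ p ∈ Finset.HasAntidiagonal.antidiagonal m,
        ((p.1 + 1) * swEta p.1 s - empirical.op (w p.1) s) * swTheta p.2 s := by
  obtain ⟨w, hw, h⟩ := swP_rec (c := c)
  refine ⟨w, hw, fun m s => ?_⟩
  set L : ℕ → ℝ := fun a => (a + 1) * swEta a s - empirical.op (w a) s with hL
  have hLm : L m + shiftSeq L m = ((m + 1) * swEta m s + m * shiftSeq swEta m s) -
        (empirical.op (w m) s + empirical.op (shiftSeq w m) s) := by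
    cases m with
    | zero => simp [hL, shiftSeq]
    | succ m => simp only [hL, shiftSeq]; push_cast; ring
  have h1 := h m s
  have h2 : ∀ p : ℕ × ℕ, ((p.1 + 1) * empirical.op (pU p.1) s - sEps s * empirical.op (w p.1) s) *
      swP p.2 s = (-1) ^ p.1 * leadTerm p.2 + sEps s * ((-1) ^ p.1 * swTheta p.2 s) +
        sEps s * (L p.1 * leadTerm p.2) + sEps s * (sEps s * (L p.1 * swTheta p.2 s)) := by
    intro p
    have : (p.1 : ℝ) + 1 ≠ 0 := by positivity
    rw [empirical_pU, swP_eq]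
    simp only [hL]
    field_simp
    ring
  simp only [h2, Finset.sum_add_distrib, ← Finset.mul_sum, sum_neg_one_mul_leadTerm,
    sum_mul_leadTerm] at h1
  rw [← hLm]
  rw [swP_eq] at h1
  linear_combination (s.1.N : ℝ) * h1 + (-(m + 1) * swTheta (m + 1) s +
    ∑ p ∈ Finset.HasAntidiagonal.antidiagonal m, (-1) ^ p.1 * swTheta p.2 s + (L m + shiftSeq L m) +
    sEps s * ∑ p ∈ Finset.HasAntidiagonal.antidiagonal m, L p.1 * swTheta p.2 s) * N_mul_sEps s

theorem shiftSeq_mem {R : Type*} [Ring R] [Algebra ℝ R] (S : Subalgebra ℝ R) {f : ℕ → R} {m : ℕ}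
    (h : ∀ k < m, f k ∈ S) : shiftSeq f m ∈ S := by
  cases m with
  | zero => exact zero_mem _
  | succ m => exact h m (Nat.lt_succ_self m)

theorem swTheta_zero : (swTheta 0 : SWState c → ℝ) = 0 := by
  funext s; simp [swTheta, swP, leadTerm]

theorem swTheta_mem_bddS (m : ℕ) (h : ∀ k < m, (swEta k : SWState c → ℝ) ∈ bddS c) :
    (swTheta m : SWState c → ℝ) ∈ bddS c := by
  induction m using Nat.strong_induction_on with
  | _ m ih =>
    cases m with
    | zero => rw [swTheta_zero]; exact zero_mem _
    | succ m =>
      obtain ⟨w, hw, e⟩ := swTheta_rec (c := c)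
      have hemp : ∀ k, empirical.op (w k) ∈ bddS c := fun k =>
        empirical_mem_bddS (polyP_le_bddP (hw k))
      have hth : ∀ k ≤ m, (swTheta k : SWState c → ℝ) ∈ bddS c := fun k hk =>
        ih k (by omega) fun j hj => h j (by omega)
      have e' : (swTheta (m + 1) : SWState c → ℝ) = ((m + 1 : ℝ)⁻¹) • (
          ∑ p ∈ Finset.HasAntidiagonal.antidiagonal m, ((-1 : ℝ) ^ p.1) • swTheta p.2 +
          (((m + 1 : ℝ) • swEta m + (m : ℝ) • shiftSeq swEta m) -
            (empirical.op (w m) + empirical.op (shiftSeq w m))) +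
          sEps * ∑ p ∈ Finset.HasAntidiagonal.antidiagonal m,
            ((p.1 + 1 : ℝ) • swEta p.1 - empirical.op (w p.1)) * swTheta p.2) := by
        funext s
        have h1 := e m s
        have : (m : ℝ) + 1 ≠ 0 := by positivity
        have hs : (shiftSeq swEta m) s = shiftSeq (fun k => swEta (c := c) k) m s := rfl
        simp only [Pi.smul_apply, smul_eq_mul, Pi.add_apply, Pi.sub_apply, Pi.mul_apply,
          Finset.sum_apply]
        rw [eq_inv_mul_iff_mul_eq₀ this]
        exact h1
      rw [e']
      refine Subalgebra.smul_mem _ (add_mem (add_mem (sum_mem fun p hp => ?_) (sub_mem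
        (add_mem (Subalgebra.smul_mem _ (h m (by omega)) _) (Subalgebra.smul_mem _ ?_ _))
        (add_mem (hemp m) ?_))) (mul_mem sEps_mem_bddS (sum_mem fun p hp => ?_))) _
      · have := Finset.HasAntidiagonal.mem_antidiagonal.1 hp
        exact Subalgebra.smul_mem _ (hth _ (by omega)) _
      · exact shiftSeq_mem _ fun k hk => h k (by omega)
      · refine empirical_mem_bddS (polyP_le_bddP (shiftSeq_mem _ fun k _ => hw k))
      · have := Finset.HasAntidiagonal.mem_antidiagonal.1 hp
        exact mul_mem (sub_mem (Subalgebra.smul_mem _ (h _ (by omega)) _) (hemp _)) (hth _ (by omega))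

/-- The increment and the drift of the centred Dickson statistics. -/
theorem swIncr_dicksonPoly_drift (m : ℕ) : ∃ w ∈ polyP c, ∃ v ∈ polyP c,
    ∃ Z : SWPoint c → ℝ, swIncr (dicksonPoly (m + 1)) = pEps * Z ∧
      Z = ((m + 1 : ℝ) • pU m + (fun _ => if m = 0 then -1 else 0)) + pEps *
        (w - sigmaPull ((m + 1 : ℝ) • (swEta m + shiftSeq swEta m) - sEps * empirical.op v)) ∧
      jump.op Z = sEps * ((m + 1 : ℝ) • (swTheta (m + 1) - swEta m - shiftSeq swEta m) +
        jump.op w + sEps * empirical.op v) := by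
  obtain ⟨w, hw, v, hv, e⟩ := swIncr_dicksonPoly (c := c) m
  refine ⟨w, hw, v, hv, _, ?_, rfl, ?_⟩
  · rw [e]
    have h1 : ((m : SWPoint c → ℝ) + 1) * pU m = (m + 1 : ℝ) • pU m := by
      funext ω; simp
    have h2 : ((m : SWState c → ℝ) + 1) * (swEta m + shiftSeq swEta m) =
        (m + 1 : ℝ) • (swEta m + shiftSeq swEta m) := by
      funext ω; simp
    rw [h1, h2]
    ring
  · have hp : (pEps : SWPoint c → ℝ) = sigmaPull sEps := rfl
    rw [map_add, map_add, map_smul, jump.op_const, hp, jump_op_pull, map_sub, jump_op_pull']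
    funext s
    have h1 : jump.op (pU m) s = leadTerm (m + 1) + sEps s * swTheta (m + 1) s := swP_eq (m + 1) s
    simp only [Pi.add_apply, Pi.smul_apply, smul_eq_mul, Pi.mul_apply, Pi.sub_apply, h1]
    have h2 : ((m : ℝ) + 1) * leadTerm (m + 1) + (if m = 0 then -1 else 0) = 0 := by
      cases m <;> simp [leadTerm]
    linear_combination h2

theorem swH_mem_of_swEta {m : ℕ} (h : ∀ k ≤ m, (swEta k : SWState c → ℝ) ∈ bddS c) :
    (swH (m + 1) : SWState c → ℝ) ∈ bddS c := by
  obtain ⟨w, hw, v, hv, Z, h1, h2, h3⟩ := swIncr_dicksonPoly_drift (c := c) m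
  have hsh : (shiftSeq swEta m : SWState c → ℝ) ∈ bddS c :=
    shiftSeq_mem _ fun k hk => h k hk.le
  have hemp := empirical_mem_bddS (polyP_le_bddP hv)
  refine swStat_mem_bddS (abs_linStat_dicksonPoly_zero_le m) ?_ h1 ?_ h3
  · rw [h2]
    refine add_mem (add_mem (Subalgebra.smul_mem _ (polyP_le_bddP (pU_mem_polyP m)) _)
      ((bddP c).algebraMap_mem _)) (mul_mem pEps_mem_bddP (sub_mem (polyP_le_bddP hw)
        (pull_mem_bddP (sub_mem (Subalgebra.smul_mem _ (add_mem (h m le_rfl) hsh) _)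
          (mul_mem sEps_mem_bddS hemp)))))
  · exact add_mem (add_mem (Subalgebra.smul_mem _ (sub_mem (sub_mem
      (swTheta_mem_bddS _ fun k hk => h k (by omega)) (h m le_rfl)) hsh) _)
        (jump_mem_bddS (polyP_le_bddP hw))) (mul_mem sEps_mem_bddS hemp)

/-- Bootstrap on the degree: `swTheta (m + 1)` involves `swEta` only up to index `m`, and so does
the drift of `swH (m + 1)`; bounded moments therefore pass to `swH (m + 1)`, hence to `swEta (m +
1)`. -/
theorem swEta_mem_bddS (m : ℕ) : (swEta m : SWState c → ℝ) ∈ bddS c := by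
  induction m using Nat.strong_induction_on with
  | _ m ih =>
    match m, ih with
    | 0, _ => exact zero_mem _
    | 1, ih => exact swH_mem_of_swEta fun k hk => ih k (by omega)
    | m + 2, ih =>
      exact add_mem (swH_mem_of_swEta fun k hk => ih k (by omega))
        (mul_mem sTime_mem_bddS (ih m (by omega)))

theorem swTheta_mem (m : ℕ) : (swTheta m : SWState c → ℝ) ∈ bddS c :=
  swTheta_mem_bddS m fun k _ => swEta_mem_bddS k

end Theta

/-! ### Averages that are nearly deterministic, and the cancellation of the random drift. -/

section NearDeterministic

variable {c : ℝ}

/-- Bounded real functions. -/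
def bddFun (X : Type*) : Subalgebra ℝ (X → ℝ) where
  carrier := {d | ∃ C, ∀ a, |d a| ≤ C}
  add_mem' := by
    rintro f g ⟨C, hC⟩ ⟨D, hD⟩
    exact ⟨C + D, fun a => (abs_add_le _ _).trans (add_le_add (hC a) (hD a))⟩
  mul_mem' := by
    rintro f g ⟨C, hC⟩ ⟨D, hD⟩
    refine ⟨C * D, fun a => ?_⟩
    rw [Pi.mul_apply, abs_mul]
    exact mul_le_mul (hC a) (hD a) (abs_nonneg _) ((abs_nonneg _).trans (hC a))
  algebraMap_mem' r := ⟨|r|, fun a => by simp⟩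

theorem swEps_mem_bddFun : swEps ∈ bddFun (SWIndex c) := ⟨1, abs_swEps_le⟩

theorem swTime_mem_bddFun : swTime ∈ bddFun (SWIndex c) := ⟨c, abs_swTime_le⟩

theorem pull_mem_bddS {d : SWIndex c → ℝ} (h : d ∈ bddFun (SWIndex c)) :
    (sigmaPull d : SWState c → ℝ) ∈ bddS c := by
  obtain ⟨C, hC⟩ := h
  exact bounded_mem_bddS hC

theorem expect_mem_bddFun {f : SWState c → ℝ} (h : f ∈ bddS c) : expect.op f ∈ bddFun (SWIndex c) :=
  Averaging.exists_bound_of_mem _ h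

variable (c) in
/-- Functions which are deterministic up to order `1 / N`. -/
noncomputable def nearDet : Subalgebra ℝ (SWState c → ℝ) where
  carrier := {f | ∃ d ∈ bddFun (SWIndex c), ∃ r ∈ bddS c, f = sigmaPull d + sEps * r}
  add_mem' := by
    rintro _ _ ⟨d, hd, r, hr, rfl⟩ ⟨d', hd', r', hr', rfl⟩
    exact ⟨d + d', add_mem hd hd', r + r', add_mem hr hr', by rw [map_add]; ring⟩
  mul_mem' := by
    rintro _ _ ⟨d, hd, r, hr, rfl⟩ ⟨d', hd', r', hr', rfl⟩
    refine ⟨d * d', mul_mem hd hd', sigmaPull d * r' + r * sigmaPull d' + sEps * (r * r'), ?_, ?_⟩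
    · exact add_mem (add_mem (mul_mem (pull_mem_bddS hd) hr') (mul_mem hr (pull_mem_bddS hd')))
        (mul_mem sEps_mem_bddS (mul_mem hr hr'))
    · rw [map_mul]; ring
  algebraMap_mem' r := ⟨_, (bddFun _).algebraMap_mem r, 0, zero_mem _, by rw [mul_zero, add_zero]; rfl⟩

theorem pull_mem_nearDet {d : SWIndex c → ℝ} (h : d ∈ bddFun (SWIndex c)) :
    (sigmaPull d : SWState c → ℝ) ∈ nearDet c := ⟨d, h, 0, zero_mem _, by rw [mul_zero, add_zero]⟩

theorem sEps_mul_mem_nearDet {r : SWState c → ℝ} (h : r ∈ bddS c) : sEps * r ∈ nearDet c :=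
  ⟨0, zero_mem _, r, h, by rw [map_zero, zero_add]⟩

theorem sEps_mem_nearDet : (sEps : SWState c → ℝ) ∈ nearDet c := pull_mem_nearDet swEps_mem_bddFun

theorem sTime_mem_nearDet : (sTime : SWState c → ℝ) ∈ nearDet c := pull_mem_nearDet swTime_mem_bddFun

theorem empirical_pU_mem (m : ℕ) : empirical.op (pU m) ∈ nearDet c := by
  have : empirical.op (pU m) = (fun _ : SWState c => (-1 : ℝ) ^ m / (m + 1)) + sEps * swEta m :=
    funext fun s => empirical_pU m s
  rw [this]
  exact add_mem ((nearDet c).algebraMap_mem _) (sEps_mul_mem_nearDet (swEta_mem_bddS m))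

theorem jump_pU (m : ℕ) :
    jump.op (pU m) = (fun _ : SWState c => leadTerm (m + 1)) + sEps * swTheta (m + 1) :=
  funext fun s => swP_eq (m + 1) s

theorem jump_pU_mem (m : ℕ) : jump.op (pU m) ∈ nearDet c := by
  rw [jump_pU]
  exact add_mem ((nearDet c).algebraMap_mem _) (sEps_mul_mem_nearDet (swTheta_mem _))

/-- Averages of polynomials are deterministic up to order `1 / N`. -/
theorem averages_mem_nearDet {Z : SWPoint c → ℝ} (hZ : Z ∈ polyP c) :
    empirical.op Z ∈ nearDet c ∧ jump.op Z ∈ nearDet c := by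
  -- Multiplication by `x` preserves `G` by the three-term recurrence of the `U_j`, and so does
  -- multiplication by near-deterministic functions of the state. All of `polyP c` therefore maps `1
  -- ∈ G` into `G`.
  let G : AddSubgroup (SWPoint c → ℝ) :=
    { carrier := {Y | ∀ j, empirical.op (Y * pU j) ∈ nearDet c ∧ jump.op (Y * pU j) ∈ nearDet c}
      add_mem' := fun {a b} ha hb j => by
        rw [add_mul, map_add, map_add]
        exact ⟨add_mem (ha j).1 (hb j).1, add_mem (ha j).2 (hb j).2⟩
      zero_mem' := fun j => by rw [zero_mul, map_zero, map_zero]; exact ⟨zero_mem _, zero_mem _⟩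
      neg_mem' := fun {a} ha j => by
        rw [neg_mul, map_neg, map_neg]; exact ⟨neg_mem (ha j).1, neg_mem (ha j).2⟩ }
  have hpull : ∀ f ∈ nearDet c, ∀ Y ∈ G, sigmaPull f * Y ∈ G := fun f hf Y hY j => by
    rw [mul_assoc, empirical_op_pull, jump_op_pull]
    exact ⟨mul_mem hf (hY j).1, mul_mem hf (hY j).2⟩
  let S : Subalgebra ℝ (SWPoint c → ℝ) :=
    { carrier := {W | ∀ Y ∈ G, W * Y ∈ G}
      add_mem' := fun {a b} ha hb Y hY => by rw [add_mul]; exact add_mem (ha Y hY) (hb Y hY)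
      mul_mem' := fun {a b} ha hb Y hY => by rw [mul_assoc]; exact ha _ (hb Y hY)
      algebraMap_mem' := fun r Y hY => hpull _ ((nearDet c).algebraMap_mem r) Y hY }
  have hS : polyP c ≤ S := by
    refine Algebra.adjoin_le ?_
    rintro f (rfl | rfl | rfl)
    · intro Y hY j
      cases j with
      | zero =>
        have e : swX * Y * pU 0 = Y * pU 1 := by
          change swX * Y * 1 = Y * swX; ring
        rw [e]; exact hY 1
      | succ j =>
        have e : swX * Y * pU (j + 1) = Y * pU (j + 2) + sigmaPull sTime * (Y * pU j) := by
          have : (pU (j + 2) : SWPoint c → ℝ) = swX * pU (j + 1) - sigmaPull sTime * pU j := rfl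
          rw [this]; ring
        rw [e, map_add, map_add, empirical_op_pull, jump_op_pull]
        exact ⟨add_mem (hY _).1 (mul_mem sTime_mem_nearDet (hY _).1),
          add_mem (hY _).2 (mul_mem sTime_mem_nearDet (hY _).2)⟩
    · exact fun Y hY => hpull _ sTime_mem_nearDet Y hY
    · exact fun Y hY => hpull _ sEps_mem_nearDet Y hY
  have h1 : (1 : SWPoint c → ℝ) ∈ G := fun j => by
    rw [one_mul]; exact ⟨empirical_pU_mem j, jump_pU_mem j⟩
  have h2 := hS hZ 1 h1 0
  have e : Z * 1 * pU 0 = Z := by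
    change Z * 1 * 1 = Z; ring
  rwa [e] at h2

/-- The decisive cancellation. Modulo `nearDet`, the recursion reads `(m + 1) θ_{m+1} = T_m + (m +
1) η_m + m η_{m-1}` with `T_m = ∑ (-1)^a θ_b` over `a + b = m`, and `T_{m+1} = θ_{m+1} - T_m`. Its
solution is `T_m = η_{m-1}`, `θ_{m+1} = η_m + η_{m-1}`, which is exactly the combination subtracted
in the drift of the Dickson statistics. -/
theorem swTheta_sub_mem (m : ℕ) :
    (swTheta (m + 1) - swEta m - shiftSeq swEta m : SWState c → ℝ) ∈ nearDet c ∧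
    (∑ p ∈ Finset.HasAntidiagonal.antidiagonal m, ((-1 : ℝ) ^ p.1) • swTheta p.2 - shiftSeq swEta m :
      SWState c → ℝ) ∈ nearDet c := by
  obtain ⟨w, hw, e⟩ := swTheta_rec (c := c)
  have step : ∀ m, (∑ p ∈ Finset.HasAntidiagonal.antidiagonal m, ((-1 : ℝ) ^ p.1) • swTheta p.2 -
      shiftSeq swEta m : SWState c → ℝ) ∈ nearDet c →
      (swTheta (m + 1) - swEta m - shiftSeq swEta m : SWState c → ℝ) ∈ nearDet c := by
    intro m hm
    have e' : (swTheta (m + 1) - swEta m - shiftSeq swEta m : SWState c → ℝ) = ((m + 1 : ℝ)⁻¹) • (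
        (∑ p ∈ Finset.HasAntidiagonal.antidiagonal m, ((-1 : ℝ) ^ p.1) • swTheta p.2 -
          shiftSeq swEta m) - (empirical.op (w m) + empirical.op (shiftSeq w m)) +
        sEps * ∑ p ∈ Finset.HasAntidiagonal.antidiagonal m,
          ((p.1 + 1 : ℝ) • swEta p.1 - empirical.op (w p.1)) * swTheta p.2) := by
      funext s
      have h1 := e m s
      have h0 : (m : ℝ) + 1 ≠ 0 := by positivity
      simp only [Pi.smul_apply, smul_eq_mul, Pi.add_apply, Pi.sub_apply, Pi.mul_apply,
        Finset.sum_apply]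
      rw [eq_inv_mul_iff_mul_eq₀ h0]
      linear_combination h1
    rw [e']
    refine Subalgebra.smul_mem _ (add_mem (sub_mem hm (add_mem (averages_mem_nearDet (hw m)).1
      (averages_mem_nearDet (shiftSeq_mem _ fun k _ => hw k)).1)) (sEps_mul_mem_nearDet
        (sum_mem fun p _ => mul_mem (sub_mem (Subalgebra.smul_mem _ (swEta_mem_bddS _) _)
          (empirical_mem_bddS (polyP_le_bddP (hw _)))) (swTheta_mem _)))) _
  have hT : (∑ p ∈ Finset.HasAntidiagonal.antidiagonal m, ((-1 : ℝ) ^ p.1) • swTheta p.2 -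
      shiftSeq swEta m : SWState c → ℝ) ∈ nearDet c := by
    induction m with
    | zero =>
      have : (∑ p ∈ Finset.HasAntidiagonal.antidiagonal 0, ((-1 : ℝ) ^ p.1) • swTheta p.2 -
        shiftSeq swEta 0 : SWState c → ℝ) = 0 := by simp [swTheta_zero, shiftSeq]
      rw [this]; exact zero_mem _
    | succ m ih =>
      have h1 := step m ih
      have e2 : (∑ p ∈ Finset.HasAntidiagonal.antidiagonal (m + 1), ((-1 : ℝ) ^ p.1) • swTheta p.2 -
          shiftSeq swEta (m + 1) : SWState c → ℝ) =
          (swTheta (m + 1) - swEta m - shiftSeq swEta m) -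
          (∑ p ∈ Finset.HasAntidiagonal.antidiagonal m, ((-1 : ℝ) ^ p.1) • swTheta p.2 -
            shiftSeq swEta m) := by
        have h3 : (shiftSeq swEta (m + 1) : SWState c → ℝ) = swEta m := rfl
        rw [Finset.Nat.sum_antidiagonal_succ, h3]
        simp only [pow_succ, pow_zero, one_smul, mul_neg_one, neg_smul, Finset.sum_neg_distrib]
        abel
      rw [e2]
      exact sub_mem h1 ih
  exact ⟨step m hT, hT⟩

/-- The jump averages of products of Dickson polynomials of the second kind. -/
theorem jump_pU_mul_pU (a b : ℕ) : ∃ r ∈ bddS c,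
    jump.op (pU a * pU b) = (if a = b then sTime ^ a else 0) + sEps * r := by
  have h0 : ∀ b, ∃ r ∈ bddS c, jump.op (pU b) =
      (if 0 = b then 1 else 0 : SWState c → ℝ) + sEps * r := by
    intro b
    refine ⟨swTheta (b + 1), swTheta_mem _, ?_⟩
    rw [jump_pU]
    congr 1
    cases b
    · funext s; simp [leadTerm]
    · funext s; simp [leadTerm]
  have hrec : ∀ j, (pU (j + 2) : SWPoint c → ℝ) = swX * pU (j + 1) - sigmaPull sTime * pU j :=
    fun _ => rfl
  have hx : ∀ j, (swX * pU (j + 1) : SWPoint c → ℝ) = pU (j + 2) + sigmaPull sTime * pU j :=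
    fun j => by rw [hrec]; ring
  induction a using Nat.twoStepInduction generalizing b with
  | zero =>
    have : (pU 0 * pU b : SWPoint c → ℝ) = pU b := one_mul _
    rw [this, pow_zero]; exact h0 b
  | one =>
    cases b with
    | zero =>
      have : (pU 1 * pU 0 : SWPoint c → ℝ) = pU 1 := mul_one _
      rw [this]
      obtain ⟨r, hr, e⟩ := h0 1
      exact ⟨r, hr, by rw [e]; simp⟩
    | succ b =>
      have : (pU 1 * pU (b + 1) : SWPoint c → ℝ) = pU (b + 2) + sigmaPull sTime * pU b := hx b
      rw [this, map_add, jump_op_pull]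
      obtain ⟨r, hr, e⟩ := h0 (b + 2)
      obtain ⟨r', hr', e'⟩ := h0 b
      refine ⟨r + sTime * r', add_mem hr (mul_mem sTime_mem_bddS hr'), ?_⟩
      rw [e, e']
      by_cases hb : b = 0
      · subst hb; simp; ring
      · have h1 : ¬ 0 = b := fun h => hb h.symm
        simp [h1, hb]; ring
  | more a ih1 ih2 =>
    cases b with
    | zero =>
      have : (pU (a + 2) * pU 0 : SWPoint c → ℝ) = pU (a + 2) := mul_one _
      rw [this]
      obtain ⟨r, hr, e⟩ := h0 (a + 2)
      exact ⟨r, hr, by rw [e]; simp⟩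
    | succ b =>
      -- The factor `x` supplied by the recurrence in `a` is absorbed by the recurrence in `b`,
      -- which lowers `a`.
      have : (pU (a + 2) * pU (b + 1) : SWPoint c → ℝ) = pU (a + 1) * pU (b + 2) +
          sigmaPull sTime * (pU (a + 1) * pU b) - sigmaPull sTime * (pU a * pU (b + 1)) := by
        rw [hrec]
        linear_combination (pU (a + 1)) * hx b
      rw [this, map_sub, map_add, jump_op_pull, jump_op_pull]
      obtain ⟨r1, hr1, e1⟩ := ih2 (b + 2)
      obtain ⟨r2, hr2, e2⟩ := ih2 b
      obtain ⟨r3, hr3, e3⟩ := ih1 (b + 1)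
      refine ⟨r1 + sTime * r2 - sTime * r3, sub_mem (add_mem hr1 (mul_mem sTime_mem_bddS hr2))
        (mul_mem sTime_mem_bddS hr3), ?_⟩
      rw [e1, e2, e3]
      by_cases c1 : a + 1 = b
      · subst c1
        have c2 : ¬ a + 1 = a + 1 + 2 := by omega
        have c3 : ¬ a = a + 1 + 1 := by omega
        simp only [if_true, c2, c3, if_false, if_pos (show a + 2 = a + 1 + 1 from rfl)]
        ring
      · have c4 : ¬ a + 2 = b + 1 := by omega
        by_cases c2 : a + 1 = b + 2
        · have c3 : a = b + 1 := by omega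
          subst c3
          have c5 : ¬ b + 1 + 1 = b := by omega
          simp only [if_true, c4, c5, if_false]
          ring
        · have c3 : ¬ a = b + 1 := by omega
          simp only [c1, c2, c3, c4, if_false]
          ring

/-- The increments of the centred Dickson statistics: drift and orthogonality. -/
theorem swIncr_dicksonPoly_nearDet (m : ℕ) : ∃ Z ∈ bddP c, swIncr (dicksonPoly (m + 1)) = pEps * Z ∧
    (∃ d ∈ nearDet c, jump.op Z = sEps * d) ∧
    ∃ r ∈ bddP c, Z = ((m + 1 : ℝ) • pU m + (fun _ => if m = 0 then -1 else 0)) + pEps * r := by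
  obtain ⟨w, hw, v, hv, Z, h1, h2, h3⟩ := swIncr_dicksonPoly_drift (c := c) m
  have hsh : (shiftSeq swEta m : SWState c → ℝ) ∈ bddS c :=
    shiftSeq_mem _ fun k hk => swEta_mem_bddS k
  have hemp := empirical_mem_bddS (polyP_le_bddP hv)
  have hr : w - sigmaPull ((m + 1 : ℝ) • (swEta m + shiftSeq swEta m) - sEps * empirical.op v) ∈
      bddP c := sub_mem (polyP_le_bddP hw)
        (pull_mem_bddP (sub_mem (Subalgebra.smul_mem _ (add_mem (swEta_mem_bddS m) hsh) _)
          (mul_mem sEps_mem_bddS hemp)))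
  refine ⟨Z, ?_, h1, ⟨_, ?_, h3⟩, _, hr, h2⟩
  · rw [h2]
    exact add_mem (add_mem (Subalgebra.smul_mem _ (polyP_le_bddP (pU_mem_polyP m)) _)
      ((bddP c).algebraMap_mem _)) (mul_mem pEps_mem_bddP hr)
  · exact add_mem (add_mem (Subalgebra.smul_mem _ (swTheta_sub_mem m).1 _)
      (averages_mem_nearDet hw).2) (mul_mem sEps_mem_nearDet (averages_mem_nearDet hv).1)

end NearDeterministic

/-! ### Gaussian moments as functions of the variance. -/

section GaussMoments

variable {R : Type*} [CommRing R]

/-- The moments of a centred Gaussian of variance `v`. -/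
def gaussMom (v : R) : ℕ → R
  | 0 => 1
  | 1 => 0
  | r + 2 => ((r + 1 : ℕ) : R) * v * gaussMom v r

theorem map_gaussMom {S : Type*} [CommRing S] (f : R →+* S) (v : R) (r : ℕ) :
    f (gaussMom v r) = gaussMom (f v) r := by
  induction r using Nat.twoStepInduction with
  | zero => simp [gaussMom]
  | one => simp [gaussMom]
  | more r h1 _ => simp [gaussMom, h1]

variable [Algebra ℝ R] (S : Subalgebra ℝ R)

theorem gaussMom_mem {v : R} (hv : v ∈ S) (r : ℕ) : gaussMom v r ∈ S := by
  induction r using Nat.twoStepInduction with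
  | zero => exact one_mem _
  | one => exact zero_mem _
  | more r h1 _ => exact mul_mem (mul_mem (natCast_mem _ _) hv) h1

theorem add_mul_pow_expansion {x e z : R} (hx : x ∈ S) (he : e ∈ S) (hz : z ∈ S) (q : ℕ) :
    ∃ w ∈ S, (x + e * z) ^ (q + 2) = x ^ (q + 2) + ((q + 2 : ℕ) : R) * x ^ (q + 1) * (e * z) +
      (((q + 2).choose 2 : ℕ) : R) * x ^ q * (e * z) ^ 2 + e ^ 3 * w := by
  induction q with
  | zero => exact ⟨0, zero_mem _, by push_cast; simp; ring⟩
  | succ q ih =>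
    obtain ⟨w, hw, e1⟩ := ih
    refine ⟨(x + e * z) * w + (((q + 2).choose 2 : ℕ) : R) * x ^ q * z ^ 3, add_mem (mul_mem
      (add_mem hx (mul_mem he hz)) hw) (mul_mem (mul_mem (natCast_mem _ _) (pow_mem hx _))
        (pow_mem hz _)), ?_⟩
    have h2 : (q + 1 + 2).choose 2 = (q + 2) + (q + 2).choose 2 := by
      rw [show q + 1 + 2 = (q + 2) + 1 from rfl, Nat.choose_succ_succ' (q + 2) 1, Nat.choose_one_right]
    rw [pow_succ, show q + 1 + 1 = q + 2 from rfl, e1, h2]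
    push_cast
    ring

/-- Heat equation: the derivative in the variance of the moment of order `r` is `r.choose 2` times
the moment of order `r - 2`. -/
theorem gaussMom_expansion {v δ : R} (hv : v ∈ S) (hδ : δ ∈ S) (q : ℕ) :
    ∃ w ∈ S, gaussMom (v + δ) (q + 2) = gaussMom v (q + 2) +
      (((q + 2).choose 2 : ℕ) : R) * gaussMom v q * δ + δ ^ 2 * w := by
  induction q using Nat.twoStepInduction with
  | zero => exact ⟨0, zero_mem _, by simp [gaussMom]⟩
  | one => exact ⟨0, zero_mem _, by simp [gaussMom]⟩
  | more q ih _ =>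
    obtain ⟨w, hw, e1⟩ := ih
    have hF := gaussMom_mem S hv q
    refine ⟨((q + 3 : ℕ) : R) * ((v + δ) * w + (((q + 2).choose 2 : ℕ) : R) * gaussMom v q),
      mul_mem (natCast_mem _ _) (add_mem (mul_mem (add_mem hv hδ) hw)
        (mul_mem (natCast_mem _ _) hF)), ?_⟩
    have hd : ∀ v : R, gaussMom v (q + 2 + 2) = ((q + 3 : ℕ) : R) * v * gaussMom v (q + 2) :=
      fun _ => rfl
    have hd2 : gaussMom v (q + 2) = ((q + 1 : ℕ) : R) * v * gaussMom v q := rfl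
    have hc : (q + 3) * ((q + 2).choose 2 + (q + 1)) = (q + 2 + 2).choose 2 * (q + 1) := by
      have : ((q + 3 : ℝ)) * (((q + 2).choose 2 : ℕ) + (q + 1)) = ((q + 2 + 2).choose 2 : ℕ) * (q + 1) := by
        rw [Nat.cast_choose_two, Nat.cast_choose_two]; push_cast; ring
      exact_mod_cast this
    have hc' : ((q + 3 : ℕ) : R) * ((((q + 2).choose 2 : ℕ) : R) + ((q + 1 : ℕ) : R)) =
        (((q + 2 + 2).choose 2 : ℕ) : R) * ((q + 1 : ℕ) : R) := by exact_mod_cast congrArg _ hc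
    rw [hd, hd, e1, hd2]
    linear_combination v * gaussMom v q * δ * hc'

end GaussMoments

/-! ### The method of moments for one centred statistic. -/

section AbstractCLT

variable {c : ℝ}

/-- Errors of order `N⁻³` accumulated over at most `c N²` steps are of order `N⁻¹`. -/
theorem abs_le_of_increments {D : SWIndex c → ℝ} {K : ℝ} (h0 : ∀ a : SWIndex c, a.n = 0 → D a = 0)
    (hs : ∀ (a : SWIndex c) h, |D (a.succ h) - D a| ≤ K * swEps a ^ 3) :
    ∃ C, ∀ a, |D a| ≤ C * swEps a := by
  have key : ∀ a : SWIndex c, |D a| ≤ |K| * swEps a * swTime a := by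
    refine SWIndex.induction (fun a ha => ?_) (fun a h ih => ?_)
    · rw [h0 a ha, swTime_zero ha]; simp
    · rw [swTime_succ, swEps_succ]
      have h1 : |D (a.succ h)| ≤ |D (a.succ h) - D a| + |D a| := by
        have := abs_add_le (D (a.succ h) - D a) (D a)
        rwa [sub_add_cancel] at this
      have h2 : K * swEps a ^ 3 ≤ |K| * swEps a ^ 3 :=
        mul_le_mul_of_nonneg_right (le_abs_self K) (pow_nonneg (swEps_pos a).le _)
      have := hs a h
      calc _ ≤ |K| * swEps a ^ 3 + |K| * swEps a * swTime a := by linarith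
        _ = _ := by ring
  refine ⟨|K| * c, fun a => (key a).trans ?_⟩
  have := mul_le_mul_of_nonneg_left (swTime_le a) (mul_nonneg (abs_nonneg K) (swEps_pos a).le)
  linarith

/-- Moment asymptotics for a centred family of linear statistics. -/
theorem exists_gaussMom_bound {Φ : ℕ → ℕ → Polynomial ℝ} {Z : SWPoint c → ℝ} {r₁ r₂ : SWState c → ℝ}
    {σ v ρ : SWIndex c → ℝ} (hZ : Z ∈ bddP c) (hΔ : swIncr Φ = pEps * Z) (hr₁ : r₁ ∈ bddS c)
    (hQ₁ : jump.op Z = sEps ^ 2 * r₁) (hr₂ : r₂ ∈ bddS c)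
    (hQ₂ : jump.op (Z ^ 2) = sigmaPull σ + sEps * r₂) (hσ : σ ∈ bddFun (SWIndex c))
    (h0 : ∀ N : ℕ, 1 ≤ N → linStat (Φ N 0) (0 : Fin N → ℤ) = 0)
    (hv : v ∈ bddFun (SWIndex c)) (hv0 : ∀ a : SWIndex c, a.n = 0 → v a = 0)
    (hρ : ρ ∈ bddFun (SWIndex c))
    (hvs : ∀ (a : SWIndex c) h, v (a.succ h) = v a + swEps a ^ 2 * σ a + swEps a ^ 3 * ρ a) (r : ℕ) :
    ∃ C, ∀ a : SWIndex c, |expect.op (swStat Φ ^ r) a - gaussMom (v a) r| ≤ C * swEps a := by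
  have hX : (swStat Φ : SWState c → ℝ) ∈ bddS c := by
    refine swStat_mem_bddS (B := 0) (fun N hN => by rw [h0 N hN, abs_zero]) hZ hΔ
      (mul_mem sEps_mem_bddS hr₁) ?_
    rw [hQ₁, sq, mul_assoc]
  have hp : (pEps : SWPoint c → ℝ) = sigmaPull sEps := rfl
  have hps : (sEps : SWState c → ℝ) = sigmaPull swEps := rfl
  have hE := swEps_mem_bddFun (c := c)
  induction r using Nat.twoStepInduction with
  | zero =>
    refine ⟨0, fun a => ?_⟩
    rw [pow_zero, expect.one]; simp [gaussMom]
  | one =>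
    obtain ⟨K, hK⟩ := expect_mem_bddFun hr₁
    refine abs_le_of_increments (K := K) (fun a ha => ?_) (fun a h => ?_)
    · rw [expect_zero _ _ ha, h0 a.N a.one_le]; simp [gaussMom]
    · rw [expect_succ, pow_one, pow_one, hΔ, map_add, jump_op_pull', hp, jump_op_pull, hQ₁]
      have e : sEps * (sEps ^ 2 * r₁) = sigmaPull (swEps ^ 3) * r₁ := by rw [hps, map_pow]; ring
      rw [e, map_add, expect_op_pull]
      simp only [gaussMom, sub_zero, Pi.add_apply, Pi.mul_apply, Pi.pow_apply, add_sub_cancel_left]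
      rw [abs_mul, abs_pow, abs_of_pos (swEps_pos a), mul_comm]
      exact mul_le_mul_of_nonneg_right (hK a) (pow_nonneg (swEps_pos a).le _)
  | more q ih _ =>
    obtain ⟨Cq, hCq⟩ := ih
    obtain ⟨w, hw, ew⟩ := add_mul_pow_expansion (bddP c) (pull_mem_bddP hX) pEps_mem_bddP hZ q
    -- The variance gained in one step. Up to `N⁻³`, both the moment of order `q + 2` and its
    -- Gaussian counterpart grow by `(q + 2).choose 2` times `N⁻² σ` times the moment of order `q`,
    -- and the induction hypothesis compares the latter. The first-order term is itself of order
    -- `N⁻³` by the hypothesis on the drift.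
    set δ : SWIndex c → ℝ := swEps ^ 2 * (σ + swEps * ρ) with hδ
    have hδb : δ ∈ bddFun (SWIndex c) := mul_mem (pow_mem hE 2) (add_mem hσ (mul_mem hE hρ))
    obtain ⟨w', hw', ew'⟩ := gaussMom_expansion (bddFun (SWIndex c)) hv hδb q
    have hgm : ∀ (u : SWIndex c → ℝ) k a, gaussMom u k a = gaussMom (u a) k := fun u k a =>
      map_gaussMom (Pi.evalRingHom (fun _ : SWIndex c => ℝ) a) u k
    set T : ℝ := (((q + 2).choose 2 : ℕ) : ℝ) with hT
    set rr : SWState c → ℝ := ((q + 2 : ℕ) : SWState c → ℝ) * swStat Φ ^ (q + 1) * r₁ +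
      T • (swStat Φ ^ q * r₂) + jump.op w with hrr
    have hrrb : rr ∈ bddS c := add_mem (add_mem (mul_mem (mul_mem (natCast_mem _ _) (pow_mem hX _)) hr₁)
      (Subalgebra.smul_mem _ (mul_mem (pow_mem hX _) hr₂) _)) (jump_mem_bddS hw)
    have hstep : jump.op ((sigmaPull (swStat Φ) + swIncr Φ) ^ (q + 2)) = swStat Φ ^ (q + 2) +
        sigmaPull (T • (swEps ^ 2 * σ)) * swStat Φ ^ q + sigmaPull (swEps ^ 3) * rr := by
      have e2 : (sigmaPull (swStat Φ) ^ (q + 2) + ((q + 2 : ℕ) : SWPoint c → ℝ) *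
          sigmaPull (swStat Φ) ^ (q + 1) * (pEps * Z) + (((q + 2).choose 2 : ℕ) : SWPoint c → ℝ) *
          sigmaPull (swStat Φ) ^ q * (pEps * Z) ^ 2 + pEps ^ 3 * w : SWPoint c → ℝ) =
          sigmaPull (swStat Φ ^ (q + 2)) +
          sigmaPull (((q + 2 : ℕ) : SWState c → ℝ) * swStat Φ ^ (q + 1) * sEps) * Z +
          sigmaPull ((((q + 2).choose 2 : ℕ) : SWState c → ℝ) * swStat Φ ^ q * sEps ^ 2) * Z ^ 2 +
          sigmaPull (sEps ^ 3) * w := by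
        rw [hp]; simp only [map_mul, map_pow, map_natCast]; ring
      rw [hΔ, ew, e2]
      simp only [map_add, jump_op_pull, jump_op_pull', hQ₁, hQ₂]
      funext s
      simp only [hrr, hT, map_smul, map_mul, map_pow, ← hps, Pi.add_apply, Pi.mul_apply, Pi.pow_apply,
        Pi.smul_apply, smul_eq_mul, Pi.natCast_apply]
      ring
    have hb : expect.op rr - T • (gaussMom v q * ρ) - swEps * (σ + swEps * ρ) ^ 2 * w' ∈
        bddFun (SWIndex c) := sub_mem (sub_mem (expect_mem_bddFun hrrb)
          (Subalgebra.smul_mem _ (mul_mem (gaussMom_mem _ hv q) hρ) _))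
          (mul_mem (mul_mem hE (pow_mem (add_mem hσ (mul_mem hE hρ)) 2)) hw')
    obtain ⟨B, hB⟩ := hb
    obtain ⟨Bσ, hBσ⟩ := hσ
    refine abs_le_of_increments (K := T * Bσ * |Cq| + B) (fun a ha => ?_) (fun a h => ?_)
    · rw [expect_zero _ _ ha, h0 a.N a.one_le, hv0 a ha]; simp [gaussMom]
    · have he := swEps_pos a
      rw [expect_succ, hstep, map_add, map_add, expect_op_pull, expect_op_pull]
      have e3 : gaussMom (v (a.succ h)) (q + 2) = gaussMom (v a) (q + 2) +
          T * gaussMom (v a) q * (swEps a ^ 2 * (σ a + swEps a * ρ a)) +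
            (swEps a ^ 2 * (σ a + swEps a * ρ a)) ^ 2 * w' a := by
        have e4 : v (a.succ h) = (v + δ) a := by
          rw [hvs]; simp only [hδ, Pi.add_apply, Pi.mul_apply, Pi.pow_apply]; ring
        rw [e4, ← hgm, ew']
        simp only [Pi.add_apply, Pi.mul_apply, Pi.pow_apply, hgm, Pi.natCast_apply, hδ, hT]
      rw [e3]
      simp only [Pi.add_apply, Pi.mul_apply, Pi.pow_apply, Pi.smul_apply, smul_eq_mul]
      have hBa := hB a
      simp only [Pi.sub_apply, Pi.add_apply, Pi.mul_apply, Pi.pow_apply, Pi.smul_apply, smul_eq_mul,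
        hgm] at hBa
      set u := expect.op (swStat Φ ^ q) a - gaussMom (v a) q with hu
      set b := expect.op rr a - T * (gaussMom (v a) q * ρ a) -
        swEps a * (σ a + swEps a * ρ a) ^ 2 * w' a with hb
      have e5 : expect.op (swStat Φ ^ (q + 2)) a + T * (swEps a ^ 2 * σ a) *
          expect.op (swStat Φ ^ q) a + swEps a ^ 3 * expect.op rr a -
          (gaussMom (v a) (q + 2) + T * gaussMom (v a) q * (swEps a ^ 2 * (σ a + swEps a * ρ a)) +
            (swEps a ^ 2 * (σ a + swEps a * ρ a)) ^ 2 * w' a) -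
          (expect.op (swStat Φ ^ (q + 2)) a - gaussMom (v a) (q + 2)) =
          T * swEps a ^ 2 * σ a * u + swEps a ^ 3 * b := by rw [hu, hb]; ring
      rw [e5]
      have hT0 : 0 ≤ T := by rw [hT]; positivity
      have hu' : |u| ≤ |Cq| * swEps a :=
        (hCq a).trans (mul_le_mul_of_nonneg_right (le_abs_self _) he.le)
      have hσa := hBσ a
      have hBσ0 : 0 ≤ Bσ := (abs_nonneg _).trans hσa
      calc |T * swEps a ^ 2 * σ a * u + swEps a ^ 3 * b|
          ≤ |T * swEps a ^ 2 * σ a * u| + |swEps a ^ 3 * b| := abs_add_le _ _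
        _ = T * swEps a ^ 2 * |σ a| * |u| + swEps a ^ 3 * |b| := by
            simp only [abs_mul, abs_pow, abs_of_pos he, abs_of_nonneg hT0]
        _ ≤ T * swEps a ^ 2 * Bσ * (|Cq| * swEps a) + swEps a ^ 3 * B := by gcongr
        _ = _ := by ring

end AbstractCLT

/-! ### Centred linear combinations of the Dickson statistics. -/

section Centering

variable {c : ℝ}

/-- The family of linear statistics `Ψ`, centred. -/
noncomputable def centredPoly (Ψ : ℕ → ℕ → Polynomial ℝ) (N n : ℕ) : Polynomial ℝ :=
  Ψ N n - Polynomial.C (1 / (N : ℝ) * ∫ lam, linStat (Ψ N n) lam.1 ∂(schurWeylMeasure N n))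

theorem linStat_centredPoly (Ψ : ℕ → ℕ → Polynomial ℝ) {N : ℕ} (hN : 1 ≤ N) (n : ℕ) (lam : Fin N → ℤ) :
    linStat (centredPoly Ψ N n) lam = linStat (Ψ N n) lam -
      ∫ lam, linStat (Ψ N n) lam.1 ∂(schurWeylMeasure N n) := by
  have hN0 : (N : ℝ) ≠ 0 := by exact_mod_cast (by omega : N ≠ 0)
  have h : ∀ (φ : Polynomial ℝ) (r : ℝ), linStat (φ - Polynomial.C (1 / (N : ℝ) * r)) lam =
      linStat φ lam - r := by
    intro φ r
    simp only [linStat, Polynomial.eval_sub, Polynomial.eval_C, Finset.sum_sub_distrib,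
      Finset.sum_const, Finset.card_univ, Fintype.card_fin, nsmul_eq_mul]
    field_simp
  exact h _ _

theorem linStat_centredPoly_zero (Ψ : ℕ → ℕ → Polynomial ℝ) {N : ℕ} (hN : 1 ≤ N) :
    linStat (centredPoly Ψ N 0) (0 : Fin N → ℤ) = 0 := by
  have h := integral_linStat_zero hN (Ψ N 0) 1
  simp only [pow_one] at h
  rw [linStat_centredPoly Ψ hN, h, sub_self]

theorem swStat_centredPoly (Ψ : ℕ → ℕ → Polynomial ℝ) : (swStat (centredPoly Ψ) : SWState c → ℝ) =
    swStat Ψ - sigmaPull (expect.op (swStat Ψ)) :=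
  funext fun s => linStat_centredPoly Ψ s.1.one_le _ _

/-- By the one-step identity, the centring constants at consecutive times differ by the mean drift.
-/
theorem swIncr_centredPoly (Ψ : ℕ → ℕ → Polynomial ℝ) : (swIncr (centredPoly Ψ) : SWPoint c → ℝ) =
    swIncr Ψ - sigmaPull (sigmaPull (expect.op (jump.op (swIncr Ψ)))) := by
  funext ω
  have h := integral_linStat_succ ω.1.1.one_le (Ψ ω.1.1.N (ω.1.1.n + 1)) ω.1.1.n 1
  have h2 : expect.op (jump.op (sigmaPull (swStat Ψ) + swIncr Ψ)) ω.1.1 =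
      ∫ lam, linStat (Ψ ω.1.1.N (ω.1.1.n + 1)) lam.1
        ∂(schurWeylMeasure ω.1.1.N (ω.1.1.n + 1)) := by
    simp only [pow_one] at h
    rw [h, expect_op_apply]
    refine integral_congr_ae (Eventually.of_forall fun lam => ?_)
    beta_reduce
    rw [jump_op_apply]
    refine Finset.sum_congr rfl fun i _ => ?_
    simp only [Pi.add_apply, sigmaPull_apply, swStat, swIncr]
    congr 1
    ring
  rw [map_add, jump_op_pull', map_add, Pi.add_apply] at h2
  have h3 : expect.op (swStat Ψ) ω.1.1 = ∫ lam, linStat (Ψ ω.1.1.N ω.1.1.n) lam.1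
        ∂(schurWeylMeasure ω.1.1.N ω.1.1.n) := rfl
  have h4 : ∀ x y : ℝ, (centredPoly Ψ ω.1.1.N (ω.1.1.n + 1)).eval x -
      (centredPoly Ψ ω.1.1.N (ω.1.1.n + 1)).eval y =
      (Ψ ω.1.1.N (ω.1.1.n + 1)).eval x - (Ψ ω.1.1.N (ω.1.1.n + 1)).eval y := by
    intro x y; simp [centredPoly]
  rw [swIncr, linStat_centredPoly Ψ ω.1.1.one_le, linStat_centredPoly Ψ ω.1.1.one_le, h4]
  simp only [Pi.sub_apply, sigmaPull_apply, swIncr]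
  linarith

/-- Linear combinations of the Dickson statistics. -/
noncomputable def combPoly (θ : ℕ → ℕ → ℝ) (M N n : ℕ) : Polynomial ℝ :=
  ∑ m ∈ Finset.range M, Polynomial.C (θ N m) * dicksonPoly (m + 1) N n

theorem linStat_combPoly (θ : ℕ → ℕ → ℝ) (M N' n : ℕ) {N : ℕ} (lam : Fin N → ℤ) :
    linStat (combPoly θ M N' n) lam =
      ∑ m ∈ Finset.range M, θ N' m * linStat (dicksonPoly (m + 1) N' n) lam := by
  simp only [linStat, combPoly, Polynomial.eval_finsetSum, Polynomial.eval_mul, Polynomial.eval_C,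
    Finset.mul_sum]
  rw [Finset.sum_comm]

/-- The coefficients as functions of the index. -/
def coeffFun (θ : ℕ → ℕ → ℝ) (m : ℕ) (a : SWIndex c) : ℝ := θ a.N m

theorem swStat_combPoly (θ : ℕ → ℕ → ℝ) (M : ℕ) : (swStat (combPoly θ M) : SWState c → ℝ) =
    ∑ m ∈ Finset.range M, sigmaPull (coeffFun θ m) * swH (m + 1) := by
  funext s
  rw [swStat, linStat_combPoly, Finset.sum_apply]
  rfl

theorem swIncr_combPoly (θ : ℕ → ℕ → ℝ) (M : ℕ) : (swIncr (combPoly θ M) : SWPoint c → ℝ) =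
    ∑ m ∈ Finset.range M, sigmaPull (sigmaPull (coeffFun θ m)) * swIncr (dicksonPoly (m + 1)) := by
  funext ω
  have h : ∀ (N n : ℕ) (x : ℝ), (combPoly θ M N n).eval x =
      ∑ m ∈ Finset.range M, θ N m * (dicksonPoly (m + 1) N n).eval x := fun N n x => by
    simp [combPoly, Polynomial.eval_finsetSum]
  rw [swIncr, linStat_combPoly, linStat_combPoly, h, h, ← Finset.sum_sub_distrib,
    ← Finset.sum_add_distrib, ← Finset.sum_sub_distrib, Finset.sum_apply]
  refine Finset.sum_congr rfl fun m _ => ?_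
  simp only [Pi.mul_apply, sigmaPull_apply, swIncr, coeffFun]
  ring

/-- The leading part of the rescaled increments. -/
noncomputable def leadIncr (m : ℕ) : SWPoint c → ℝ :=
  (m + 1 : ℝ) • pU m + (fun _ => if m = 0 then -1 else 0)

theorem leadIncr_zero : (leadIncr 0 : SWPoint c → ℝ) = 0 := by
  funext ω
  simp [leadIncr, pU, dicksonU]

theorem leadIncr_of_ne {m : ℕ} (h : m ≠ 0) : (leadIncr m : SWPoint c → ℝ) = (m + 1 : ℝ) • pU m := by
  funext ω
  simp [leadIncr, h]

/-- Orthogonality of the `U_a` under the jump average. The index `0` carries no noise, since its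
leading increment vanishes. -/
theorem jump_leadIncr_mul (a b : ℕ) : ∃ r ∈ bddS c, jump.op (leadIncr a * leadIncr b) =
    (if a = b then (if a = 0 then 0 else ((a + 1 : ℝ) ^ 2) • sTime ^ a) else 0) + sEps * r := by
  by_cases ha : a = 0
  · subst ha
    exact ⟨0, zero_mem _, by rw [leadIncr_zero, zero_mul, map_zero]; simp⟩
  by_cases hb : b = 0
  · subst hb
    exact ⟨0, zero_mem _, by rw [leadIncr_zero, mul_zero, map_zero]; simp [ha]⟩
  obtain ⟨r, hr, e⟩ := jump_pU_mul_pU (c := c) a b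
  refine ⟨((a + 1 : ℝ) * (b + 1)) • r, Subalgebra.smul_mem _ hr _, ?_⟩
  rw [leadIncr_of_ne ha, leadIncr_of_ne hb, smul_mul_smul_comm, map_smul, e]
  by_cases hab : a = b
  · subst hab
    simp only [if_true, ha, if_false, smul_add, sq, mul_smul_comm]
  · simp only [hab, if_false, zero_add, mul_smul_comm]

theorem time_pow_expansion (m : ℕ) : ∃ w ∈ bddFun (SWIndex c), ∀ (a : SWIndex c),
    (swTime a + swEps a ^ 2) ^ (m + 1) = swTime a ^ (m + 1) +
      (m + 1) * swTime a ^ m * swEps a ^ 2 + swEps a ^ 3 * w a := by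
  induction m with
  | zero => exact ⟨0, zero_mem _, fun a => by simp⟩
  | succ m ih =>
    obtain ⟨w, hw, e⟩ := ih
    have ht := swTime_mem_bddFun (c := c)
    have hE := swEps_mem_bddFun (c := c)
    refine ⟨(swTime + swEps ^ 2) * w + (m + 1 : ℝ) • (swTime ^ m * swEps),
      add_mem (mul_mem (add_mem ht (pow_mem hE 2)) hw)
        (Subalgebra.smul_mem _ (mul_mem (pow_mem ht _) hE) _), fun a => ?_⟩
    rw [pow_succ, e]
    simp only [Pi.add_apply, Pi.mul_apply, Pi.pow_apply, Pi.smul_apply, smul_eq_mul]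
    push_cast
    ring

/-- The limiting variance of a linear combination of the Dickson statistics. -/
noncomputable def combVar (θ : ℕ → ℝ) (M : ℕ) (t : ℝ) : ℝ :=
  ∑ m ∈ Finset.range M, if m = 0 then 0 else θ m ^ 2 * ((m + 1) * t ^ (m + 1))

/-- Moments of centred linear combinations of the Dickson statistics. -/
theorem exists_gaussMom_bound_comb {θ : ℕ → ℕ → ℝ} (hθ : ∀ m, ∃ B, ∀ N, |θ N m| ≤ B) (M r : ℕ) :
    ∃ C, ∀ a : SWIndex c, |expect.op ((∑ m ∈ Finset.range M, sigmaPull (coeffFun θ m) *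
      (swH (m + 1) - sigmaPull (expect.op (swH (m + 1))))) ^ r) a -
        gaussMom (combVar (θ a.N) M (swTime a)) r| ≤ C * swEps a := by
  have hθb : ∀ m, (coeffFun θ m : SWIndex c → ℝ) ∈ bddFun (SWIndex c) := fun m => by
    obtain ⟨B, hB⟩ := hθ m
    exact ⟨B, fun a => hB a.N⟩
  have hp : (pEps : SWPoint c → ℝ) = sigmaPull sEps := rfl
  have hps : (sEps : SWState c → ℝ) = sigmaPull swEps := rfl
  have hE := swEps_mem_bddFun (c := c)
  have hT := swTime_mem_bddFun (c := c)
  choose Z hZ hinc hdrift hlead using swIncr_dicksonPoly_nearDet (c := c)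
  choose d hd hQ using hdrift
  choose R hR hZR using hlead
  set τ : ℕ → SWPoint c → ℝ := fun m => sigmaPull (sigmaPull (coeffFun θ m)) with hτ
  have hτb : ∀ m, τ m ∈ bddP c := fun m => pull_mem_bddP (pull_mem_bddS (hθb m))
  set Zs : SWPoint c → ℝ := ∑ m ∈ Finset.range M, τ m * Z m with hZs
  have hZsb : Zs ∈ bddP c := sum_mem fun m _ => mul_mem (hτb m) (hZ m)
  set D : SWState c → ℝ := ∑ m ∈ Finset.range M, sigmaPull (coeffFun θ m) * d m with hD
  have hDn : D ∈ nearDet c := sum_mem fun m _ => mul_mem (pull_mem_nearDet (hθb m)) (hd m)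
  have hjZs : jump.op Zs = sEps * D := by
    rw [hZs, hD, map_sum, Finset.mul_sum]
    refine Finset.sum_congr rfl fun m _ => ?_
    simp only [hτ]
    rw [jump_op_pull, hQ]; ring
  obtain ⟨d0, hd0, r0, hr0, hD0⟩ := hDn
  have hED : expect.op D = d0 + swEps * expect.op r0 := by
    rw [hD0, map_add, expect_op_pull', hps, expect_op_pull]
  have hEDb : expect.op D ∈ bddFun (SWIndex c) := by
    rw [hED]; exact add_mem hd0 (mul_mem hE (expect_mem_bddFun hr0))
  -- Centring subtracts the mean drift. As `D` is deterministic up to order `N⁻¹`, the jump average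
  -- of `Z'` is of order `N⁻²`.
  set Z' : SWPoint c → ℝ := Zs - pEps * sigmaPull (sigmaPull (expect.op D)) with hZ'
  have hZ'b : Z' ∈ bddP c :=
    sub_mem hZsb (mul_mem pEps_mem_bddP (pull_mem_bddP (pull_mem_bddS hEDb)))
  have hincr : swIncr (centredPoly (combPoly θ M)) = pEps * Z' := by
    have h1 : (swIncr (combPoly θ M) : SWPoint c → ℝ) = pEps * Zs := by
      rw [swIncr_combPoly, hZs, Finset.mul_sum]
      refine Finset.sum_congr rfl fun m _ => ?_
      rw [hinc]; simp only [hτ]; ring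
    rw [swIncr_centredPoly, h1, hp, jump_op_pull, hjZs]
    have h2 : sEps * (sEps * D) = sigmaPull (swEps ^ 2) * D := by rw [hps, map_pow]; ring
    rw [h2, expect_op_pull, hZ', hp, map_mul, map_mul, map_pow, map_pow, ← hps]
    ring
  have hQ1 : jump.op Z' = sEps ^ 2 * (r0 - sigmaPull (expect.op r0)) := by
    rw [hZ', map_sub, hp, jump_op_pull, jump_op_pull', hjZs, hED, hD0, map_add, map_mul, ← hps]
    ring
  set A : SWPoint c → ℝ := ∑ m ∈ Finset.range M, τ m * leadIncr m with hA
  set R' : SWPoint c → ℝ := (∑ m ∈ Finset.range M, τ m * R m) - sigmaPull (sigmaPull (expect.op D))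
    with hR'
  have hR'b : R' ∈ bddP c := sub_mem (sum_mem fun m _ => mul_mem (hτb m) (hR m))
    (pull_mem_bddP (pull_mem_bddS hEDb))
  have hZ'A : Z' = A + pEps * R' := by
    have h1 : Zs = A + pEps * ∑ m ∈ Finset.range M, τ m * R m := by
      rw [hZs, hA, Finset.mul_sum, ← Finset.sum_add_distrib]
      refine Finset.sum_congr rfl fun m _ => ?_
      rw [hZR m, leadIncr]; ring
    rw [hZ', h1, hR']; ring
  have hAb : A ∈ bddP c := sum_mem fun m _ => mul_mem (hτb m)
    (add_mem (Subalgebra.smul_mem _ (polyP_le_bddP (pU_mem_polyP m)) _) ((bddP c).algebraMap_mem _))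
  choose ρ hρ eρ using jump_leadIncr_mul (c := c)
  set σ : SWIndex c → ℝ := ∑ m ∈ Finset.range M, coeffFun θ m ^ 2 *
    (if m = 0 then 0 else ((m + 1 : ℝ) ^ 2) • swTime ^ m) with hσ
  have hite : ∀ m : ℕ, (if m = 0 then 0 else ((m + 1 : ℝ) ^ 2) • swTime ^ m) ∈ bddFun (SWIndex c) := by
    intro m
    split_ifs
    · exact zero_mem _
    · exact Subalgebra.smul_mem _ (pow_mem hT _) _
  have hσb : σ ∈ bddFun (SWIndex c) := sum_mem fun m _ => mul_mem (pow_mem (hθb m) 2) (hite m)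
  set r3 : SWState c → ℝ := ∑ m ∈ Finset.range M, ∑ k ∈ Finset.range M,
    sigmaPull (coeffFun θ m) * (sigmaPull (coeffFun θ k) * ρ m k) with hr3
  have hr3b : r3 ∈ bddS c := sum_mem fun m _ => sum_mem fun k _ =>
    mul_mem (pull_mem_bddS (hθb m)) (mul_mem (pull_mem_bddS (hθb k)) (hρ m k))
  have hjA : jump.op (A * A) = sigmaPull σ + sEps * r3 := by
    have h1 : A * A = ∑ m ∈ Finset.range M, ∑ k ∈ Finset.range M,
        sigmaPull (sigmaPull (coeffFun θ m)) * (sigmaPull (sigmaPull (coeffFun θ k)) *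
          (leadIncr m * leadIncr k)) := by
      rw [hA, Finset.sum_mul_sum]
      refine Finset.sum_congr rfl fun m _ => Finset.sum_congr rfl fun k _ => ?_
      simp only [hτ]; ring
    have h2 : ∀ m ∈ Finset.range M, ∑ k ∈ Finset.range M, sigmaPull (coeffFun θ m) *
        (sigmaPull (coeffFun θ k) * jump.op (leadIncr (c := c) m * leadIncr k)) =
        sigmaPull (coeffFun θ m ^ 2 * (if m = 0 then 0 else ((m + 1 : ℝ) ^ 2) • swTime ^ m)) +
        sEps * ∑ k ∈ Finset.range M, sigmaPull (coeffFun θ m) * (sigmaPull (coeffFun θ k) * ρ m k) := by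
      intro m hm
      have h3 : ∀ k, sigmaPull (coeffFun θ m) *
        (sigmaPull (coeffFun θ k) * jump.op (leadIncr (c := c) m * leadIncr k)) =
        (if m = k then sigmaPull (coeffFun θ m ^ 2 *
          (if m = 0 then 0 else ((m + 1 : ℝ) ^ 2) • swTime ^ m)) else 0) +
        sEps * (sigmaPull (coeffFun θ m) * (sigmaPull (coeffFun θ k) * ρ m k)) := by
        intro k
        rw [eρ]
        by_cases hmk : m = k
        · subst hmk
          by_cases hm0 : m = 0
          · simp only [if_true, hm0, mul_zero, map_zero]; ring
          · simp only [if_true, hm0, if_false, map_mul, map_pow, map_smul]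
            change _ = _ * (_ • sTime ^ m) + _
            ring
        · simp only [hmk, if_false]; ring
      rw [Finset.sum_congr rfl fun k _ => h3 k, Finset.sum_add_distrib, Finset.sum_ite_eq,
        if_pos hm, ← Finset.mul_sum]
    rw [h1, map_sum]
    simp only [map_sum, jump_op_pull]
    rw [Finset.sum_congr rfl h2, Finset.sum_add_distrib, ← Finset.mul_sum, hσ, map_sum, hr3]
  have hQ2 : jump.op (Z' ^ 2) = sigmaPull σ +
      sEps * (r3 + jump.op (A * R' + R' * A + pEps * (R' * R'))) := by
    have h1 : Z' ^ 2 = A * A + sigmaPull sEps * (A * R' + R' * A + pEps * (R' * R')) := by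
      rw [hZ'A, hp]; ring
    rw [h1, map_add, jump_op_pull, hjA]; ring
  have hr4 : r3 + jump.op (A * R' + R' * A + pEps * (R' * R')) ∈ bddS c :=
    add_mem hr3b (jump_mem_bddS (add_mem (add_mem (mul_mem hAb hR'b) (mul_mem hR'b hAb))
      (mul_mem pEps_mem_bddP (mul_mem hR'b hR'b))))
  choose w hw ew using time_pow_expansion (c := c)
  -- The integral in time of the variance rate `σ`: `(m + 1) ^ 2 t ^ m` integrates to `(m + 1) t ^
  -- (m + 1)`.
  set v : SWIndex c → ℝ := fun a => combVar (θ a.N) M (swTime a) with hv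
  have hvb : v ∈ bddFun (SWIndex c) := by
    have : v = ∑ m ∈ Finset.range M, if m = 0 then 0 else
        coeffFun θ m ^ 2 * ((m + 1 : ℝ) • swTime ^ (m + 1)) := by
      funext a
      simp only [hv, combVar, Finset.sum_apply]
      refine Finset.sum_congr rfl fun m _ => ?_
      split_ifs <;> simp [coeffFun]
    rw [this]
    refine sum_mem fun m _ => ?_
    split_ifs
    · exact zero_mem _
    · exact mul_mem (pow_mem (hθb m) 2) (Subalgebra.smul_mem _ (pow_mem hT _) _)
  set κ : SWIndex c → ℝ := ∑ m ∈ Finset.range M, if m = 0 then 0 else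
        coeffFun θ m ^ 2 * ((m + 1 : ℝ) • w m) with hκ
  have hκb : κ ∈ bddFun (SWIndex c) := by
    refine sum_mem fun m _ => ?_
    split_ifs
    · exact zero_mem _
    · exact mul_mem (pow_mem (hθb m) 2) (Subalgebra.smul_mem _ (hw m) _)
  have hmain := exists_gaussMom_bound hZ'b hincr (sub_mem hr0 (pull_mem_bddS (expect_mem_bddFun hr0)))
    hQ1 hr4 hQ2 hσb (fun N hN => linStat_centredPoly_zero _ hN) hvb (fun a ha => ?_) hκb
    (fun a h => ?_) r
  · obtain ⟨C, hC⟩ := hmain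
    refine ⟨C, fun a => ?_⟩
    have hst : (swStat (centredPoly (combPoly θ M)) : SWState c → ℝ) =
        ∑ m ∈ Finset.range M, sigmaPull (coeffFun θ m) *
          (swH (m + 1) - sigmaPull (expect.op (swH (m + 1)))) := by
      rw [swStat_centredPoly, swStat_combPoly, map_sum, map_sum, ← Finset.sum_sub_distrib]
      refine Finset.sum_congr rfl fun m _ => ?_
      rw [expect_op_pull, map_mul]; ring
    rw [← hst]
    exact hC a
  · simp only [hv, combVar, swTime_zero ha]
    exact Finset.sum_eq_zero fun m _ => by simp
  · simp only [hv, combVar, swTime_succ, hσ, hκ, Finset.sum_apply, Finset.mul_sum]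
    rw [← Finset.sum_add_distrib, ← Finset.sum_add_distrib]
    refine Finset.sum_congr rfl fun m _ => ?_
    by_cases hm : m = 0
    · simp [hm]
    · simp only [hm, if_false, ew, Pi.mul_apply, Pi.pow_apply, Pi.smul_apply, smul_eq_mul, coeffFun]
      change θ a.N m ^ 2 * _ = _
      ring

end Centering

/-! ### Laurent coefficients and the expansion of powers in Dickson polynomials. -/

section Laurent

variable {R : Type*} [CommRing R]

/-- The coefficient of `z ^ (-m)` in `(1 / z + 1 + t + t z) ^ k`. -/
def laurentCoeff (t : R) : ℕ → ℕ → R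
  | 0, 0 => 1
  | 0, _ + 1 => 0
  | k + 1, 0 => (1 + t) * laurentCoeff t k 0 + 2 * t * laurentCoeff t k 1
  | k + 1, m + 1 => laurentCoeff t k m + (1 + t) * laurentCoeff t k (m + 1) +
      t * laurentCoeff t k (m + 2)

theorem map_laurentCoeff {S : Type*} [CommRing S] (f : R →+* S) (t : R) (k m : ℕ) :
    f (laurentCoeff t k m) = laurentCoeff (f t) k m := by
  induction k generalizing m with
  | zero => cases m <;> simp [laurentCoeff]
  | succ k ih => cases m <;> simp [laurentCoeff, ih, map_ofNat f 2]

theorem laurentCoeff_eq_zero (t : R) {k m : ℕ} (h : k < m) : laurentCoeff t k m = 0 := by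
  induction k generalizing m with
  | zero =>
    obtain ⟨m, rfl⟩ : ∃ j, m = j + 1 := ⟨m - 1, by omega⟩
    rfl
  | succ k ih =>
    obtain ⟨m, rfl⟩ : ∃ j, m = j + 1 := ⟨m - 1, by omega⟩
    rw [laurentCoeff, ih (by omega), ih (by omega), ih (by omega)]; simp

/-- Expansion of powers in Dickson polynomials. -/
theorem pow_eq_sum_laurentCoeff (x t : R) {k M : ℕ} (h : k ≤ M) : (x + 1 + t) ^ k =
    laurentCoeff t k 0 + ∑ m ∈ Finset.range M, laurentCoeff t k (m + 1) * dicksonD x t (m + 1) := by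
  induction k generalizing M with
  | zero => simp [laurentCoeff]
  | succ k ih =>
    have h1 := ih (M := M) (by omega)
    have h2 := ih (M := M + 1) (by omega)
    obtain ⟨M, rfl⟩ : ∃ j, M = j + 1 := ⟨M - 1, by omega⟩
    -- Uses `x D_m = D_{m+1} + t D_{m-1}`; the factor `2` is `D_0 = 2`. The boundary terms vanish
    -- because `k < M + 1`.
    have e0 : x * (laurentCoeff t k 0 + ∑ m ∈ Finset.range (M + 1),
        laurentCoeff t k (m + 1) * dicksonD x t (m + 1)) =
        2 * t * laurentCoeff t k 1 + ∑ m ∈ Finset.range (M + 1),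
          (laurentCoeff t k m + t * laurentCoeff t k (m + 2)) * dicksonD x t (m + 1) := by
      have hz : laurentCoeff t k (M + 1) = 0 := laurentCoeff_eq_zero t (by omega)
      have hz2 : laurentCoeff t k (M + 2) = 0 := laurentCoeff_eq_zero t (by omega)
      have hg : ∀ K, x * (laurentCoeff t k 0 + ∑ m ∈ Finset.range (K + 1),
        laurentCoeff t k (m + 1) * dicksonD x t (m + 1)) =
        2 * t * laurentCoeff t k 1 + ∑ m ∈ Finset.range (K + 1),
          (laurentCoeff t k m + t * laurentCoeff t k (m + 2)) * dicksonD x t (m + 1)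
          + laurentCoeff t k (K + 1) * dicksonD x t (K + 2) -
          t * laurentCoeff t k (K + 2) * dicksonD x t (K + 1) := by
        intro K
        induction K with
        | zero => simp [dicksonD]; ring
        | succ K ihK =>
          rw [Finset.sum_range_succ, ← add_assoc, mul_add, ihK, Finset.sum_range_succ _ (K + 1)]
          have : dicksonD x t (K + 1 + 2) = x * dicksonD x t (K + 1 + 1) - t * dicksonD x t (K + 1) :=
            rfl
          rw [this]; ring
      rw [hg, hz, hz2]; ring
    rw [pow_succ, show (x + 1 + t) ^ k * (x + 1 + t) = x * (x + 1 + t) ^ k +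
      (1 + t) * (x + 1 + t) ^ k by ring, h1, e0, laurentCoeff]
    simp only [laurentCoeff, add_mul, Finset.sum_add_distrib, mul_add, Finset.mul_sum, mul_assoc]
    ring

end Laurent

theorem continuous_laurentCoeff (k m : ℕ) : Continuous fun t : ℝ => laurentCoeff t k m := by
  induction k generalizing m with
  | zero => cases m <;> simp only [laurentCoeff] <;> exact continuous_const
  | succ k ih =>
    have := ih 0
    have := ih 1
    have := fun m => ih m
    cases m <;> simp only [laurentCoeff] <;> fun_prop

/-! ### Power sums in terms of the Dickson statistics. -/

section Moments

variable {c : ℝ}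

/-- Power sums as functions of states. -/
noncomputable def swPow (k : ℕ) (s : SWState c) : ℝ := powerSum k s.2

theorem swPow_eq (k : ℕ) (s : SWState c) :
    swPow k s = (s.1.N : ℝ) ^ k * s.1.N * empirical.op (swY ^ k) s := by
  have hN := s.1.N_pos.ne'
  rw [empirical_op_apply, swPow, powerSum, Finset.mul_sum]
  refine Finset.sum_congr rfl fun i _ => ?_
  simp only [Pi.pow_apply, swY, shiftedCoord, div_pow]
  field_simp

theorem empirical_swY_pow {k M : ℕ} (h : k ≤ M) : ∃ d, empirical.op (swY (c := c) ^ k) =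
    sigmaPull d +
    sEps * ∑ m ∈ Finset.range M, sigmaPull (laurentCoeff swTime k (m + 1)) * swH (m + 1) := by
  have hY : (swY : SWPoint c → ℝ) = swX + 1 + pTime := by rw [swX]; ring
  have hp : ∀ m, laurentCoeff (pTime : SWPoint c → ℝ) k m =
      sigmaPull (sigmaPull (laurentCoeff swTime k m)) := fun m =>
    (map_laurentCoeff ((sigmaPull.comp sigmaPull : (SWIndex c → ℝ) →ₐ[ℝ] (SWPoint c → ℝ)) :
      (SWIndex c → ℝ) →+* (SWPoint c → ℝ)) swTime k m).symm
  have hD : ∀ m, empirical.op (dicksonD (swX : SWPoint c → ℝ) pTime m) =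
      sigmaPull (fun a => detTerm m (swTime a)) + sEps * swH m := fun m => funext fun s =>
    empirical_pD m s
  refine ⟨laurentCoeff swTime k 0 + ∑ m ∈ Finset.range M, laurentCoeff swTime k (m + 1) *
      fun a => detTerm (m + 1) (swTime a), ?_⟩
  rw [hY, pow_eq_sum_laurentCoeff _ _ h, map_add, map_sum]
  simp only [hp, empirical_op_pull, empirical_op_pull', hD, map_add, map_sum, map_mul]
  rw [add_assoc, Finset.mul_sum, ← Finset.sum_add_distrib]
  congr 1
  exact Finset.sum_congr rfl fun m _ => by ring

theorem normalizedMoment_eq {k M : ℕ} (h : k ≤ M) (a : SWIndex c) (lam : Signature a.N) :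
    normalizedMoment (schurWeylMeasure a.N a.n) k lam =
      (∑ m ∈ Finset.range M, sigmaPull (laurentCoeff swTime k (m + 1)) *
        (swH (m + 1) - sigmaPull (expect.op (swH (m + 1)))) : SWState c → ℝ) ⟨a, lam⟩ := by
  have h1 : (swPow k : SWState c → ℝ) =
      sigmaPull (fun a => (a.N : ℝ) ^ k * a.N) * empirical.op (swY ^ k) := funext fun s => swPow_eq k s
  have h2 : normalizedMoment (schurWeylMeasure a.N a.n) k lam =
      (swPow k ⟨a, lam⟩ - expect.op (swPow k) a) / (a.N : ℝ) ^ k := rfl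
  have hN := a.N_pos.ne'
  have hs : (sEps : SWState c → ℝ) = sigmaPull swEps := rfl
  obtain ⟨d, h3⟩ := empirical_swY_pow (c := c) h
  rw [h2, h1, expect_op_pull, h3, map_add, expect_op_pull', hs, expect_op_pull, map_sum]
  simp only [expect_op_pull, Pi.mul_apply, Pi.add_apply, sigmaPull_apply, Finset.sum_apply,
    Pi.sub_apply, mul_sub, Finset.sum_sub_distrib, swEps]
  field_simp
  ring

end Moments

/-! ### Polarization of powers. -/

section Polarization

variable {ι R : Type*} [Fintype ι] [DecidableEq ι] [CommRing R]

/-- Inclusion–exclusion: for `j ∉ T` the terms of `S` and `insert j S` cancel. -/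
theorem sum_powerset_neg_one_mul_ite (T : Finset ι) :
    ∑ S : Finset ι, (-1 : R) ^ S.card * (if T ⊆ S then 1 else 0) =
      if T = Finset.univ then (-1) ^ Fintype.card ι else 0 := by
  split_ifs with hT
  · subst hT
    rw [Finset.sum_eq_single Finset.univ]
    · simp
    · intro S _ hS
      rw [if_neg (fun h => hS (Finset.univ_subset_iff.1 h)), mul_zero]
    · simp
  · obtain ⟨j, hj⟩ : ∃ j, j ∉ T := by
      by_contra! h
      exact hT (Finset.eq_univ_iff_forall.2 h)
    have h1 : (Finset.univ : Finset (Finset ι)) =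
        (insert j (Finset.univ.erase j) : Finset ι).powerset := by
      rw [Finset.insert_erase (Finset.mem_univ j), Finset.powerset_univ]
    rw [h1, Finset.sum_powerset_insert (Finset.notMem_erase j _), ← Finset.sum_add_distrib]
    refine Finset.sum_eq_zero fun S hS => ?_
    have hjS : j ∉ S := fun h => Finset.notMem_erase j _ (Finset.mem_powerset.1 hS h)
    have h2 : T ⊆ insert j S ↔ T ⊆ S := Finset.subset_insert_iff_of_notMem hj
    rw [Finset.card_insert_of_notMem hjS]
    simp only [h2, pow_succ]
    ring

/-- The polarization identity for products. -/
theorem sum_powerset_neg_one_mul_sum_pow {r : ℕ} (x : Fin r → R) :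
    ∑ S : Finset (Fin r), (-1 : R) ^ S.card * (∑ j ∈ S, x j) ^ r =
      (-1) ^ r * (r.factorial : R) * ∏ j, x j := by
  -- Expansion over maps `p : Fin r → Fin r`; the alternating sum over `S` keeps only those with
  -- full image, that is, the permutations.
  have h1 : ∀ S : Finset (Fin r), (∑ j ∈ S, x j) ^ r =
      ∑ p : Fin r → Fin r, (if Finset.univ.image p ⊆ S then 1 else 0) * ∏ i, x (p i) := by
    intro S
    have h2 : (∑ j ∈ S, x j) ^ r = ∏ _i : Fin r, ∑ j, if j ∈ S then x j else 0 := by simp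
    rw [h2, Finset.prod_univ_sum, Fintype.piFinset_univ]
    refine Finset.sum_congr rfl fun p _ => ?_
    split_ifs with hp
    · rw [one_mul]
      exact Finset.prod_congr rfl fun i _ =>
        if_pos (hp (Finset.mem_image_of_mem p (Finset.mem_univ i)))
    · rw [zero_mul]
      obtain ⟨i, hi⟩ : ∃ i, p i ∉ S := by
        by_contra! h
        exact hp (Finset.image_subset_iff.2 fun i _ => h i)
      exact Finset.prod_eq_zero (Finset.mem_univ i) (if_neg hi)
  simp only [h1, Finset.mul_sum, ← mul_assoc]
  rw [Finset.sum_comm]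
  simp only [← Finset.sum_mul, sum_powerset_neg_one_mul_ite, Fintype.card_fin]
  have h3 : ∀ p : Fin r → Fin r, (if Finset.univ.image p = Finset.univ then (-1 : R) ^ r else 0) *
      ∏ i, x (p i) = if Function.Bijective p then (-1) ^ r * ∏ i, x i else 0 := by
    intro p
    have h4 : Finset.univ.image p = Finset.univ ↔ Function.Bijective p := by
      rw [← Finite.surjective_iff_bijective, ← Finset.coe_eq_univ, Finset.coe_image, Finset.coe_univ,
        Set.image_univ, Set.range_eq_univ]
    by_cases hp : Function.Bijective p
    · rw [if_pos (h4.2 hp), if_pos hp, hp.prod_comp]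
    · rw [if_neg (fun h => hp (h4.1 h)), if_neg hp, zero_mul]
  simp only [h3]
  rw [← Finset.sum_filter, Finset.sum_const, nsmul_eq_mul]
  have h5 : (Finset.univ.filter fun p : Fin r → Fin r => Function.Bijective p).card = r.factorial := by
    have h6 : (Finset.univ.filter fun p : Fin r → Fin r => Function.Bijective p) =
        Finset.univ.map (⟨fun e => ⇑e, DFunLike.coe_injective⟩ : Equiv.Perm (Fin r) ↪ (Fin r → Fin r)) := by
      ext p
      simp only [Finset.mem_filter, Finset.mem_univ, true_and, Finset.mem_map,
        Function.Embedding.coeFn_mk]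
      exact ⟨fun hp => ⟨Equiv.ofBijective p hp, rfl⟩, fun ⟨e, he⟩ => he ▸ e.bijective⟩
    rw [h6, Finset.card_map, Finset.card_univ, Fintype.card_perm, Fintype.card_fin]
  rw [h5]; ring

end Polarization

theorem continuous_gaussMom (r : ℕ) : Continuous fun v : ℝ => gaussMom v r := by
  induction r using Nat.twoStepInduction with
  | zero => exact continuous_const
  | one => exact continuous_const
  | more r h _ =>
    simp only [gaussMom]
    fun_prop

/-! ### Passage to the limit of the moments. -/

section Limit

variable {c : ℝ}

theorem tendsto_floor_div_sq (hc : 0 < c) :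
    Tendsto (fun N : ℕ => (⌊c * (N : ℝ) ^ 2⌋₊ : ℝ) / (N : ℝ) ^ 2) atTop (𝓝 c) :=
  (tendsto_nat_floor_mul_div_atTop hc.le).comp
    ((tendsto_pow_atTop two_ne_zero).comp tendsto_natCast_atTop_atTop)

/-- At finite `N` the coefficients are Laurent coefficients at `t = n / N²`, and the moments are
Gaussian up to `O(1 / N)`. As `n / N² → c`, the coefficients converge, hence are bounded, and
continuity of `gaussMom` gives the limit. -/
theorem tendsto_integral_sum_pow (hc : 0 < c) {ι : Type*} (S : Finset ι) (k : ι → ℕ) {M : ℕ}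
    (hM : ∀ j ∈ S, k j ≤ M) (r : ℕ) :
    Tendsto (fun N : ℕ => ∫ lam, (∑ j ∈ S,
        normalizedMoment (schurWeylMeasure N ⌊c * (N : ℝ) ^ 2⌋₊) (k j) lam) ^ r
          ∂(schurWeylMeasure N ⌊c * (N : ℝ) ^ 2⌋₊)) atTop
      (𝓝 (gaussMom (combVar (fun m => ∑ j ∈ S, laurentCoeff c (k j) (m + 1)) M c) r)) := by
  set t : ℕ → ℝ := fun N => (⌊c * (N : ℝ) ^ 2⌋₊ : ℝ) / (N : ℝ) ^ 2 with ht
  have htc : Tendsto t atTop (𝓝 c) := tendsto_floor_div_sq hc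
  set θ : ℕ → ℕ → ℝ := fun N m => ∑ j ∈ S, laurentCoeff (t N) (k j) (m + 1) with hθ
  have hθc : ∀ m, Tendsto (fun N => θ N m) atTop (𝓝 (∑ j ∈ S, laurentCoeff c (k j) (m + 1))) :=
    fun m => tendsto_finsetSum _ fun j _ =>
      ((continuous_laurentCoeff (k j) (m + 1)).tendsto c).comp htc
  have hθb : ∀ m, ∃ B, ∀ N, |θ N m| ≤ B := fun m => by
    obtain ⟨B, hB⟩ := (Metric.isBounded_range_of_tendsto _ (hθc m)).exists_norm_le
    exact ⟨B, fun N => hB _ (Set.mem_range_self N)⟩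
  obtain ⟨C, hC⟩ := exists_gaussMom_bound_comb (c := c) hθb M r
  have hlim : Tendsto (fun N => gaussMom (combVar (θ N) M (t N)) r) atTop
      (𝓝 (gaussMom (combVar (fun m => ∑ j ∈ S, laurentCoeff c (k j) (m + 1)) M c) r)) := by
    refine ((continuous_gaussMom r).tendsto _).comp (tendsto_finsetSum _ fun m _ => ?_)
    split_ifs
    · exact tendsto_const_nhds
    · exact ((hθc m).pow 2).mul ((htc.pow (m + 1)).const_mul _)
  refine hlim.congr_dist ?_
  have hz : Tendsto (fun N : ℕ => C * (1 / (N : ℝ))) atTop (𝓝 0) := by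
    simpa using tendsto_one_div_atTop_nhds_zero_nat.const_mul C
  refine squeeze_zero' (Eventually.of_forall fun N => dist_nonneg) ?_ hz
  filter_upwards [eventually_ge_atTop 1] with N hN
  have hle : (⌊c * (N : ℝ) ^ 2⌋₊ : ℝ) ≤ c * (N : ℝ) ^ 2 := Nat.floor_le (by positivity)
  have h := hC ⟨N, ⌊c * (N : ℝ) ^ 2⌋₊, hN, hle⟩
  rw [dist_comm, Real.dist_eq]
  refine le_of_eq_of_le ?_ h
  rw [expect_op_apply]
  change |_ - gaussMom (combVar (θ N) M (t N)) r| = |_ - gaussMom (combVar (θ N) M (t N)) r|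
  congr 2
  refine integral_congr_ae (Eventually.of_forall fun lam => ?_)
  beta_reduce
  rw [Pi.pow_apply]
  congr 1
  have h1 := fun j (hj : j ∈ S) =>
    normalizedMoment_eq (hM j hj) (⟨N, ⌊c * (N : ℝ) ^ 2⌋₊, hN, hle⟩ : SWIndex c) lam
  have hl : ∀ (k m : ℕ) (a : SWIndex c), laurentCoeff (swTime : SWIndex c → ℝ) k m a =
      laurentCoeff (swTime a) k m := fun k m a =>
    map_laurentCoeff (Pi.evalRingHom (fun _ : SWIndex c => ℝ) a) swTime k m
  rw [Finset.sum_congr rfl h1]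
  simp only [Finset.sum_apply, Pi.mul_apply, sigmaPull_apply, hl]
  rw [Finset.sum_comm]
  refine Finset.sum_congr rfl fun m _ => ?_
  rw [← Finset.sum_mul]
  rfl

/-- Polarized form of `tendsto_integral_sum_pow`. -/
theorem tendsto_integral_prod (hc : 0 < c) {r : ℕ} (k : Fin r → ℕ) {M : ℕ} (hM : ∀ j, k j ≤ M) :
    Tendsto (fun N : ℕ => ∫ lam, ∏ j,
        normalizedMoment (schurWeylMeasure N ⌊c * (N : ℝ) ^ 2⌋₊) (k j) lam
          ∂(schurWeylMeasure N ⌊c * (N : ℝ) ^ 2⌋₊)) atTop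
      (𝓝 (((-1) ^ r * (r.factorial : ℝ))⁻¹ * ∑ S : Finset (Fin r), (-1) ^ S.card *
        gaussMom (combVar (fun m => ∑ j ∈ S, laurentCoeff c (k j) (m + 1)) M c) r)) := by
  have h := (tendsto_finsetSum (Finset.univ : Finset (Finset (Fin r))) fun S _ =>
    (tendsto_integral_sum_pow hc S k (M := M) (fun j _ => hM j) r).const_mul
      ((-1 : ℝ) ^ S.card)).const_mul (((-1) ^ r * (r.factorial : ℝ))⁻¹)
  refine h.congr' ?_
  filter_upwards [eventually_ge_atTop 1] with N hN
  have h0 : ((-1) ^ r * (r.factorial : ℝ)) ≠ 0 := by positivity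
  simp only [← integral_const_mul]
  rw [← integral_finsetSum _ fun S _ => integrable_schurWeyl hN _, ← integral_const_mul]
  refine integral_congr_ae (Eventually.of_forall fun lam => ?_)
  beta_reduce
  rw [sum_powerset_neg_one_mul_sum_pow, inv_mul_cancel_left₀ h0]

end Limit

/-! ### Moments of the Gaussian law. -/

section GaussianReal

/-- Leibniz rule for `f' = v t f`. At `t = 0` it becomes the recursion of `gaussMom`. -/
theorem iteratedDeriv_exp_sq (v : ℝ) (n : ℕ) (t : ℝ) :
    iteratedDeriv (n + 2) (fun t : ℝ => Real.exp (v * t ^ 2 / 2)) t =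
      v * (t * iteratedDeriv (n + 1) (fun t : ℝ => Real.exp (v * t ^ 2 / 2)) t +
        (n + 1) * iteratedDeriv n (fun t : ℝ => Real.exp (v * t ^ 2 / 2)) t) := by
  set f : ℝ → ℝ := fun t : ℝ => Real.exp (v * t ^ 2 / 2) with hf
  have hc : ContDiff ℝ ⊤ f := by fun_prop
  have hd : ∀ n t, HasDerivAt (iteratedDeriv n f) (iteratedDeriv (n + 1) f t) t := fun n t => by
    rw [iteratedDeriv_succ]
    exact ((hc.differentiable_iteratedDeriv n (by simp)) t).hasDerivAt
  have h1 : ∀ t, iteratedDeriv 1 f t = v * (t * f t) := fun t => by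
    have : HasDerivAt f (Real.exp (v * t ^ 2 / 2) * (v * (2 * t) / 2)) t := by
      have := (((hasDerivAt_pow 2 t).const_mul v).div_const 2).exp
      simpa using this
    rw [iteratedDeriv_one, this.deriv, hf]; ring
  induction n generalizing t with
  | zero =>
    have e : iteratedDeriv 1 f = fun t => v * (t * iteratedDeriv 0 f t) := by
      funext t; rw [h1, iteratedDeriv_zero]
    have h := (((hasDerivAt_id t).mul (hd 0 t)).const_mul v)
    rw [show 0 + 2 = 1 + 1 from rfl, iteratedDeriv_succ, e]
    refine h.deriv.trans ?_
    simp only [id, zero_add, e]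
    push_cast; ring
  | succ n ih =>
    have e : iteratedDeriv (n + 2) f = fun t => v * (t * iteratedDeriv (n + 1) f t +
        (n + 1) * iteratedDeriv n f t) := funext ih
    have h := (((hasDerivAt_id t).mul (hd (n + 1) t)).add
      ((hd n t).const_mul ((n : ℝ) + 1))).const_mul v
    rw [show n + 1 + 2 = n + 2 + 1 from rfl, iteratedDeriv_succ, e]
    refine h.deriv.trans ?_
    simp only [id, ← ih, show n + 1 + 1 = n + 2 from rfl]
    push_cast; ring

/-- The moments of a centred Gaussian law. -/
theorem integral_pow_gaussianReal (v : NNReal) (r : ℕ) :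
    ∫ x, x ^ r ∂(gaussianReal 0 v) = gaussMom (v : ℝ) r := by
  have h : ∀ n, ∫ x, x ^ n ∂(gaussianReal 0 v) =
      iteratedDeriv n (fun t : ℝ => Real.exp (v * t ^ 2 / 2)) 0 := fun n => by
    have h1 := iteratedDeriv_mgf_zero (X := id) (μ := gaussianReal 0 v) (by simp) n
    rw [mgf_id_gaussianReal] at h1
    simp only [zero_mul, zero_add] at h1
    rw [h1]
    rfl
  induction r using Nat.twoStepInduction with
  | zero => simp [gaussMom]
  | one => simp [gaussMom]
  | more n h1 _ =>
    rw [h, iteratedDeriv_exp_sq, ← h n, h1, gaussMom]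
    push_cast; ring

end GaussianReal

/-! ### White noise and its finite linear combinations. -/

section WhiteNoise

/-- The law of a sequence of independent standard Gaussian variables. -/
noncomputable def whiteNoise : Measure (ℕ → ℝ) := Measure.infinitePi fun _ => gaussianReal 0 1

instance : IsProbabilityMeasure whiteNoise := by unfold whiteNoise; infer_instance

theorem iIndepFun_whiteNoise : iIndepFun (fun (i : ℕ) (ω : ℕ → ℝ) => ω i) whiteNoise :=
  iIndepFun_infinitePi (X := fun _ x => x) fun _ => measurable_id

theorem map_whiteNoise (i : ℕ) : whiteNoise.map (fun ω => ω i) = gaussianReal 0 1 :=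
  Measure.infinitePi_map_eval _ i

theorem hasGaussianLaw_whiteNoise (i : ℕ) : HasGaussianLaw (fun ω : ℕ → ℝ => ω i) whiteNoise where
  isGaussian_map := by rw [map_whiteNoise]; infer_instance

theorem isGaussianProcess_whiteNoise :
    IsGaussianProcess (fun (i : ℕ) (ω : ℕ → ℝ) => ω i) whiteNoise where
  hasGaussianLaw I := (iIndepFun_whiteNoise.precomp Subtype.val_injective).hasGaussianLaw
    fun i : I => hasGaussianLaw_whiteNoise i

theorem integral_whiteNoise (i : ℕ) : ∫ ω, ω i ∂whiteNoise = 0 := by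
  have h := integral_id_gaussianReal (μ := 0) (v := 1)
  rw [← map_whiteNoise i, integral_map (measurable_pi_apply i).aemeasurable (by fun_prop)] at h
  exact h

theorem covariance_whiteNoise (i j : ℕ) :
    cov[fun ω => ω i, fun ω => ω j; whiteNoise] = if i = j then 1 else 0 := by
  split_ifs with h
  · subst h
    have h1 := variance_fun_id_gaussianReal (μ := 0) (v := 1)
    have hm : AEMeasurable (fun ω : ℕ → ℝ => ω i) whiteNoise := (measurable_pi_apply i).aemeasurable
    rw [← map_whiteNoise i, variance_map (by fun_prop) hm] at h1
    rw [covariance_self hm]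
    exact h1.trans (by simp)
  · exact (iIndepFun_whiteNoise.indepFun h).covariance_eq_zero
      (hasGaussianLaw_whiteNoise i).memLp_two (hasGaussianLaw_whiteNoise j).memLp_two

/-- Finite linear combinations of white noise. -/
noncomputable def noiseSum (M : ℕ) (b : ℕ → ℝ) (ω : ℕ → ℝ) : ℝ := ∑ m ∈ Finset.range M, b m * ω m

theorem memLp_mul_whiteNoise (x : ℝ) (i : ℕ) : MemLp (fun ω : ℕ → ℝ => x * ω i) 2 whiteNoise :=
  (hasGaussianLaw_whiteNoise i).memLp_two.const_mul x

theorem integral_noiseSum (M : ℕ) (b : ℕ → ℝ) : ∫ ω, noiseSum M b ω ∂whiteNoise = 0 := by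
  unfold noiseSum
  rw [integral_finsetSum _ fun i _ => (memLp_mul_whiteNoise (b i) i).integrable (by norm_num)]
  simp [integral_const_mul, integral_whiteNoise]

theorem covariance_noiseSum (M : ℕ) (b d : ℕ → ℝ) :
    cov[noiseSum M b, noiseSum M d; whiteNoise] = ∑ m ∈ Finset.range M, b m * d m := by
  unfold noiseSum
  rw [covariance_fun_sum_fun_sum' (fun i _ => memLp_mul_whiteNoise _ i)
    fun i _ => memLp_mul_whiteNoise _ i]
  refine Finset.sum_congr rfl fun i hi => ?_
  simp only [covariance_const_mul_left, covariance_const_mul_right, covariance_whiteNoise]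
  rw [Finset.sum_eq_single_of_mem i hi]
  · simp; ring
  · intro j _ hj; simp [hj.symm]

theorem isGaussianProcess_noiseSum {T : Type*} (M : T → ℕ) (b : T → ℕ → ℝ) :
    IsGaussianProcess (fun s => noiseSum (M s) (b s)) whiteNoise := by
  refine isGaussianProcess_whiteNoise.of_isGaussianProcess fun s => ⟨Finset.range (M s),
    ∑ m : Finset.range (M s), b s m • ContinuousLinearMap.proj m, fun ω => ?_⟩
  rw [noiseSum, ← Finset.sum_coe_sort]
  simp

theorem integral_noiseSum_pow (M : ℕ) (b : ℕ → ℝ) (r : ℕ) :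
    ∫ ω, noiseSum M b ω ^ r ∂whiteNoise = gaussMom (∑ m ∈ Finset.range M, b m ^ 2) r := by
  have hG := (isGaussianProcess_noiseSum (fun _ : Unit => M) fun _ => b).hasGaussianLaw_eval ()
  have h := hG.map_eq_gaussianReal
  have hm := hG.aemeasurable
  beta_reduce at h hm
  have hv : Var[noiseSum M b; whiteNoise] = ∑ m ∈ Finset.range M, b m ^ 2 := by
    rw [← covariance_self hm, covariance_noiseSum]
    exact Finset.sum_congr rfl fun m _ => (sq _).symm
  have h0 : whiteNoise[noiseSum M b] = 0 := integral_noiseSum M b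
  rw [h0] at h
  rw [← integral_map (f := fun x : ℝ => x ^ r) hm (by fun_prop), h, integral_pow_gaussianReal,
    Real.coe_toNNReal _ (variance_nonneg _ _), hv]

end WhiteNoise

/-! ### The limiting Gaussian process. -/

section LimitProcess

/-- The limiting Gaussian process. -/
noncomputable def limitProcess (c : ℝ) (k : ℕ) : (ℕ → ℝ) → ℝ :=
  noiseSum k fun m => if m = 0 then 0 else laurentCoeff c k (m + 1) * √((m + 1) * c ^ (m + 1))

theorem limitProcess_eq (c : ℝ) {k M : ℕ} (h : k ≤ M) : limitProcess c k = noiseSum M fun m =>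
    if m = 0 then 0 else laurentCoeff c k (m + 1) * √((m + 1) * c ^ (m + 1)) := by
  funext ω
  refine Finset.sum_subset (Finset.range_subset_range.2 h) fun m _ hm => ?_
  rw [Finset.mem_range, not_lt] at hm
  simp [laurentCoeff_eq_zero c (show k < m + 1 by omega)]

theorem sum_limitProcess (c : ℝ) {ι : Type*} (S : Finset ι) (k : ι → ℕ) {M : ℕ}
    (h : ∀ j ∈ S, k j ≤ M) (ω : ℕ → ℝ) : ∑ j ∈ S, limitProcess c (k j) ω = noiseSum M (fun m =>
      if m = 0 then 0 else (∑ j ∈ S, laurentCoeff c (k j) (m + 1)) * √((m + 1) * c ^ (m + 1))) ω := by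
  rw [Finset.sum_congr rfl fun j hj => congrFun (limitProcess_eq c (h j hj)) ω]
  unfold noiseSum
  rw [Finset.sum_comm]
  refine Finset.sum_congr rfl fun m _ => ?_
  beta_reduce
  rw [← Finset.sum_mul]
  split_ifs <;> simp [Finset.sum_mul]

variable {c : ℝ}

theorem covariance_limitProcess (hc : 0 < c) {k₁ k₂ M : ℕ} (h₁ : k₁ ≤ M) (h₂ : k₂ ≤ M) :
    cov[limitProcess c k₁, limitProcess c k₂; whiteNoise] = ∑ m ∈ Finset.range M,
      if m = 0 then 0 else
        laurentCoeff c k₁ (m + 1) * laurentCoeff c k₂ (m + 1) * ((m + 1) * c ^ (m + 1)) := by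
  rw [limitProcess_eq c h₁, limitProcess_eq c h₂, covariance_noiseSum]
  refine Finset.sum_congr rfl fun m _ => ?_
  split_ifs
  · simp
  · have := Real.mul_self_sqrt (show 0 ≤ ((m : ℝ) + 1) * c ^ (m + 1) by positivity)
    linear_combination laurentCoeff c k₁ (m + 1) * laurentCoeff c k₂ (m + 1) * this

theorem integral_sum_limitProcess_pow (hc : 0 < c) {ι : Type*} (S : Finset ι) (k : ι → ℕ) {M : ℕ}
    (h : ∀ j ∈ S, k j ≤ M) (r : ℕ) : ∫ ω, (∑ j ∈ S, limitProcess c (k j) ω) ^ r ∂whiteNoise =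
      gaussMom (combVar (fun m => ∑ j ∈ S, laurentCoeff c (k j) (m + 1)) M c) r := by
  simp only [sum_limitProcess c S k h]
  rw [integral_noiseSum_pow, combVar]
  congr 1
  refine Finset.sum_congr rfl fun m _ => ?_
  split_ifs
  · simp
  · rw [mul_pow, Real.sq_sqrt (by positivity)]

theorem integrable_sum_limitProcess_pow {ι : Type*} (S : Finset ι) (k : ι → ℕ) (r : ℕ) :
    Integrable (fun ω => (∑ j ∈ S, limitProcess c (k j) ω) ^ r) whiteNoise := by
  have hG := (isGaussianProcess_noiseSum (fun k : ℕ => k) fun (k m : ℕ) =>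
    if m = 0 then 0 else laurentCoeff c k (m + 1) * √((m + 1) * c ^ (m + 1)))
  have h2 : ∀ j, MemLp (limitProcess c (k j)) r whiteNoise := fun j =>
    (hG.hasGaussianLaw_eval (k j)).memLp (by simp)
  have h3 : MemLp (fun ω => ∑ j ∈ S, limitProcess c (k j) ω) r whiteNoise :=
    memLp_finsetSum _ fun j _ => h2 j
  rcases Nat.eq_zero_or_pos r with rfl | hr
  · simp
  · have := h3.integrable_norm_pow hr.ne'
    refine (integrable_norm_iff (h3.aestronglyMeasurable.pow r)).1 ?_
    simpa using this

/-- Polarized exactly as in `tendsto_integral_prod`, so the two formulas agree term by term and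
Wick's formula is not needed. -/
theorem integral_prod_limitProcess (hc : 0 < c) {r : ℕ} (k : Fin r → ℕ) {M : ℕ} (hM : ∀ j, k j ≤ M) :
    ∫ ω, ∏ j, limitProcess c (k j) ω ∂whiteNoise =
      ((-1) ^ r * (r.factorial : ℝ))⁻¹ * ∑ S : Finset (Fin r), (-1) ^ S.card *
        gaussMom (combVar (fun m => ∑ j ∈ S, laurentCoeff c (k j) (m + 1)) M c) r := by
  have h0 : ((-1) ^ r * (r.factorial : ℝ)) ≠ 0 := by positivity
  simp only [← integral_sum_limitProcess_pow hc _ k (fun j _ => hM j), ← integral_const_mul]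
  rw [← integral_finsetSum _ fun S _ => (integrable_sum_limitProcess_pow S k r).const_mul _,
    ← integral_const_mul]
  refine integral_congr_ae (Eventually.of_forall fun ω => ?_)
  beta_reduce
  rw [sum_powerset_neg_one_mul_sum_pow, inv_mul_cancel_left₀ h0]

end LimitProcess

/-! ### Evaluation of the double contour integral. -/

section Contour

open Complex in
theorem circleIntegral_pow_mul_inv_pow {R : ℝ} (hR : 0 < R) (m j : ℕ) :
    (∮ w in C(0, R), (w⁻¹) ^ (j + 1) * w ^ m) = if m = j then 2 * Real.pi * I else 0 := by
  have h : (∮ w in C(0, R), (w⁻¹) ^ (j + 1) * w ^ m) = ∮ w in C(0, R), (w - 0) ^ ((m : ℤ) - j - 1) := by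
    refine circleIntegral.integral_congr hR.le fun w hw => ?_
    have hw0 : w ≠ 0 := Metric.ne_of_mem_sphere hw hR.ne'
    rw [sub_zero, show (m : ℤ) - j - 1 = m - (j + 1 : ℕ) by push_cast; ring, zpow_sub₀ hw0,
      zpow_natCast, zpow_natCast, inv_pow]
    ring
  rw [h]
  split_ifs with hm
  · subst hm
    have := circleIntegral.integral_sub_center_inv 0 hR.ne'
    simpa using this
  · exact circleIntegral.integral_sub_zpow_of_ne (by omega) 0 0 R

theorem circleIntegral_pow (R : ℝ) (m : ℕ) : (∮ w in C(0, R), w ^ m) = 0 := by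
  have := circleIntegral.integral_sub_zpow_of_ne (n := m) (by omega) 0 0 R
  simpa using this

section Kernel

variable {R : ℝ} {z : ℂ}

theorem continuousOn_inv_sphere (hR : 0 < R) :
    ContinuousOn (fun w : ℂ => w⁻¹) (Metric.sphere 0 R) :=
  continuousOn_inv₀.mono fun _ hw => Metric.ne_of_mem_sphere hw hR.ne'

theorem sub_ne_zero_of_mem_sphere (hz : z ∈ Metric.ball (0 : ℂ) R) {w : ℂ}
    (hw : w ∈ Metric.sphere (0 : ℂ) R) : w - z ≠ 0 := by
  rw [sub_ne_zero]
  rintro rfl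
  exact (Metric.mem_ball.1 hz).ne hw

theorem continuousOn_kernel (hz : z ∈ Metric.ball (0 : ℂ) R) :
    ContinuousOn (fun w : ℂ => (w - z)⁻¹) (Metric.sphere 0 R) :=
  (continuousOn_id.sub continuousOn_const).inv₀ fun _ hw => sub_ne_zero_of_mem_sphere hz hw

theorem circleIntegral_pow_mul_kernel (hR : 0 < R) (hz : z ∈ Metric.ball (0 : ℂ) R) (n : ℕ) :
    (∮ w in C(0, R), w ^ n * (w - z)⁻¹) = 2 * Real.pi * Complex.I * z ^ n := by
  have hk := continuousOn_kernel hz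
  induction n with
  | zero => simpa using circleIntegral.integral_sub_inv_of_mem_ball hz
  | succ n ih =>
    have h : (∮ w in C(0, R), w ^ (n + 1) * (w - z)⁻¹) =
        ∮ w in C(0, R), (w ^ n + z * (w ^ n * (w - z)⁻¹)) := by
      refine circleIntegral.integral_congr hR.le fun w hw => ?_
      have := sub_ne_zero_of_mem_sphere hz hw
      field_simp
      ring
    rw [h, circleIntegral.integral_add, circleIntegral.integral_const_mul, ih, circleIntegral_pow]
    · ring
    · exact (by fun_prop : ContinuousOn _ _).circleIntegrable hR.le
    · exact (by fun_prop : ContinuousOn _ _).circleIntegrable hR.le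

/-- From `w⁻¹ (w - z)⁻¹ = z⁻¹ ((w - z)⁻¹ - w⁻¹)`: for `p = 0` the residues at `0` and `z` cancel,
and higher powers reduce to this case. -/
theorem circleIntegral_inv_pow_mul_kernel (hR : 0 < R) (hz : z ∈ Metric.ball (0 : ℂ) R)
    (hz0 : z ≠ 0) (p : ℕ) : (∮ w in C(0, R), (w⁻¹) ^ (p + 1) * (w - z)⁻¹) = 0 := by
  have hk := continuousOn_kernel hz
  have hi := continuousOn_inv_sphere hR
  have h : ∀ p : ℕ, (∮ w in C(0, R), (w⁻¹) ^ (p + 1) * (w - z)⁻¹) =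
      z⁻¹ * ((∮ w in C(0, R), (w⁻¹) ^ p * (w - z)⁻¹) - if 0 = p then 2 * Real.pi * Complex.I else 0) := by
    intro p
    have h : (∮ w in C(0, R), (w⁻¹) ^ (p + 1) * (w - z)⁻¹) =
        ∮ w in C(0, R), z⁻¹ * ((w⁻¹) ^ p * (w - z)⁻¹ - (w⁻¹) ^ (p + 1) * w ^ 0) := by
      refine circleIntegral.integral_congr hR.le fun w hw => ?_
      have := sub_ne_zero_of_mem_sphere hz hw
      have hw0 : w ≠ 0 := Metric.ne_of_mem_sphere hw hR.ne'
      rw [pow_succ]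
      field_simp
      ring
    rw [h, circleIntegral.integral_const_mul, circleIntegral.integral_sub,
      circleIntegral_pow_mul_inv_pow hR]
    · exact (by fun_prop : ContinuousOn _ _).circleIntegrable hR.le
    · exact (by fun_prop : ContinuousOn _ _).circleIntegrable hR.le
  induction p with
  | zero =>
    have := circleIntegral_pow_mul_kernel hR hz 0
    simp only [pow_zero, mul_one] at this
    rw [h, if_pos rfl]
    simp only [pow_zero, this, sub_self, mul_zero]
  | succ p ih => rw [h, ih, if_neg (by omega)]; simp

/-- Writing `w = (w - z) + z` lowers the power of `w`; the integral of `(w - z)⁻²` itself vanishes.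
-/
theorem circleIntegral_pow_mul_kernel_sq (hR : 0 < R) (hz : z ∈ Metric.ball (0 : ℂ) R) :
    (∮ w in C(0, R), ((w - z)⁻¹) ^ 2) = 0 ∧ ∀ n : ℕ, (∮ w in C(0, R), w ^ (n + 1) * ((w - z)⁻¹) ^ 2) =
      2 * Real.pi * Complex.I * ((n + 1) * z ^ n) := by
  have hk := continuousOn_kernel hz
  have h : ∀ n : ℕ, (∮ w in C(0, R), w ^ (n + 1) * ((w - z)⁻¹) ^ 2) =
      2 * Real.pi * Complex.I * z ^ n + z * ∮ w in C(0, R), w ^ n * ((w - z)⁻¹) ^ 2 := by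
    intro n
    have h : (∮ w in C(0, R), w ^ (n + 1) * ((w - z)⁻¹) ^ 2) =
        ∮ w in C(0, R), (w ^ n * (w - z)⁻¹ + z * (w ^ n * ((w - z)⁻¹) ^ 2)) := by
      refine circleIntegral.integral_congr hR.le fun w hw => ?_
      have := sub_ne_zero_of_mem_sphere hz hw
      field_simp
      ring
    rw [h, circleIntegral.integral_add, circleIntegral.integral_const_mul,
      circleIntegral_pow_mul_kernel hR hz]
    · exact (by fun_prop : ContinuousOn _ _).circleIntegrable hR.le
    · exact (by fun_prop : ContinuousOn _ _).circleIntegrable hR.le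
  have h0 : (∮ w in C(0, R), ((w - z)⁻¹) ^ 2) = 0 := by
    have := circleIntegral.integral_sub_zpow_of_ne (n := -2) (by omega) 0 z R
    rw [← this]
    congr 1
    funext w
    rw [inv_pow]
    rfl
  refine ⟨h0, fun n => ?_⟩
  induction n with
  | zero =>
    rw [h]
    simp only [pow_zero, one_mul, h0]
    simp
  | succ n ih => rw [h, ih]; push_cast; ring

theorem circleIntegral_inv_pow_mul_kernel_sq (hR : 0 < R) (hz : z ∈ Metric.ball (0 : ℂ) R)
    (hz0 : z ≠ 0) (p : ℕ) : (∮ w in C(0, R), (w⁻¹) ^ p * ((w - z)⁻¹) ^ 2) = 0 := by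
  have hk := continuousOn_kernel hz
  have hi := continuousOn_inv_sphere hR
  induction p with
  | zero => simpa using (circleIntegral_pow_mul_kernel_sq hR hz).1
  | succ p ih =>
    have h : (∮ w in C(0, R), (w⁻¹) ^ (p + 1) * ((w - z)⁻¹) ^ 2) = ∮ w in C(0, R),
        z⁻¹ * ((w⁻¹) ^ p * ((w - z)⁻¹) ^ 2 - (w⁻¹) ^ (p + 1) * (w - z)⁻¹) := by
      refine circleIntegral.integral_congr hR.le fun w hw => ?_
      have := sub_ne_zero_of_mem_sphere hz hw
      have hw0 : w ≠ 0 := Metric.ne_of_mem_sphere hw hR.ne'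
      rw [pow_succ]
      field_simp
      ring
    rw [h, circleIntegral.integral_const_mul, circleIntegral.integral_sub, ih,
      circleIntegral_inv_pow_mul_kernel hR hz hz0]
    · simp
    · exact (by fun_prop : ContinuousOn _ _).circleIntegrable hR.le
    · exact (by fun_prop : ContinuousOn _ _).circleIntegrable hR.le

end Kernel

variable {R : ℝ}

theorem laurent_pow_eq (c : ℂ) {k M : ℕ} (h : k ≤ M) {z : ℂ} (hz : z ≠ 0) :
    (1 / z + 1 + c + c * z) ^ k = laurentCoeff c k 0 + ∑ m ∈ Finset.range M,
      laurentCoeff c k (m + 1) * ((z⁻¹) ^ (m + 1) + c ^ (m + 1) * z ^ (m + 1)) := by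
  have e : 1 / z + 1 + c + c * z = (z⁻¹ + c * z) + 1 + c := by rw [one_div]; ring
  have e2 : c = z⁻¹ * (c * z) := by field_simp
  have e3 : ∀ m, dicksonD (z⁻¹ + c * z) c m = (z⁻¹) ^ m + c ^ m * z ^ m := fun m => by
    have h1 := dicksonD_add_mul (z⁻¹) (c * z) m
    rwa [← e2, mul_pow] at h1
  rw [e, pow_eq_sum_laurentCoeff _ _ h]
  simp only [e3]

theorem circleIntegral_laurent_mul (hR : 0 < R) (c : ℂ) {k M : ℕ} (h : k ≤ M) {g : ℂ → ℂ}
    (hg : ContinuousOn g (Metric.sphere 0 R)) :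
    (∮ w in C(0, R), (1 / w + 1 + c + c * w) ^ k * g w) =
      laurentCoeff c k 0 * (∮ w in C(0, R), g w) + ∑ m ∈ Finset.range M,
        laurentCoeff c k (m + 1) * ((∮ w in C(0, R), (w⁻¹) ^ (m + 1) * g w) +
          c ^ (m + 1) * ∮ w in C(0, R), w ^ (m + 1) * g w) := by
  have hi := continuousOn_inv_sphere hR
  have h1 : (∮ w in C(0, R), (1 / w + 1 + c + c * w) ^ k * g w) = ∮ w in C(0, R),
      (laurentCoeff c k 0 * g w + ∑ m ∈ Finset.range M,
        laurentCoeff c k (m + 1) * ((w⁻¹) ^ (m + 1) * g w + c ^ (m + 1) * (w ^ (m + 1) * g w))) := by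
    refine circleIntegral.integral_congr hR.le fun w hw => ?_
    rw [laurent_pow_eq c h (Metric.ne_of_mem_sphere hw hR.ne'), add_mul, Finset.sum_mul]
    congr 1
    exact Finset.sum_congr rfl fun m _ => by ring
  rw [h1, circleIntegral.integral_add, circleIntegral.integral_const_mul,
    circleIntegral.integral_fun_sum]
  · congr 1
    refine Finset.sum_congr rfl fun m _ => ?_
    rw [circleIntegral.integral_const_mul, circleIntegral.integral_add,
      circleIntegral.integral_const_mul]
    · exact (by fun_prop : ContinuousOn _ _).circleIntegrable hR.le
    · exact (by fun_prop : ContinuousOn _ _).circleIntegrable hR.le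
  · intro m _
    exact (by fun_prop : ContinuousOn _ _).circleIntegrable hR.le
  · exact (by fun_prop : ContinuousOn _ _).circleIntegrable hR.le
  · exact (by fun_prop : ContinuousOn _ _).circleIntegrable hR.le

theorem circleIntegral_laurent_mul_pow (hR : 0 < R) (c : ℂ) (k m : ℕ) :
    (∮ w in C(0, R), (1 / w + 1 + c + c * w) ^ k * w ^ m) =
      2 * Real.pi * Complex.I * laurentCoeff c k (m + 1) := by
  rw [circleIntegral_laurent_mul hR c (M := max k (m + 1)) (le_max_left _ _) (by fun_prop)]
  simp only [circleIntegral_pow, circleIntegral_pow_mul_inv_pow hR, ← pow_add, mul_zero, add_zero,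
    zero_add]
  rw [Finset.sum_eq_single_of_mem m (by simp)]
  · simp; ring
  · intro j _ hj; simp [hj.symm]

/-- For `z` inside the circle, negative powers of `w` integrate to zero against `(w - z)⁻²`, and `w
^ (m + 1)` gives its derivative `(m + 1) z ^ m` at `z`. -/
theorem circleIntegral_laurent_mul_kernel (hR : 0 < R) (c : ℂ) {k M : ℕ} (h : k ≤ M) (hM : 0 < M)
    {z : ℂ} (hz : z ∈ Metric.ball (0 : ℂ) R) (hz0 : z ≠ 0) :
    (∮ w in C(0, R), (1 / w + 1 + c + c * w) ^ k * (-c + 1 / (z - w) ^ 2)) =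
      2 * Real.pi * Complex.I * ∑ m ∈ Finset.range M, if m = 0 then 0 else
        laurentCoeff c k (m + 1) * (c ^ (m + 1) * (m + 1)) * z ^ m := by
  have hk := continuousOn_kernel hz
  have hi := continuousOn_inv_sphere hR
  have h1 : (∮ w in C(0, R), (1 / w + 1 + c + c * w) ^ k * (-c + 1 / (z - w) ^ 2)) =
      ∮ w in C(0, R), ((-c) * ((1 / w + 1 + c + c * w) ^ k * w ^ 0) +
        (1 / w + 1 + c + c * w) ^ k * ((w - z)⁻¹) ^ 2) := by
    refine circleIntegral.integral_congr hR.le fun w hw => ?_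
    rw [← neg_sub w z, neg_sq, inv_pow]
    ring
  have hL : ContinuousOn (fun w : ℂ => (1 / w + 1 + c + c * w) ^ k) (Metric.sphere 0 R) := by
    simp only [one_div]; fun_prop
  rw [h1, circleIntegral.integral_add, circleIntegral.integral_const_mul]
  · rw [circleIntegral_laurent_mul_pow hR, circleIntegral_laurent_mul hR c h (by fun_prop)]
    obtain ⟨h0, hp⟩ := circleIntegral_pow_mul_kernel_sq hR hz
    simp only [h0, hp, circleIntegral_inv_pow_mul_kernel_sq hR hz hz0]
    obtain ⟨M, rfl⟩ : ∃ j, M = j + 1 := ⟨M - 1, by omega⟩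
    -- The term `m = 0` is isolated: there the kernel contributes `c` times the first Laurent
    -- coefficient, which the constant `-c` cancels.
    rw [Finset.sum_range_succ', Finset.sum_range_succ']
    simp only [Nat.add_one_ne_zero, if_false, if_true, mul_add, Finset.mul_sum]
    push_cast
    ring_nf
    exact Finset.sum_congr rfl fun m _ => by ring
  · exact (by fun_prop : ContinuousOn _ _).circleIntegrable hR.le
  · exact (by fun_prop : ContinuousOn _ _).circleIntegrable hR.le

/-- Evaluation of the double contour integral. -/
theorem schurWeylCovariance_eq (c : ℝ) {ε : ℝ} (hε : 0 < ε) {k₁ k₂ M : ℕ}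
    (h₂ : k₂ ≤ M) (hM : 0 < M) : schurWeylCovariance c ε k₁ k₂ =
      ((∑ m ∈ Finset.range M, if m = 0 then 0 else
        laurentCoeff c k₁ (m + 1) * laurentCoeff c k₂ (m + 1) * ((m + 1) * c ^ (m + 1)) : ℝ) : ℂ) := by
  have hi := continuousOn_inv_sphere hε
  have hl : ∀ k m, ((laurentCoeff c k m : ℝ) : ℂ) = laurentCoeff (c : ℂ) k m := fun k m =>
    map_laurentCoeff Complex.ofRealHom c k m
  have hpi : (2 * Real.pi * Complex.I : ℂ) ≠ 0 := Complex.two_pi_I_ne_zero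
  have h1 : (∮ z in C(0, ε), ∮ w in C(0, 2 * ε), (1 / z + 1 + c + c * z) ^ k₁ *
      (1 / w + 1 + c + c * w) ^ k₂ * (-c + 1 / (z - w) ^ 2)) = ∮ z in C(0, ε),
      ∑ m ∈ Finset.range M, (2 * Real.pi * Complex.I * if m = 0 then 0 else
        laurentCoeff (c : ℂ) k₂ (m + 1) * (c ^ (m + 1) * (m + 1))) *
          ((1 / z + 1 + c + c * z) ^ k₁ * z ^ m) := by
    refine circleIntegral.integral_congr hε.le fun z hz => ?_
    have hz0 : z ≠ 0 := Metric.ne_of_mem_sphere hz hε.ne'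
    have hzb : z ∈ Metric.ball (0 : ℂ) (2 * ε) := by
      rw [Metric.mem_ball, Metric.mem_sphere.1 hz]; linarith
    simp only [mul_assoc]
    rw [circleIntegral.integral_const_mul,
      circleIntegral_laurent_mul_kernel (by linarith) _ h₂ hM hzb hz0, Finset.mul_sum, Finset.mul_sum]
    refine Finset.sum_congr rfl fun m _ => ?_
    split_ifs
    · simp
    · ring
  rw [schurWeylCovariance, h1, circleIntegral.integral_fun_sum]
  · simp only [circleIntegral.integral_const_mul, circleIntegral_laurent_mul_pow hε, ← hl]
    push_cast
    rw [Finset.mul_sum]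
    refine Finset.sum_congr rfl fun m _ => ?_
    split_ifs
    · simp
    · push_cast
      field_simp
  · intro m _
    simp only [one_div]
    exact (by fun_prop : ContinuousOn _ _).circleIntegrable hε.le

end Contour

/-! ### Joint moments and covariance of the power sums. -/

section Conclusion

variable {c : ℝ}

theorem tendsto_integral_prod_normalizedMoment (hc : 0 < c) {r : ℕ} (k : Fin r → ℕ) :
    Tendsto (fun N : ℕ => ∫ lam, ∏ j,
        normalizedMoment (schurWeylMeasure N ⌊c * (N : ℝ) ^ 2⌋₊) (k j) lam
          ∂(schurWeylMeasure N ⌊c * (N : ℝ) ^ 2⌋₊)) atTop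
      (𝓝 (∫ ω, ∏ j, limitProcess c (k j) ω ∂whiteNoise)) := by
  have hM : ∀ j, k j ≤ ∑ j, k j := fun j =>
    Finset.single_le_sum (f := k) (fun _ _ => Nat.zero_le _) (Finset.mem_univ j)
  rw [integral_prod_limitProcess hc k hM]
  exact tendsto_integral_prod hc k hM

theorem isGaussianProcess_limitProcess :
    IsGaussianProcess (fun k : ℕ+ => limitProcess c k) whiteNoise :=
  isGaussianProcess_noiseSum (fun k : ℕ+ => (k : ℕ)) fun (k : ℕ+) (m : ℕ) =>
    if m = 0 then 0 else laurentCoeff c k (m + 1) * √((m + 1) * c ^ (m + 1))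

theorem integral_limitProcess (k : ℕ) : ∫ ω, limitProcess c k ω ∂whiteNoise = 0 :=
  integral_noiseSum _ _

theorem covariance_limitProcess_eq (hc : 0 < c) {ε : ℝ} (hε : 0 < ε) (k₁ k₂ : ℕ+) :
    ((cov[limitProcess c k₁, limitProcess c k₂; whiteNoise] : ℝ) : ℂ) =
      schurWeylCovariance c ε k₁ k₂ := by
  have hM : (k₂ : ℕ) ≤ (k₁ : ℕ) + k₂ := Nat.le_add_left _ _
  rw [schurWeylCovariance_eq c hε hM (by have := k₁.pos; omega),
    covariance_limitProcess hc (Nat.le_add_right _ _) hM]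

/-- The case `r = 2` of the convergence of joint moments, both sides being centred. -/
theorem tendsto_covariance_powerSum (hc : 0 < c) (k₁ k₂ : ℕ) :
    Tendsto (fun N : ℕ => cov[powerSum k₁, powerSum k₂; schurWeylMeasure N ⌊c * (N : ℝ) ^ 2⌋₊] /
        (N : ℝ) ^ (k₁ + k₂)) atTop
      (𝓝 (cov[limitProcess c k₁, limitProcess c k₂; whiteNoise])) := by
  have h := tendsto_integral_prod_normalizedMoment hc ![k₁, k₂]
  simp only [Fin.prod_univ_two, Matrix.cons_val_zero, Matrix.cons_val_one] at h
  have h2 : cov[limitProcess c k₁, limitProcess c k₂; whiteNoise] =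
      ∫ ω, limitProcess c k₁ ω * limitProcess c k₂ ω ∂whiteNoise := by
    simp only [covariance, integral_limitProcess, sub_zero]
  rw [h2]
  refine h.congr fun N => ?_
  rw [covariance, ← integral_div]
  refine integral_congr_ae (Eventually.of_forall fun lam => ?_)
  simp only [normalizedMoment]
  rw [div_mul_div_comm, pow_add]

end Conclusion

theorem theorem3p5 (c : ℝ) (hc : 0 < c) :
    (∀ N : ℕ, 1 ≤ N → IsProbabilityMeasure (schurWeylMeasure N ⌊c * (N : ℝ) ^ 2⌋₊)) ∧
    -- the limiting covariance
    (∀ ε : ℝ, 0 < ε → ∀ k₁ k₂ : ℕ+,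
      Tendsto
        (fun N : ℕ =>
          ((cov[powerSum (k₁ : ℕ), powerSum (k₂ : ℕ);
              schurWeylMeasure N ⌊c * (N : ℝ) ^ 2⌋₊] / (N : ℝ) ^ ((k₁ : ℕ) + (k₂ : ℕ)) : ℝ) : ℂ))
        atTop (𝓝 (schurWeylCovariance c ε k₁ k₂))) ∧
    -- convergence in the sense of moments to a centered Gaussian vector with this covariance
    ∃ (Ω : Type) (_ : MeasurableSpace Ω) (P : Measure Ω) (ξ : ℕ+ → Ω → ℝ),
      IsProbabilityMeasure P ∧ IsGaussianProcess ξ P ∧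
      (∀ k : ℕ+, ∫ ω, ξ k ω ∂P = 0) ∧
      (∀ ε : ℝ, 0 < ε → ∀ k₁ k₂ : ℕ+,
        ((cov[ξ k₁, ξ k₂; P] : ℝ) : ℂ) = schurWeylCovariance c ε k₁ k₂) ∧
      ∀ (r : ℕ) (k : Fin r → ℕ+),
        Tendsto
          (fun N : ℕ =>
            ∫ lam, ∏ j, normalizedMoment (schurWeylMeasure N ⌊c * (N : ℝ) ^ 2⌋₊) (k j) lam
              ∂(schurWeylMeasure N ⌊c * (N : ℝ) ^ 2⌋₊))
          atTop (𝓝 (∫ ω, ∏ j, ξ (k j) ω ∂P)) := by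
  refine ⟨fun N hN => isProbabilityMeasure_schurWeyl hN, fun ε hε k₁ k₂ => ?_, ℕ → ℝ, inferInstance,
    whiteNoise, fun k => limitProcess c k, inferInstance, isGaussianProcess_limitProcess,
    fun k => integral_limitProcess k, fun ε hε k₁ k₂ => covariance_limitProcess_eq hc hε k₁ k₂,
    fun r k => tendsto_integral_prod_normalizedMoment hc fun j => (k j : ℕ)⟩
  rw [← covariance_limitProcess_eq hc hε]
  exact (Complex.continuous_ofReal.tendsto _).comp (tendsto_covariance_powerSum hc k₁ k₂)
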